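/- Let $X$ be a connected, oriented, smooth surface, let $\lambda\in\mathbb{R}\setminus\{0\}$, let $(x_u,x_v)$ be the Cartesian coordinates of $\mathbb{R}^2$, and let $g$ be a smooth Lorentzian metric on $M=\mathbb{R}^2\times X$ of signature $(-,+,+,+)$. All families indexed by $x_u\in\mathbb{R}$ are smooth in $(x_u,x)\in\mathbb{R}\times X$, and $a\odot b=a\otimes b+b\otimes a$. A bundle of irreducible real spinors on $(M,g)$ is a real rank-four vector bundle $S$, associated with a spin structure, with Clifford multiplication $v\cdot v\cdot\varepsilon=g(v,v)\,\varepsilon$, spin-invariant non-degenerate pairing $\langle\cdot,\cdot\rangle$, $\langle v\cdot\varepsilon,\eta\rangle=-\langle\varepsilon,v\cdot\eta\rangle$, and the connection $\nabla^g$ induced by the Levi-Civita connection. A spinor $\varepsilon\in\Gamma(S)$ is Killing with constant $\lambda$ if $\nabla^g_v\varepsilon=\frac{\lambda}{2}v\cdot\varepsilon$ for all $v$; its Dirac current is the one-form $u(v)=\langle\varepsilon,v\cdot\varepsilon\rangle$. The triple $(M,g,\varepsilon)$ is a standard supersymmetric Kundt configuration if $\varepsilon$ is a Killing spinor with constant $\lambda$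 that is adapted, i.e. $u^{\sharp}=\partial_{x_v}$, and $$g=\mathcal{H}_{x_u}\,dx_u\otimes dx_u+e^{\mathcal{F}_{x_u}}dx_u\odot dx_v+dx_u\odot\alpha_{x_u}+q_{x_u}$$ for families of functions $\mathcal{H}_{x_u},\mathcal{F}_{x_u}$, of one-forms $\alpha_{x_u}$ and of complete Riemannian metrics $q_{x_u}$ on $X$. **Theorem.** There are a bundle of irreducible real spinors on $(M,g)$ and a section $\varepsilon$ of it such that $(M,g,\varepsilon)$ is a standard supersymmetric Kundt configuration if and only if there are families of functions $\mathcal{H}_{x_u},\mathcal{F}_{x_u}$, of closed one-forms $\omega_{x_u}$ and of one-forms $\beta_{x_u}$ on $X$ such that $$g=\mathcal{H}_{x_u}\,dx_u\otimes dx_u+e^{\mathcal{F}_{x_u}}dx_u\odot(dx_v+\beta_{x_u})+\frac{1}{4\lambda^2}d_X\mathcal{F}_{x_u}\otimes d_X\mathcal{F}_{x_u}+e^{\mathcal{F}_{x_u}}\omega_{x_u}\otimes\omega_{x_u},$$ where, for every $x_u\in\mathbb{R}$, the tensor $$q_{x_u}=\frac{1}{4\lambda^2}d_X\mathcal{F}_{x_u}\otimes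 d_X\mathcal{F}_{x_u}+e^{\mathcal{F}_{x_u}}\omega_{x_u}\otimes\omega_{x_u}$$ is a complete Riemannian metric on $X$, with Hodge star $\ast_{q_{x_u}}$ and volume form $\nu_{q_{x_u}}$, and $$d_X\beta_{x_u}=\frac{e^{-\mathcal{F}_{x_u}}}{4\lambda^2}\left\langle\partial_{x_u}\!\ast_{q_{x_u}}\!d_X\mathcal{F}_{x_u}+\ast_{q_{x_u}}\partial_{x_u}d_X\mathcal{F}_{x_u},\,d_X\mathcal{F}_{x_u}\right\rangle_{q_{x_u}}\nu_{q_{x_u}}.$$ In that case, for every $x_u\in\mathbb{R}$, the surface $(X,q_{x_u})$ is an elementary hyperbolic surface of scalar curvature $-2\lambda^2$, that is, it is isometric to the upper half-plane with the metric $\frac{dx^2+dy^2}{\lambda^2y^2}$ or to its quotient by the cyclic group generated by $z\mapsto e^{l}z$ for some $l>0$ (a hyperbolic cylinder) or by $z\mapsto z+1$ (the parabolic cylinder); hence $X$ is diffeomorphic to $\mathbb{R}^2$ or to $\mathbb{R}\times S^1$. -/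

import Mathlib

open Bundle Filter Topology Manifold
open scoped ContDiff ENNReal

noncomputable section

namespace SusyKundt

/-! ### Manifolds, tensors and connections -/

/-- The model space of surfaces. -/
abbrev E2 : Type := EuclideanSpace ℝ (Fin 2)

/-- The model fibre of real spinor bundles. -/
abbrev E4 : Type := EuclideanSpace ℝ (Fin 4)

/-- The model of surfaces (without boundary). -/
abbrev IX : ModelWithCorners ℝ E2 E2 := 𝓘(ℝ, E2)

/-- The model of the four-manifolds `ℝ × ℝ × X`. -/
abbrev IM : ModelWithCorners ℝ (ℝ × ℝ × E2) (ModelProd ℝ (ModelProd ℝ E2)) :=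
  𝓘(ℝ, ℝ).prod (𝓘(ℝ, ℝ).prod IX)

section General

variable {E : Type*} [NormedAddCommGroup E] [NormedSpace ℝ E]
  {H : Type*} [TopologicalSpace H] (I : ModelWithCorners ℝ E H)
  {M : Type*} [TopologicalSpace M] [ChartedSpace H M] [IsManifold I ∞ M]

/-- `η = dθ` for a one-form `θ`, by the invariant formula
`dθ(V, W) = V(θ(W)) - W(θ(V)) - θ([V, W])`. -/
def IsExtDeriv (θ : ∀ x : M, TangentSpace I x →L[ℝ] ℝ)
    (η : ∀ x : M, TangentSpace I x →L[ℝ] TangentSpace I x →L[ℝ] ℝ) : Prop :=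
  ∀ (x : M) (V W : ∀ y : M, TangentSpace I y),
    MDifferentiableAt I I.tangent (fun y ↦ (V y : TangentBundle I M)) x →
    MDifferentiableAt I I.tangent (fun y ↦ (W y : TangentBundle I M)) x →
    η x (V x) (W x) = mvfderiv I (fun y ↦ θ y (W y)) x (V x)
      - mvfderiv I (fun y ↦ θ y (V y)) x (W x) - θ x (VectorField.mlieBracket I V W x)

/-- `nab` is the Levi-Civita connection of the (possibly indefinite) metric `g`: it is torsion-free
and metric.  Here `nab V x v` stands for `∇_v V`. -/
structure IsLeviCivita (g : ∀ x : M, TangentSpace I x →L[ℝ] TangentSpace I x →L[ℝ] ℝ)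
    (nab : CovariantDerivative I E (TangentSpace I : M → Type _)) : Prop where
  torsion_free : ∀ (x : M) (V W : ∀ y : M, TangentSpace I y),
    MDifferentiableAt I I.tangent (fun y ↦ (V y : TangentBundle I M)) x →
    MDifferentiableAt I I.tangent (fun y ↦ (W y : TangentBundle I M)) x →
    nab W x (V x) - nab V x (W x) = VectorField.mlieBracket I V W x
  metric : ∀ (x : M) (V W : ∀ y : M, TangentSpace I y),
    MDifferentiableAt I I.tangent (fun y ↦ (V y : TangentBundle I M)) x →
    MDifferentiableAt I I.tangent (fun y ↦ (W y : TangentBundle I M)) x →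
    ∀ v : TangentSpace I x, mvfderiv I (fun y ↦ g y (V y) (W y)) x v
      = g x (nab V x v) (W x) + g x (V x) (nab W x v)

/-- The curvature `R(V, W)Z = ∇_V ∇_W Z - ∇_W ∇_V Z - ∇_[V, W] Z`. -/
def curvature (nab : CovariantDerivative I E (TangentSpace I : M → Type _))
    (V W Z : ∀ y : M, TangentSpace I y) (x : M) : TangentSpace I x :=
  nab (fun y ↦ nab Z y (W y)) x (V x) - nab (fun y ↦ nab Z y (V y)) x (W x)
    - nab Z x (VectorField.mlieBracket I V W x)

/-- A smooth Lorentzian metric, of signature `(-, +, …, +)`. -/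
structure LorentzMetric (M : Type*) [TopologicalSpace M] [ChartedSpace H M]
    [IsManifold I ∞ M] where
  val : ∀ p : M, TangentSpace I p →L[ℝ] TangentSpace I p →L[ℝ] ℝ
  symm : ∀ p v w, val p v w = val p w v
  lorentz : ∀ p, ∃ e, val p e e < 0 ∧ ∀ w, val p e w = 0 → w ≠ 0 → 0 < val p w w
  smooth : ContMDiff I (I.prod 𝓘(ℝ, E →L[ℝ] E →L[ℝ] ℝ)) ∞
    (fun p ↦ TotalSpace.mk' (E →L[ℝ] E →L[ℝ] ℝ) p (val p))

variable {I}

/-! ### Real spinors -/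

/-- A bundle of irreducible real spinors over a Lorentzian four-manifold `(M, g)`: a real vector
bundle of rank four with a Clifford multiplication, `v · v · s = g(v, v) s`, and a spin-invariant
pairing.  The algebra `Cl(3,1)` is isomorphic to the algebra of real `4 × 4` matrices, so every
Clifford module of dimension four is irreducible, and a pairing with the property `pairing_clifford`
is unique up to a factor at every point.  On an oriented and time-oriented `M`, giving the pairing
amounts to reducing the structure group of the Clifford module bundle to the spin group `Spin₀(3,1)`,
that is, to a spin structure to which the bundle is associated. -/
structure SpinorBundle (g : LorentzMetric I M) where
  S : M → Type
  [acg : ∀ p, AddCommGroup (S p)]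
  [mod : ∀ p, Module ℝ (S p)]
  [top : ∀ p, TopologicalSpace (S p)]
  [tag : ∀ p, IsTopologicalAddGroup (S p)]
  [csm : ∀ p, ContinuousSMul ℝ (S p)]
  [topTotal : TopologicalSpace (TotalSpace E4 S)]
  [fiber : FiberBundle E4 S]
  [vector : VectorBundle ℝ E4 S]
  [smoothBundle : ContMDiffVectorBundle ∞ E4 S I]
  /-- Clifford multiplication. -/
  clifford : ∀ p, TangentSpace I p →L[ℝ] S p →L[ℝ] S p
  clifford_sq : ∀ p v s, clifford p v (clifford p v s) = g.val p v v • s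
  clifford_smooth : ContMDiff I (I.prod 𝓘(ℝ, E →L[ℝ] E4 →L[ℝ] E4)) ∞
    (fun p ↦ TotalSpace.mk' (E →L[ℝ] E4 →L[ℝ] E4) p (clifford p))
  /-- The spin-invariant pairing. -/
  pairing : ∀ p, S p →L[ℝ] S p →L[ℝ] ℝ
  pairing_skew : ∀ p s t, pairing p s t = - pairing p t s
  pairing_nondeg : ∀ p s, (∀ t, pairing p s t = 0) → s = 0
  pairing_clifford : ∀ p v s t, pairing p (clifford p v s) t = - pairing p s (clifford p v t)
  pairing_smooth : ContMDiff I (I.prod 𝓘(ℝ, E4 →L[ℝ] E4 →L[ℝ] ℝ)) ∞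
    (fun p ↦ TotalSpace.mk' (E4 →L[ℝ] E4 →L[ℝ] ℝ) p (pairing p))

attribute [instance] SpinorBundle.acg SpinorBundle.mod SpinorBundle.top SpinorBundle.tag
  SpinorBundle.csm SpinorBundle.topTotal SpinorBundle.fiber SpinorBundle.vector
  SpinorBundle.smoothBundle

namespace SpinorBundle

variable {g : LorentzMetric I M} (B : SpinorBundle g)

/-- `D` is the spinorial Levi-Civita connection of the spinor bundle: the unique connection that
is a derivation for Clifford multiplication, with respect to the Levi-Civita connection `nab` of
`g`, and for which the spin-invariant pairing is parallel. -/
structure IsSpinLeviCivita (nab : CovariantDerivative I E (TangentSpace I : M → Type _))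
    (D : CovariantDerivative I E4 B.S) : Prop where
  leviCivita : IsLeviCivita I g.val nab
  clifford : ∀ (p : M) (V : ∀ y : M, TangentSpace I y) (s : ∀ y : M, B.S y),
    MDifferentiableAt I I.tangent (fun y ↦ (V y : TangentBundle I M)) p →
    MDifferentiableAt I (I.prod 𝓘(ℝ, E4)) (fun y ↦ TotalSpace.mk' E4 y (s y)) p →
    ∀ v : TangentSpace I p, D (fun y ↦ B.clifford y (V y) (s y)) p v
      = B.clifford p (nab V p v) (s p) + B.clifford p (V p) (D s p v)
  pairing : ∀ (p : M) (s t : ∀ y : M, B.S y),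
    MDifferentiableAt I (I.prod 𝓘(ℝ, E4)) (fun y ↦ TotalSpace.mk' E4 y (s y)) p →
    MDifferentiableAt I (I.prod 𝓘(ℝ, E4)) (fun y ↦ TotalSpace.mk' E4 y (t y)) p →
    ∀ v : TangentSpace I p, mvfderiv I (fun y ↦ B.pairing y (s y) (t y)) p v
      = B.pairing p (D s p v) (t p) + B.pairing p (s p) (D t p v)

/-- A real Killing spinor with Killing constant `lam`: a smooth section `ε` with
`∇_v ε = (lam / 2) v · ε`. -/
def IsKillingSpinor (lam : ℝ) (ε : ∀ p, B.S p) : Prop :=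
  ContMDiff I (I.prod 𝓘(ℝ, E4)) ∞ (fun p ↦ TotalSpace.mk' E4 p (ε p)) ∧
  ∃ (nab : CovariantDerivative I E (TangentSpace I : M → Type _))
    (D : CovariantDerivative I E4 B.S), B.IsSpinLeviCivita nab D ∧
    ∀ (p : M) (v : TangentSpace I p), D ε p v = (lam / 2) • B.clifford p v (ε p)

/-- The Dirac current `u` of a spinor: the one-form `u(v) = ⟨ε, v · ε⟩` of the parabolic pair
`(u, [l])` associated with `ε`.  (The class `[l]` is given by
`(u ∧ l)(v, w) = ⟨ε, (w · v - v · w) · ε⟩ / 2`.) -/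
def diracCurrent (ε : ∀ p, B.S p) (p : M) (v : TangentSpace I p) : ℝ :=
  B.pairing p (ε p) (B.clifford p v (ε p))

end SpinorBundle

end General

/-! ### Geometry of surfaces -/

section Surface

variable {X : Type*} [TopologicalSpace X] [ChartedSpace E2 X] [IsManifold IX ∞ X]

variable (X) in
/-- A smooth Riemannian metric on the surface `X`. -/
abbrev SurfaceMetric : Type _ := ContMDiffRiemannianMetric IX ∞ E2 (TangentSpace IX : X → Type _)

variable (X) in
/-- An orientation of the surface `X`, given by a nowhere vanishing smooth two-form; only its class
up to a positive factor enters below. -/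
structure SurfaceOrientation where
  form : ∀ x : X, TangentSpace IX x →L[ℝ] TangentSpace IX x →L[ℝ] ℝ
  alt : ∀ x v, form x v v = 0
  ne_zero : ∀ x, form x ≠ 0
  smooth : ContMDiff IX (IX.prod 𝓘(ℝ, E2 →L[ℝ] E2 →L[ℝ] ℝ)) ∞
    (fun x ↦ TotalSpace.mk' (E2 →L[ℝ] E2 →L[ℝ] ℝ) x (form x))

/-- The metric is complete: every Cauchy sequence for its Riemannian distance converges. -/
def IsCompleteMetric (q : SurfaceMetric X) : Prop :=
  letI : RiemannianBundle (TangentSpace IX : X → Type _) := ⟨q.toRiemannianMetric⟩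
  ∀ a : ℕ → X,
    (∀ δ : ℝ≥0∞, 0 < δ → ∃ N, ∀ m ≥ N, ∀ n ≥ N, riemannianEDist IX (a m) (a n) < δ) →
    ∃ x, Tendsto a atTop (𝓝 x)

/-- A basis of `T_x X`. -/
def tangentBasis (x : X) (i : Fin 2) : TangentSpace IX x :=
  (EuclideanSpace.single i (1 : ℝ) : E2)

/-- The Riemannian volume form `ν_q` of `q` for the given orientation: the positive multiple of the
orienting form that takes the value `± √(det q(b_i, b_j))` on a basis `b`. -/
def volumeForm (o : SurfaceOrientation X) (q : SurfaceMetric X) (x : X) :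
    TangentSpace IX x →L[ℝ] TangentSpace IX x →L[ℝ] ℝ :=
  (√(Matrix.det (Matrix.of fun i j ↦ q.inner x (tangentBasis x i) (tangentBasis x j)))
    / |o.form x (tangentBasis x 0) (tangentBasis x 1)|) • o.form x

/-- The vector `θ♯` with `q(θ♯, ·) = θ`. -/
def sharp (q : SurfaceMetric X) (x : X) (θ : TangentSpace IX x →L[ℝ] ℝ) : TangentSpace IX x :=
  (q.inner x).inverse θ

/-- The inner product `⟨θ, η⟩_q` of covectors. -/
def coInner (q : SurfaceMetric X) (x : X) (θ η : TangentSpace IX x →L[ℝ] ℝ) : ℝ :=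
  θ (sharp q x η)

/-- The Hodge star of a covector, `*θ = ν_q(θ♯, ·)`, so that `θ ∧ *θ = |θ|² ν_q`. -/
def hodgeStar (o : SurfaceOrientation X) (q : SurfaceMetric X) (x : X)
    (θ : TangentSpace IX x →L[ℝ] ℝ) : TangentSpace IX x →L[ℝ] ℝ :=
  volumeForm o q x (sharp q x θ)

/-- The metric `q` has constant scalar curvature `s`: with `∇` the Levi-Civita connection,
`∑ i j, q(R(e_i, e_j) e_j, e_i) = s` whenever `e` is orthonormal at the point. -/
def HasScalarCurvature (q : SurfaceMetric X) (s : ℝ) : Prop :=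
  ∃ nab : CovariantDerivative IX E2 (TangentSpace IX : X → Type _),
    IsLeviCivita IX q.inner nab ∧
    ∀ (x : X) (e : Fin 2 → ∀ y : X, TangentSpace IX y),
      (∀ i, ContMDiff IX IX.tangent ∞ (fun y ↦ (e i y : TangentBundle IX X))) →
      (∀ i j, q.inner x (e i x) (e j x) = if i = j then 1 else 0) →
      ∑ i, ∑ j, q.inner x (curvature IX nab (e i) (e j) (e j) x) (e i x) = s

/-- The upper half-plane `y > 0`. -/
def halfPlane : Set E2 := {z | 0 < z 1}

/-- `(X, q)` is isometric to the quotient of the upper half-plane with the metric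
`(dx² + dy²) / (lam² y²)`, of scalar curvature `-2 lam²`, by the group of isometries whose orbits are
the classes of `r`: there is a surjective smooth local isometry `pr` onto `X` whose fibres are these
orbits. -/
def IsHalfPlaneQuotient (lam : ℝ) (q : SurfaceMetric X) (r : E2 → E2 → Prop) : Prop :=
  ∃ pr : E2 → X, ContMDiffOn 𝓘(ℝ, E2) IX ∞ pr halfPlane ∧ pr '' halfPlane = Set.univ ∧
    (∀ z ∈ halfPlane, ∀ v w : E2,
      q.inner (pr z) (mfderiv 𝓘(ℝ, E2) IX pr z v) (mfderiv 𝓘(ℝ, E2) IX pr z w)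
        = inner ℝ v w / (lam ^ 2 * z 1 ^ 2)) ∧
    ∀ z ∈ halfPlane, ∀ w ∈ halfPlane, pr z = pr w ↔ r z w

/-- `(X, q)` is an elementary hyperbolic surface of scalar curvature `-2 lam²`: isometric to the
Poincaré half-plane, to a hyperbolic cylinder (the quotient by `z ↦ e^l z`, `l > 0`) or to the
parabolic cylinder (the quotient by `z ↦ z + 1`). -/
def IsElementaryHyperbolic (lam : ℝ) (q : SurfaceMetric X) : Prop :=
  IsHalfPlaneQuotient lam q (fun z w ↦ w = z) ∨
  (∃ l : ℝ, 0 < l ∧ IsHalfPlaneQuotient lam q (fun z w ↦ ∃ n : ℤ, w = Real.exp (n * l) • z)) ∨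
  IsHalfPlaneQuotient lam q (fun z w ↦ ∃ n : ℤ, w = z + (n : ℝ) • EuclideanSpace.single 0 (1 : ℝ))

/-! ### Families parametrized by `x_u ∈ ℝ` -/

/-- A smooth family of functions on `X`. -/
def IsSmoothFun (f : ℝ → X → ℝ) : Prop :=
  ContMDiff (𝓘(ℝ, ℝ).prod IX) 𝓘(ℝ, ℝ) ∞ (fun p : ℝ × X ↦ f p.1 p.2)

/-- A smooth family of one-forms on `X`. -/
def IsSmoothForm (θ : ℝ → ∀ x : X, TangentSpace IX x →L[ℝ] ℝ) : Prop :=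
  ContMDiff (𝓘(ℝ, ℝ).prod IX) (IX.prod 𝓘(ℝ, E2 →L[ℝ] ℝ)) ∞
    (fun p : ℝ × X ↦ (TotalSpace.mk' (E2 →L[ℝ] ℝ) p.2 (θ p.1 p.2) :
      TotalSpace (E2 →L[ℝ] ℝ) (fun x : X ↦ TangentSpace IX x →L[ℝ] ℝ)))

/-- A smooth family of Riemannian metrics on `X`. -/
def IsSmoothMetric (q : ℝ → SurfaceMetric X) : Prop :=
  ContMDiff (𝓘(ℝ, ℝ).prod IX) (IX.prod 𝓘(ℝ, E2 →L[ℝ] E2 →L[ℝ] ℝ)) ∞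
    (fun p : ℝ × X ↦ (TotalSpace.mk' (E2 →L[ℝ] E2 →L[ℝ] ℝ) p.2 ((q p.1).inner p.2) :
      TotalSpace (E2 →L[ℝ] E2 →L[ℝ] ℝ)
        (fun x : X ↦ TangentSpace IX x →L[ℝ] TangentSpace IX x →L[ℝ] ℝ)))

/-- The family `d_X f` of differentials. -/
def dX (f : ℝ → X → ℝ) (t : ℝ) (x : X) : TangentSpace IX x →L[ℝ] ℝ :=
  mvfderiv IX (f t) x

/-- The derivative `∂_{x_u} θ` of a family of one-forms. -/
def partialU (θ : ℝ → ∀ x : X, TangentSpace IX x →L[ℝ] ℝ) (t : ℝ) (x : X) :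
    TangentSpace IX x →L[ℝ] ℝ :=
  (deriv (fun τ ↦ (θ τ x : E2 →L[ℝ] ℝ)) t : E2 →L[ℝ] ℝ)

/-! ### The four-manifold `ℝ² × X` -/

/-- The one-form `dx_u`. -/
def dxu (p : ℝ × ℝ × X) : TangentSpace IM p →L[ℝ] ℝ :=
  mvfderiv IM (fun p' : ℝ × ℝ × X ↦ p'.1) p

/-- The one-form `dx_v`. -/
def dxv (p : ℝ × ℝ × X) : TangentSpace IM p →L[ℝ] ℝ :=
  mvfderiv IM (fun p' : ℝ × ℝ × X ↦ p'.2.1) p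

/-- The differential of the projection to `X`. -/
def projX (p : ℝ × ℝ × X) : TangentSpace IM p →L[ℝ] TangentSpace IX p.2.2 :=
  mfderiv IM IX (fun p' : ℝ × ℝ × X ↦ p'.2.2) p

/-- The vector field `∂_{x_v}`. -/
def partialV (p : ℝ × ℝ × X) : TangentSpace IM p :=
  mfderiv 𝓘(ℝ, ℝ) IM (fun s : ℝ ↦ ((p.1, s, p.2.2) : ℝ × ℝ × X)) p.2.1 (1 : ℝ)

/-- The metric `g` on `ℝ² × X` has the standard conformally Brinkmann form
`H dx_u ⊗ dx_u + e^F dx_u ⊙ dx_v + dx_u ⊙ α + q`, where `a ⊙ b = a ⊗ b + b ⊗ a`. -/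
def HasBrinkmannForm (g : LorentzMetric IM (ℝ × ℝ × X)) (H F : ℝ → X → ℝ)
    (α : ℝ → ∀ x : X, TangentSpace IX x →L[ℝ] ℝ) (q : ℝ → SurfaceMetric X) : Prop :=
  ∀ (p : ℝ × ℝ × X) (a b : TangentSpace IM p),
    g.val p a b = H p.1 p.2.2 * (dxu p a * dxu p b)
      + Real.exp (F p.1 p.2.2) * (dxu p a * dxv p b + dxv p a * dxu p b)
      + (dxu p a * α p.1 p.2.2 (projX p b) + α p.1 p.2.2 (projX p a) * dxu p b)
      + (q p.1).inner p.2.2 (projX p a) (projX p b)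

/-- `(ℝ² × X, g)` is a standard conformally Brinkmann space-time. -/
def IsStandardConformallyBrinkmann (g : LorentzMetric IM (ℝ × ℝ × X)) : Prop :=
  ∃ (H F : ℝ → X → ℝ) (α : ℝ → ∀ x : X, TangentSpace IX x →L[ℝ] ℝ) (q : ℝ → SurfaceMetric X),
    IsSmoothFun H ∧ IsSmoothFun F ∧ IsSmoothForm α ∧ IsSmoothMetric q ∧
    (∀ t, IsCompleteMetric (q t)) ∧ HasBrinkmannForm g H F α q

/-- `(ℝ² × X, g, ε)` is a standard supersymmetric Kundt configuration: `g` is standard conformally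
Brinkmann and `ε` is a Killing spinor that is adapted, i.e. the Dirac current `u` of `ε` satisfies
`u♯ = ∂_{x_v}`. -/
structure IsStandardSusyKundt (lam : ℝ) (g : LorentzMetric IM (ℝ × ℝ × X)) (B : SpinorBundle g)
    (ε : ∀ p, B.S p) : Prop where
  brinkmann : IsStandardConformallyBrinkmann g
  killing : B.IsKillingSpinor lam ε
  adapted : ∀ (p : ℝ × ℝ × X) (w : TangentSpace IM p),
    g.val p (partialV p) w = B.diracCurrent ε p w

/-- The prescribed form of the metric:
`g = H dx_u ⊗ dx_u + e^F dx_u ⊙ (dx_v + β) + q` with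
`q = (4 lam²)⁻¹ d_X F ⊗ d_X F + e^F om ⊗ om` a family of complete Riemannian metrics, `om` closed, and
`d_X β = (e^{-F} / (4 lam²)) ⟨∂_{x_u} * d_X F + * ∂_{x_u} d_X F, d_X F⟩_q ν_q`. -/
structure IsKundtData (lam : ℝ) (o : SurfaceOrientation X) (g : LorentzMetric IM (ℝ × ℝ × X))
    (H F : ℝ → X → ℝ) (q : ℝ → SurfaceMetric X)
    (om β : ℝ → ∀ x : X, TangentSpace IX x →L[ℝ] ℝ) : Prop where
  smooth_H : IsSmoothFun H
  smooth_F : IsSmoothFun F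
  smooth_om : IsSmoothForm om
  smooth_β : IsSmoothForm β
  complete : ∀ t, IsCompleteMetric (q t)
  metric_X : ∀ (t : ℝ) (x : X) (v w : TangentSpace IX x),
    (q t).inner x v w = 1 / (4 * lam ^ 2) * (dX F t x v * dX F t x w)
      + Real.exp (F t x) * (om t x v * om t x w)
  closed_om : ∀ t, IsExtDeriv IX (om t) 0
  d_β : ∀ t, IsExtDeriv IX (β t) fun x ↦
    (Real.exp (-F t x) / (4 * lam ^ 2) *
      coInner (q t) x
        (partialU (fun τ y ↦ hodgeStar o (q τ) y (dX F τ y)) t x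
          + hodgeStar o (q t) x (partialU (dX F) t x))
        (dX F t x)) • volumeForm o (q t) x
  metric_M : ∀ (p : ℝ × ℝ × X) (a b : TangentSpace IM p),
    g.val p a b = H p.1 p.2.2 * (dxu p a * dxu p b)
      + Real.exp (F p.1 p.2.2) *
        (dxu p a * (dxv p b + β p.1 p.2.2 (projX p b))
          + (dxv p a + β p.1 p.2.2 (projX p a)) * dxu p b)
      + 1 / (4 * lam ^ 2) *
        (dX F p.1 p.2.2 (projX p a) * dX F p.1 p.2.2 (projX p b))
      + Real.exp (F p.1 p.2.2) * (om p.1 p.2.2 (projX p a) * om p.1 p.2.2 (projX p b))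

end Surface

end SusyKundt

end

open Bundle Filter Topology Manifold
open scoped ContDiff ENNReal

noncomputable section

open VectorField

namespace SusyKundt

set_option linter.unusedSectionVars false

/-! ### Exterior derivatives of one-forms, tested on vector fields. -/

section ExtDeriv

variable {E : Type*} [NormedAddCommGroup E] [NormedSpace ℝ E]
  {H : Type*} [TopologicalSpace H] {I : ModelWithCorners ℝ E H}
  {M : Type*} [TopologicalSpace M] [ChartedSpace H M] [IsManifold I ∞ M]

/-! The spinor is traded for differential forms. By linear algebra in the Clifford module, a real
spinor `ε` with null Dirac current is annihilated by the current `K = ∂_{x_v}` and fixed by a unit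
spacelike vector `L` orthogonal to it (`exists_unit_fix`). For the current `u = e^F dx_u` the
Killing equation gives `du(v, w) = 2 lam ⟨v·ε, w·ε⟩`. Comparing this with `du = d_X F ∧ u` on a lift
of a vector of `X` and on a null vector `N` with `u(N) = 1` shows that `L` is dual to `l = d_X F /
(2 lam)`, which is therefore a unit form (`clifford_liftM_sharp`). Differentiating `L·ε = ε` gives
`∇_v L = lam (v - g(L, v) L)` up to vectors that kill `ε`, and these have no component along `X`
(`projX_nab`).

Complete `l` to an orthonormal coframe `(l, n)` of `q`. Torsion-freeness and metricity turn the
previous identity into `dn = lam l ∧ n` and `dβ = e^{-F} (∂_u n(l♯) - ∂_u l(n♯)) l ∧ n`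
(`isFrameData_of_killing`). With `n = e^{F/2} om`, the first equation says that `om` is closed, and
the second is the prescribed formula with Hodge stars (`kundt_source_eq`). The structure
`IsFrameData` is thus the middle term of the equivalence.

Conversely, these equations are the first structure equations of an explicit skew matrix of
connection forms in a null frame `(K, N, L, n)`. Its spin lift acts on the trivial bundle with fibre
`ℝ⁴`, and the first column of the lift is `lam / 2` times the Clifford action on the first basis
spinor. That constant spinor is therefore Killing (`exists_isStandardSusyKundt`).

For the global geometry, fix `x_u`. The forms `a = lam om` and `b = -d_X F / 2` are closed, so local
primitives of them are coordinates in which the dual frame `(P, Q)` is the coordinate frame. Along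
an integral curve of a constant-coefficient field, `F` is affine. Hence its speed is bounded on
bounded intervals, and completeness of `q` makes all such fields complete (`IsHorocyclic.complete`).
The flows form a transitive action of `ℝ²` whose orbit maps are local diffeomorphisms, and `F (flow
p v) = F p - 2 v₁`. So the stabilizer of a point is `cℤ` in the direction of `P`. Substituting the
logarithm of the height for `v₁` turns the metric into that of the half-plane, and `X` is its
quotient by a horizontal translation or by nothing. Only the half-plane and the parabolic cylinder
arise, because `F` is globally defined; the alternative of a hyperbolic cylinder is never used. The
curvature is read off from the connection form `lam n`, whose differential is `lam² l ∧ n`. -/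

/-- A vector field read in the chart at `x`. -/
def chartField (x : M) (V : ∀ y : M, TangentSpace I y) (z : E) : E :=
  mpullbackWithin 𝓘(ℝ, E) I (extChartAt I x).symm V (Set.range I) z

/-- The derivative of a function along a vector field, read in the chart at `x`. -/
theorem mvfderiv_eq_fderiv_chart [I.Boundaryless] {f : M → ℝ} {x : M} {z : E}
    (hz : z ∈ (extChartAt I x).target)
    (hf : MDifferentiableAt I 𝓘(ℝ, ℝ) f ((extChartAt I x).symm z))
    (V : ∀ y : M, TangentSpace I y) :
    mvfderiv I f ((extChartAt I x).symm z) (V ((extChartAt I x).symm z)) =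
      fderiv ℝ (f ∘ (extChartAt I x).symm) z (chartField x V z) := by
  have hinv := isInvertible_mfderivWithin_extChartAt_symm (I := I) hz
  have hI : Set.range I = Set.univ := I.range_eq_univ
  rw [hI] at hinv
  rw [mfderivWithin_univ] at hinv
  have hd : MDifferentiableAt 𝓘(ℝ, E) I (extChartAt I x).symm z := by
    have := (mdifferentiableWithinAt_extChartAt_symm (I := I) hz)
    rwa [hI, mdifferentiableWithinAt_univ] at this
  have key := mfderiv_comp z hf hd
  rw [mfderiv_eq_fderiv] at key
  rw [chartField, mpullbackWithin_apply, hI, mfderivWithin_univ]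
  obtain ⟨e, he⟩ := hinv
  rw [key, ← he, ContinuousLinearMap.inverse_equiv]
  exact congrArg (mvfderiv I f ((extChartAt I x).symm z)) (e.apply_symm_apply _).symm

theorem chartField_differentiableAt [I.Boundaryless] [CompleteSpace E]
    {x : M} {V : ∀ y : M, TangentSpace I y}
    (hV : MDifferentiableAt I I.tangent (fun y ↦ (V y : TangentBundle I M)) x) :
    DifferentiableAt ℝ (chartField x V) (extChartAt I x x) := by
  have hI : Set.range I = Set.univ := I.range_eq_univ
  have : DifferentiableWithinAt ℝ (chartField x V)
      ((extChartAt I x).symm ⁻¹' Set.univ ∩ Set.range I) (extChartAt I x x) :=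
    MDifferentiableWithinAt.differentiableWithinAt_mpullbackWithin_vectorField
      (I := I) (s := Set.univ) (x := x) (V := V) hV.mdifferentiableWithinAt
  rwa [Set.preimage_univ, hI, Set.univ_inter, differentiableWithinAt_univ] at this

/-- The bracket on the manifold is by definition the bracket in the chart carried back by the
inverse of the derivative of the chart. At the centre that derivative inverts the derivative of the
inverse chart, so the two transports cancel. -/
theorem chartField_mlieBracket [I.Boundaryless] [CompleteSpace E]
    {x : M} {V W : ∀ y : M, TangentSpace I y} :
    chartField x (mlieBracket I V W) (extChartAt I x x) =
      lieBracket ℝ (chartField x V) (chartField x W) (extChartAt I x x) := by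
  have hI : Set.range I = Set.univ := I.range_eq_univ
  have hback : (extChartAt I x).symm (extChartAt I x x) = x := extChartAt_to_inv x
  set b := lieBracket ℝ (chartField x V) (chartField x W) (extChartAt I x x) with hb
  have hY : mlieBracket I V W x = (mfderiv I 𝓘(ℝ, E) (extChartAt I x) x).inverse b := by
    have h0 : mlieBracket I V W x = (mfderiv I 𝓘(ℝ, E) (extChartAt I x) x).inverse
        (lieBracketWithin (E := E) ℝ (chartField x V) (chartField x W)
          ((extChartAt I x).symm ⁻¹' Set.univ ∩ Set.range I) (extChartAt I x x)) := by
      rw [← mlieBracketWithin_univ]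
      rfl
    rwa [Set.preimage_univ, hI, Set.univ_inter, lieBracketWithin_univ] at h0
  have h1 := mfderiv_extChartAt_inverse_comp_mfderivWithin_extChartAT_symm (I := I)
    (mlieBracket I V W x)
  have hinv : (mfderiv I 𝓘(ℝ, E) (extChartAt I x) x).IsInvertible :=
    isInvertible_mfderiv_extChartAt (mem_extChartAt_source x)
  obtain ⟨e, he⟩ := hinv
  rw [← he, ContinuousLinearMap.inverse_equiv] at h1 hY
  have h2 : chartField x (mlieBracket I V W) (extChartAt I x x) =
      (mfderivWithin 𝓘(ℝ, E) I (extChartAt I x).symm (Set.range I) (extChartAt I x x)).inverse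
        (mlieBracket I V W ((extChartAt I x).symm (extChartAt I x x))) := rfl
  have h3 : ∀ y (_ : y = x), e.symm ((mfderivWithin 𝓘(ℝ, E) I (extChartAt I x).symm (Set.range I)
      (extChartAt I x x)).inverse (mlieBracket I V W y)) = e.symm b := by
    rintro y rfl
    exact h1.trans hY
  rw [h2]
  exact e.symm.injective (h3 _ hback)

/-- The Lie bracket acts on functions as the commutator. -/
theorem mvfderiv_mlieBracket [I.Boundaryless] [CompleteSpace E] {f : M → ℝ}
    {x : M} {V W : ∀ z : M, TangentSpace I z} (hf : ContMDiffAt I 𝓘(ℝ, ℝ) 2 f x)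
    (hV : MDifferentiableAt I I.tangent (fun y ↦ (V y : TangentBundle I M)) x)
    (hW : MDifferentiableAt I I.tangent (fun y ↦ (W y : TangentBundle I M)) x) :
    mvfderiv I f x (mlieBracket I V W x) =
      mvfderiv I (fun y ↦ mvfderiv I f y (W y)) x (V x)
        - mvfderiv I (fun y ↦ mvfderiv I f y (V y)) x (W x) := by
  have hI : Set.range I = Set.univ := I.range_eq_univ
  set φ := extChartAt I x with hφ
  set z := φ x with hzdef
  have hz : z ∈ φ.target := mem_extChartAt_target x
  have hback : φ.symm z = x := extChartAt_to_inv x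
  set F : E → ℝ := f ∘ φ.symm with hF
  have hFc : ContDiffAt ℝ 2 F z := by
    have h1 := (contMDiffAt_iff.1 hf).2
    simp only [extChartAt_self_eq, hI, contDiffWithinAt_univ] at h1
    exact h1
  have dF2 : DifferentiableAt ℝ (fderiv ℝ F) z :=
    (hFc.fderiv_right (m := 1) (by norm_num)).differentiableAt (by norm_num)
  have evf : ∀ᶠ y in 𝓝 x, MDifferentiableAt I 𝓘(ℝ, ℝ) f y :=
    ((contMDiffAt_iff_contMDiffAt_nhds (by decide)).1 hf).mono fun y hy ↦ hy.mdifferentiableAt (by norm_num)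
  have hcont : ContinuousAt φ.symm z := continuousAt_extChartAt_symm x
  have evz : ∀ᶠ w in 𝓝 z, w ∈ φ.target ∧ MDifferentiableAt I 𝓘(ℝ, ℝ) f (φ.symm w) := by
    have h2 : ∀ᶠ w in 𝓝 z, w ∈ φ.target := extChartAt_target_mem_nhds (I := I) x
    refine h2.and ?_
    exact hcont.tendsto.eventually (by rwa [hback])
  -- An iterated derivative is a Hessian term plus the derivative of the inner field.
  -- Antisymmetrizing removes the Hessian and leaves the bracket.
  have main : ∀ (A B : ∀ z : M, TangentSpace I z),
      DifferentiableAt ℝ (chartField x B) z →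
      mvfderiv I (fun y ↦ mvfderiv I f y (B y)) x (A x) =
        fderiv ℝ (fderiv ℝ F) z (chartField x A z) (chartField x B z) +
        fderiv ℝ F z (fderiv ℝ (chartField x B) z (chartField x A z)) := by
    intro A B hB
    have e1 : (fun y ↦ mvfderiv I f y (B y)) ∘ φ.symm =ᶠ[𝓝 z]
        fun w ↦ fderiv ℝ F w (chartField x B w) := by
      filter_upwards [evz] with w hw
      exact mvfderiv_eq_fderiv_chart hw.1 hw.2 B
    have dd : DifferentiableAt ℝ (fun w ↦ fderiv ℝ F w (chartField x B w)) z :=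
      dF2.clm_apply hB
    have md : MDifferentiableAt I 𝓘(ℝ, ℝ) (fun y ↦ mvfderiv I f y (B y)) (φ.symm z) := by
      rw [hback]
      rw [← mdifferentiableWithinAt_univ]
      apply DifferentiableWithinAt.mdifferentiableWithinAt_of_comp_extChartAt_symm
      simp only [hI, Set.preimage_univ, Set.univ_inter, differentiableWithinAt_univ]
      exact dd.congr_of_eventuallyEq e1
    have k := mvfderiv_eq_fderiv_chart hz md A
    rw [e1.fderiv_eq, fderiv_clm_apply dF2 hB, hback] at k
    rw [k]
    simp only [_root_.add_apply, ContinuousLinearMap.comp_apply, ContinuousLinearMap.flip_apply]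
    rw [add_comm]
  have hsymm : IsSymmSndFDerivAt ℝ F z := hFc.isSymmSndFDerivAt (by simp)
  have k := mvfderiv_eq_fderiv_chart hz (f := f) (evz.self_of_nhds).2 (mlieBracket I V W)
  rw [hback, chartField_mlieBracket] at k
  rw [k, main V W (chartField_differentiableAt hW), main W V (chartField_differentiableAt hV),
    lieBracket, map_sub, hsymm.eq (chartField x W z)]
  ring

variable (I) in
/-- `η` is the value at `x` of the exterior derivative of `θ`. -/
def IsExtDerivAt (θ : ∀ y : M, TangentSpace I y →L[ℝ] ℝ) (x : M)
    (η : TangentSpace I x → TangentSpace I x → ℝ) : Prop :=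
  ∀ V W : ∀ y : M, TangentSpace I y,
    MDifferentiableAt I I.tangent (fun y ↦ (V y : TangentBundle I M)) x →
    MDifferentiableAt I I.tangent (fun y ↦ (W y : TangentBundle I M)) x →
    η (V x) (W x) = mvfderiv I (fun y ↦ θ y (W y)) x (V x)
      - mvfderiv I (fun y ↦ θ y (V y)) x (W x) - θ x (mlieBracket I V W x)

variable (I) in
/-- The one-form `θ` is differentiable at `x`, tested on vector fields. -/
def FormDiffAt (θ : ∀ y : M, TangentSpace I y →L[ℝ] ℝ) (x : M) : Prop :=
  ∀ V : ∀ y : M, TangentSpace I y,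
    MDifferentiableAt I I.tangent (fun y ↦ (V y : TangentBundle I M)) x →
    MDifferentiableAt I 𝓘(ℝ, ℝ) (fun y ↦ θ y (V y)) x

theorem isExtDeriv_iff {θ : ∀ y : M, TangentSpace I y →L[ℝ] ℝ}
    {η : ∀ x : M, TangentSpace I x →L[ℝ] TangentSpace I x →L[ℝ] ℝ} :
    IsExtDeriv I θ η ↔ ∀ x, IsExtDerivAt I θ x fun v w ↦ η x v w :=
  Iff.rfl

theorem IsExtDerivAt.congr {θ θ' : ∀ y : M, TangentSpace I y →L[ℝ] ℝ} {x : M}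
    {η : TangentSpace I x → TangentSpace I x → ℝ} (h : IsExtDerivAt I θ x η)
    (e : ∀ᶠ y in 𝓝 x, θ y = θ' y) : IsExtDerivAt I θ' x η := by
  intro V W hV hW
  have e1 : ∀ U : ∀ y : M, TangentSpace I y,
      (fun y ↦ θ y (U y)) =ᶠ[𝓝 x] fun y ↦ θ' y (U y) := fun U ↦ e.mono fun y hy ↦ by simp [hy]
  have e2 : ∀ U : ∀ y : M, TangentSpace I y,
      mvfderiv I (fun y ↦ θ y (U y)) x = mvfderiv I (fun y ↦ θ' y (U y)) x := fun U ↦ by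
    ext v
    simp only [mvfderiv, (e1 U).mfderiv_eq]
    rfl
  rw [h V W hV hW, e2, e2, e.self_of_nhds]

theorem IsExtDerivAt.congr_right {θ : ∀ y : M, TangentSpace I y →L[ℝ] ℝ} {x : M}
    {η η' : TangentSpace I x → TangentSpace I x → ℝ} (h : IsExtDerivAt I θ x η)
    (e : ∀ v w, η v w = η' v w) : IsExtDerivAt I θ x η' := fun V W hV hW ↦ by
  rw [← e, h V W hV hW]

/-- Every tangent vector extends to a field that is differentiable at the point, so the invariant
formula determines all values. This is how two computations of the same exterior derivative are
compared later. -/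
theorem IsExtDerivAt.unique {θ : ∀ y : M, TangentSpace I y →L[ℝ] ℝ} {x : M}
    {η η' : TangentSpace I x → TangentSpace I x → ℝ} (h : IsExtDerivAt I θ x η)
    (h' : IsExtDerivAt I θ x η') (v w : TangentSpace I x) : η v w = η' v w := by
  have hv := FiberBundle.mdifferentiableAt_extend I E v
  have hw := FiberBundle.mdifferentiableAt_extend I E w
  have := (h _ _ hv hw).trans (h' _ _ hv hw).symm
  simpa using this

theorem IsExtDerivAt.swap {θ : ∀ y : M, TangentSpace I y →L[ℝ] ℝ} {x : M}
    {η : TangentSpace I x → TangentSpace I x → ℝ} (h : IsExtDerivAt I θ x η)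
    (v w : TangentSpace I x) : η v w = - η w v := by
  have hv := FiberBundle.mdifferentiableAt_extend I E v
  have hw := FiberBundle.mdifferentiableAt_extend I E w
  have h1 := h _ _ hv hw
  have h2 := h _ _ hw hv
  rw [mlieBracket_swap_apply, map_neg] at h2
  simp only [FiberBundle.extend_apply_self] at h1 h2
  linarith

theorem FormDiffAt.add {θ θ' : ∀ y : M, TangentSpace I y →L[ℝ] ℝ} {x : M}
    (h : FormDiffAt I θ x) (h' : FormDiffAt I θ' x) : FormDiffAt I (fun y ↦ θ y + θ' y) x :=
  fun V hV ↦ (h V hV).add (h' V hV)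

theorem FormDiffAt.smul {θ : ∀ y : M, TangentSpace I y →L[ℝ] ℝ} {f : M → ℝ} {x : M}
    (hf : MDifferentiableAt I 𝓘(ℝ, ℝ) f x) (h : FormDiffAt I θ x) :
    FormDiffAt I (fun y ↦ f y • θ y) x :=
  fun V hV ↦ hf.mul (h V hV)

theorem IsExtDerivAt.add {θ θ' : ∀ y : M, TangentSpace I y →L[ℝ] ℝ} {x : M}
    {η η' : TangentSpace I x → TangentSpace I x → ℝ} (hd : FormDiffAt I θ x)
    (hd' : FormDiffAt I θ' x) (h : IsExtDerivAt I θ x η)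
    (h' : IsExtDerivAt I θ' x η') :
    IsExtDerivAt I (fun y ↦ θ y + θ' y) x fun v w ↦ η v w + η' v w := by
  intro V W hV hW
  have e : ∀ U : ∀ y : M, TangentSpace I y,
      MDifferentiableAt I I.tangent (fun y ↦ (U y : TangentBundle I M)) x →
      mvfderiv I (fun y ↦ (θ y + θ' y) (U y)) x =
      mvfderiv I (fun y ↦ θ y (U y)) x + mvfderiv I (fun y ↦ θ' y (U y)) x := fun U hU ↦
    mvfderiv_fun_add (hd U hU) (hd' U hU)
  rw [e W hW, e V hV]
  simp only [_root_.add_apply, h V W hV hW, h' V W hV hW]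
  ring

theorem IsExtDerivAt.smul {θ : ∀ y : M, TangentSpace I y →L[ℝ] ℝ} {f : M → ℝ} {x : M}
    {η : TangentSpace I x → TangentSpace I x → ℝ} (hf : MDifferentiableAt I 𝓘(ℝ, ℝ) f x)
    (hd : FormDiffAt I θ x) (h : IsExtDerivAt I θ x η) :
    IsExtDerivAt I (fun y ↦ f y • θ y) x fun v w ↦
      f x * η v w + (mvfderiv I f x v * θ x w - mvfderiv I f x w * θ x v) := by
  intro V W hV hW
  have e : ∀ U : ∀ y : M, TangentSpace I y,
      MDifferentiableAt I I.tangent (fun y ↦ (U y : TangentBundle I M)) x →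
      mvfderiv I (fun y ↦ (f y • θ y) (U y)) x =
      f x • mvfderiv I (fun y ↦ θ y (U y)) x + (θ x (U x)) • mvfderiv I f x := fun U hU ↦
    mvfderiv_fun_mul hf (hd U hU)
  rw [e W hW, e V hV]
  simp only [_root_.add_apply, _root_.smul_apply, smul_eq_mul, h V W hV hW]
  ring

/-- A one-form is differentiable if it is so as a section of the cotangent bundle. -/
theorem FormDiffAt.of_section {θ : ∀ y : M, TangentSpace I y →L[ℝ] ℝ} {x : M}
    (h : MDifferentiableAt I (I.prod 𝓘(ℝ, E →L[ℝ] ℝ))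
      (fun y ↦ TotalSpace.mk' (E →L[ℝ] ℝ) (E := fun y : M ↦ TangentSpace I y →L[ℝ] ℝ) y (θ y)) x) :
    FormDiffAt I θ x := by
  intro V hV
  have h1 : MDifferentiableAt I (I.prod 𝓘(ℝ, ℝ))
      (fun m ↦ TotalSpace.mk' ℝ (E := Bundle.Trivial M ℝ) m (θ m (V m))) x :=
    MDifferentiableAt.clm_bundle_apply (F₁ := E) (F₂ := ℝ) (E₁ := fun y : M ↦ TangentSpace I y)
      (E₂ := Bundle.Trivial M ℝ) (b := fun m ↦ m) h hV
  exact ((mdifferentiableAt_totalSpace _ _).1 h1).2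

section Exact

variable [I.Boundaryless] [CompleteSpace E]

theorem isExtDerivAt_mvfderiv {f : M → ℝ} {x : M} (hf : ContMDiffAt I 𝓘(ℝ, ℝ) 2 f x) :
    IsExtDerivAt I (mvfderiv I f) x fun _ _ ↦ 0 := fun V W hV hW ↦ by
  rw [mvfderiv_mlieBracket hf hV hW]
  ring

theorem formDiffAt_mvfderiv {f : M → ℝ} {x : M} (hf : ContMDiffAt I 𝓘(ℝ, ℝ) 2 f x) :
    FormDiffAt I (mvfderiv I f) x := by
  intro V hV
  have hI : Set.range I = Set.univ := I.range_eq_univ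
  have hback : (extChartAt I x).symm (extChartAt I x x) = x := extChartAt_to_inv x
  have hFc : ContDiffAt ℝ 2 (f ∘ (extChartAt I x).symm) (extChartAt I x x) := by
    have h1 := (contMDiffAt_iff.1 hf).2
    simp only [extChartAt_self_eq, hI, contDiffWithinAt_univ] at h1
    exact h1
  have dF2 : DifferentiableAt ℝ (fderiv ℝ (f ∘ (extChartAt I x).symm)) (extChartAt I x x) :=
    (hFc.fderiv_right (m := 1) (by norm_num)).differentiableAt (by norm_num)
  have evf : ∀ᶠ y in 𝓝 x, MDifferentiableAt I 𝓘(ℝ, ℝ) f y :=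
    ((contMDiffAt_iff_contMDiffAt_nhds (by decide)).1 hf).mono
      fun y hy ↦ hy.mdifferentiableAt (by norm_num)
  rw [← mdifferentiableWithinAt_univ]
  apply DifferentiableWithinAt.mdifferentiableWithinAt_of_comp_extChartAt_symm
  simp only [hI, Set.preimage_univ, Set.univ_inter, differentiableWithinAt_univ]
  refine (dF2.clm_apply (chartField_differentiableAt hV)).congr_of_eventuallyEq ?_
  have h2 : ∀ᶠ w in 𝓝 (extChartAt I x x), w ∈ (extChartAt I x).target :=
    extChartAt_target_mem_nhds (I := I) x
  filter_upwards [h2, (continuousAt_extChartAt_symm (I := I) x).tendsto.eventually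
    (show ∀ᶠ y in 𝓝 ((extChartAt I x).symm (extChartAt I x x)),
      MDifferentiableAt I 𝓘(ℝ, ℝ) f y by rwa [hback])] with w hw hw'
  exact mvfderiv_eq_fderiv_chart hw hw' V

end Exact

end ExtDeriv

theorem two_le_infty : (2 : WithTop ℕ∞) ≤ ((⊤ : ℕ∞) : WithTop ℕ∞) := by
  exact WithTop.coe_le_coe.2 (le_top : (2 : ℕ∞) ≤ ⊤)

/-! ### Smooth families of functions, one-forms and vector fields on `X`. -/

section Families

variable {X : Type*} [TopologicalSpace X] [ChartedSpace E2 X] [IsManifold IX ∞ X]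

/-- The model of `ℝ × X`. -/
abbrev JX : ModelWithCorners ℝ (ℝ × E2) (ModelProd ℝ E2) := 𝓘(ℝ, ℝ).prod IX

/-- A family of one-forms on `X` is smooth at a point of `ℝ × X`. -/
def SmoothFormAt (θ : ℝ → ∀ x : X, TangentSpace IX x →L[ℝ] ℝ) (p : ℝ × X) : Prop :=
  ContMDiffAt JX (IX.prod 𝓘(ℝ, E2 →L[ℝ] ℝ)) ∞
    (fun p : ℝ × X ↦ (TotalSpace.mk' (E2 →L[ℝ] ℝ) p.2 (θ p.1 p.2) :
      TotalSpace (E2 →L[ℝ] ℝ) (fun x : X ↦ TangentSpace IX x →L[ℝ] ℝ))) p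

/-- A family of vector fields on `X` is smooth at a point of `ℝ × X`. -/
def SmoothVecAt (Z : ℝ → ∀ x : X, TangentSpace IX x) (p : ℝ × X) : Prop :=
  ContMDiffAt JX IX.tangent ∞ (fun p : ℝ × X ↦ (⟨p.2, Z p.1 p.2⟩ : TangentBundle IX X)) p

/-- The coordinate frame of the chart at `x₀`. -/
def locFrame (x₀ : X) (i : Fin 2) (y : X) : TangentSpace IX y :=
  (trivializationAt E2 (TangentSpace IX) x₀).symm y (EuclideanSpace.single i (1 : ℝ))

theorem mem_trivializationAt_baseSet (x₀ : X) :
    ∀ᶠ y in 𝓝 x₀, y ∈ (trivializationAt E2 (TangentSpace IX : X → Type _) x₀).baseSet :=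
  (trivializationAt E2 (TangentSpace IX : X → Type _) x₀).open_baseSet.mem_nhds
    (FiberBundle.mem_baseSet_trivializationAt' x₀)

theorem locFrame_smooth (x₀ : X) (i : Fin 2) :
    ContMDiffAt IX IX.tangent ∞ (fun y ↦ (⟨y, locFrame x₀ i y⟩ : TangentBundle IX X)) x₀ := by
  rw [contMDiffAt_totalSpace]
  refine ⟨contMDiffAt_id, ?_⟩
  refine (contMDiffAt_const (c := EuclideanSpace.single i (1 : ℝ))).congr_of_eventuallyEq ?_
  filter_upwards [mem_trivializationAt_baseSet x₀] with y hy
  exact congrArg Prod.snd (Trivialization.apply_mk_symm _ hy _)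

theorem smoothVecAt_locFrame (t : ℝ) (x₀ : X) (i : Fin 2) :
    SmoothVecAt (fun _ y ↦ locFrame x₀ i y) (t, x₀) :=
  ContMDiffAt.comp (t, x₀) (g := fun y ↦ (⟨y, locFrame x₀ i y⟩ : TangentBundle IX X))
    (f := Prod.snd) (locFrame_smooth x₀ i) contMDiffAt_snd

theorem SmoothFormAt.apply {θ : ℝ → ∀ x : X, TangentSpace IX x →L[ℝ] ℝ}
    {Z : ℝ → ∀ x : X, TangentSpace IX x} {p : ℝ × X} (hθ : SmoothFormAt θ p)
    (hZ : SmoothVecAt Z p) :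
    ContMDiffAt JX 𝓘(ℝ, ℝ) ∞ (fun p : ℝ × X ↦ θ p.1 p.2 (Z p.1 p.2)) p := by
  have h1 : ContMDiffAt JX (IX.prod 𝓘(ℝ, ℝ)) ∞
      (fun m : ℝ × X ↦ TotalSpace.mk' ℝ (E := Bundle.Trivial X ℝ) m.2 (θ m.1 m.2 (Z m.1 m.2))) p :=
    ContMDiffAt.clm_bundle_apply (F₁ := E2) (F₂ := ℝ) (E₁ := fun y : X ↦ TangentSpace IX y)
      (E₂ := Bundle.Trivial X ℝ) (b := fun m : ℝ × X ↦ m.2) hθ hZ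
  exact (contMDiffAt_totalSpace.1 h1).2

theorem locFrame_sum {x₀ y : X}
    (hy : y ∈ (trivializationAt E2 (TangentSpace IX : X → Type _) x₀).baseSet) (v : E2) :
    (trivializationAt E2 (TangentSpace IX) x₀).symm y v
      = v 0 • locFrame x₀ 0 y + v 1 • locFrame x₀ 1 y := by
  have hv : v = v 0 • EuclideanSpace.single 0 (1 : ℝ) + v 1 • EuclideanSpace.single 1 (1 : ℝ) := by
    ext i; fin_cases i <;> simp
  have key : ∀ w, (trivializationAt E2 (TangentSpace IX) x₀).symm y w
      = (trivializationAt E2 (TangentSpace IX) x₀).symmL ℝ y w := fun w ↦ by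
    rw [Trivialization.symmL_apply _ hy]
  unfold locFrame
  rw [key, key, key, ← map_smul, ← map_smul, ← map_add, ← hv]

/-- In the trivialization a covector is the sum of its two frame components times the coordinate
projections, so smooth components suffice. -/
theorem SmoothFormAt.of_locFrame {θ : ℝ → ∀ x : X, TangentSpace IX x →L[ℝ] ℝ} {p : ℝ × X}
    (h : ∀ i, ContMDiffAt JX 𝓘(ℝ, ℝ) ∞
      (fun m : ℝ × X ↦ θ m.1 m.2 (locFrame p.2 i m.2)) p) : SmoothFormAt θ p := by
  have key := contMDiffAt_hom_bundle (IM := JX) (IB := IX) (n := ∞) (F₁ := E2) (F₂ := ℝ)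
    (E₁ := fun y : X ↦ TangentSpace IX y) (E₂ := Bundle.Trivial X ℝ) (x₀ := p)
    (fun m : ℝ × X ↦ ⟨m.2, θ m.1 m.2⟩)
  refine key.2 ⟨contMDiffAt_snd, ?_⟩
  have hs : ContMDiffAt JX 𝓘(ℝ, E2 →L[ℝ] ℝ) ∞ (fun m : ℝ × X ↦
      θ m.1 m.2 (locFrame p.2 0 m.2) • (EuclideanSpace.proj 0 : E2 →L[ℝ] ℝ)
      + θ m.1 m.2 (locFrame p.2 1 m.2) • (EuclideanSpace.proj 1 : E2 →L[ℝ] ℝ)) p :=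
    ((h 0).smul contMDiffAt_const).add ((h 1).smul contMDiffAt_const)
  refine hs.congr_of_eventuallyEq ?_
  have hb := mem_trivializationAt_baseSet p.2
  filter_upwards [(continuousAt_snd (p := p)).eventually hb] with m hm
  ext v
  rw [ContinuousLinearMap.inCoordinates_eq hm (Set.mem_univ _)]
  have e1 := locFrame_sum hm v
  have e2 : (θ m.1 m.2) ((trivializationAt E2 (TangentSpace IX) p.2).symm m.2 v) =
      v 0 * θ m.1 m.2 (locFrame p.2 0 m.2) + v 1 * θ m.1 m.2 (locFrame p.2 1 m.2) := by
    rw [e1, map_add, map_smul, map_smul, smul_eq_mul, smul_eq_mul]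
  refine Eq.trans e2 ?_
  simp [mul_comm]

theorem SmoothVecAt.of_coeff {Z : ℝ → ∀ x : X, TangentSpace IX x} {p : ℝ × X} {f : Fin 2 → ℝ × X → ℝ}
    (hf : ∀ i, ContMDiffAt JX 𝓘(ℝ, ℝ) ∞ (f i) p)
    (h : ∀ᶠ m in 𝓝 p, Z m.1 m.2 = f 0 m • locFrame p.2 0 m.2 + f 1 m • locFrame p.2 1 m.2) :
    SmoothVecAt Z p := by
  unfold SmoothVecAt
  rw [contMDiffAt_totalSpace]
  refine ⟨contMDiffAt_snd, ?_⟩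
  have hs : ContMDiffAt JX 𝓘(ℝ, E2) ∞ (fun m : ℝ × X ↦
      f 0 m • (EuclideanSpace.single 0 (1 : ℝ) : E2) + f 1 m • EuclideanSpace.single 1 (1 : ℝ)) p :=
    ((hf 0).smul contMDiffAt_const).add ((hf 1).smul contMDiffAt_const)
  refine hs.congr_of_eventuallyEq ?_
  have hb := mem_trivializationAt_baseSet p.2
  filter_upwards [(continuousAt_snd (p := p)).eventually hb, h] with m hm hZ
  have e1 := locFrame_sum hm (f 0 m • (EuclideanSpace.single 0 (1 : ℝ) : E2)
    + f 1 m • EuclideanSpace.single 1 (1 : ℝ))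
  have e2 : Z m.1 m.2 = (trivializationAt E2 (TangentSpace IX) p.2).symm m.2
      (f 0 m • (EuclideanSpace.single 0 (1 : ℝ) : E2) + f 1 m • EuclideanSpace.single 1 (1 : ℝ)) := by
    rw [e1, hZ]; simp
  change (trivializationAt E2 (TangentSpace IX) p.2 ⟨m.2, Z m.1 m.2⟩).2 = _
  rw [e2]
  exact congrArg Prod.snd (Trivialization.apply_mk_symm _ hm _)

theorem SmoothFormAt.smul {f : ℝ → X → ℝ} {θ : ℝ → ∀ x : X, TangentSpace IX x →L[ℝ] ℝ} {p : ℝ × X}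
    (hf : ContMDiffAt JX 𝓘(ℝ, ℝ) ∞ (fun m : ℝ × X ↦ f m.1 m.2) p) (hθ : SmoothFormAt θ p) :
    SmoothFormAt (fun t x ↦ f t x • θ t x) p :=
  SmoothFormAt.of_locFrame fun i ↦ hf.mul (hθ.apply (smoothVecAt_locFrame p.1 p.2 i))

/-- The differential of a smooth family of functions is a smooth family of one-forms. -/
theorem smoothFormAt_dX {F : ℝ → X → ℝ} (hF : IsSmoothFun F) (p : ℝ × X) :
    SmoothFormAt (dX F) p := by
  apply SmoothFormAt.of_locFrame
  intro i
  have h1 := ContMDiffAt.mfderiv (J := JX) (I := IX) (I' := 𝓘(ℝ, ℝ)) (n := ∞) (m := ∞) (x₀ := p)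
    (fun (m : ℝ × X) (y : X) ↦ F m.1 y) (fun m ↦ m.2)
    (ContMDiffAt.comp (p, p.2) (g := fun m : ℝ × X ↦ F m.1 m.2)
      (f := fun m : (ℝ × X) × X ↦ (m.1.1, m.2)) hF.contMDiffAt
      ((contMDiffAt_fst.comp _ contMDiffAt_fst).prodMk contMDiffAt_snd))
    contMDiffAt_snd (by simp)
  have h2 := ContMDiffAt.clm_apply h1 (contMDiffAt_const (c := (EuclideanSpace.single i (1 : ℝ) : E2)))
  refine h2.congr_of_eventuallyEq ?_
  have hb := mem_trivializationAt_baseSet p.2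
  filter_upwards [(continuousAt_snd (p := p)).eventually hb] with m hm
  unfold inTangentCoordinates
  rw [ContinuousLinearMap.inCoordinates_eq hm (by simp [chartAt_self_eq])]
  have key : ∀ (b b' : ℝ) (v : ℝ),
      (trivializationAt ℝ (TangentSpace 𝓘(ℝ, ℝ) : ℝ → Type _) b ⟨b', v⟩).2 = v := fun b b' v ↦ by
    rw [trivializationAt_model_space_apply]
  exact (key (F p.1 p.2) (F m.1 m.2) _).symm

/-- The coordinate functions of the chart at `x₀`. -/
def coordFun (x₀ : X) (i : Fin 2) (y : X) : ℝ := (extChartAt IX x₀ y) i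

theorem coordFun_smooth (x₀ : X) (i : Fin 2) {y : X} (hy : y ∈ (chartAt E2 x₀).source) :
    ContMDiffAt IX 𝓘(ℝ, ℝ) ∞ (coordFun x₀ i) y := by
  have h1 : ContMDiffAt 𝓘(ℝ, E2) 𝓘(ℝ, ℝ) ∞ (EuclideanSpace.proj i : E2 →L[ℝ] ℝ)
      (extChartAt IX x₀ y) := (EuclideanSpace.proj i : E2 →L[ℝ] ℝ).contMDiffAt
  exact h1.comp y (contMDiffAt_extChartAt' hy)

/-- The differentials of the coordinates are dual to `locFrame`. This reduces exterior derivatives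
of arbitrary forms to those of `f dx_i`. -/
theorem form_eq_sum_coordFun {x₀ y : X} (hy : y ∈ (chartAt E2 x₀).source)
    (θ : TangentSpace IX y →L[ℝ] ℝ) :
    θ = θ (locFrame x₀ 0 y) • mvfderiv IX (coordFun x₀ 0) y
      + θ (locFrame x₀ 1 y) • mvfderiv IX (coordFun x₀ 1) y := by
  ext v
  have hb : y ∈ (trivializationAt E2 (TangentSpace IX : X → Type _) x₀).baseSet := by
    simpa using hy
  set w : E2 := (trivializationAt E2 (TangentSpace IX) x₀).continuousLinearMapAt ℝ y v with hw
  have e0 : w = mfderiv IX 𝓘(ℝ, E2) (extChartAt IX x₀) y v := by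
    rw [hw, TangentBundle.continuousLinearMapAt_trivializationAt hy]
    rfl
  have e1 : v = w 0 • locFrame x₀ 0 y + w 1 • locFrame x₀ 1 y := by
    rw [← locFrame_sum hb, ← Trivialization.symmL_apply (R := ℝ) _ hb, hw,
      Trivialization.symmL_continuousLinearMapAt _ hb]
  have e2 : ∀ i, mvfderiv IX (coordFun x₀ i) y v = w i := by
    intro i
    have h1 : HasMFDerivAt 𝓘(ℝ, E2) 𝓘(ℝ, ℝ) (EuclideanSpace.proj i : E2 →L[ℝ] ℝ)
      (extChartAt IX x₀ y) (EuclideanSpace.proj i : E2 →L[ℝ] ℝ) :=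
      (EuclideanSpace.proj i : E2 →L[ℝ] ℝ).hasMFDerivAt
    have h2 := h1.comp y (mdifferentiableAt_extChartAt hy).hasMFDerivAt
    have h3 : coordFun x₀ i = (EuclideanSpace.proj i : E2 →L[ℝ] ℝ) ∘ (extChartAt IX x₀) := rfl
    rw [mvfderiv, h3, h2.mfderiv, e0]
    rfl
  rw [_root_.add_apply, _root_.smul_apply, _root_.smul_apply, e2, e2]
  nth_rewrite 1 [e1]
  rw [map_add, map_smul, map_smul, smul_eq_mul, smul_eq_mul, smul_eq_mul, smul_eq_mul]
  ring

/-! ### The product `ℝ × ℝ × X` -/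

theorem dxu_apply (p : ℝ × ℝ × X) (a : TangentSpace IM p) : dxu p a = a.1 := by
  unfold dxu mvfderiv
  rw [mfderiv_fst]
  rfl

theorem projX_apply (p : ℝ × ℝ × X) (a : TangentSpace IM p) : projX p a = a.2.2 := by
  have h : projX p =
      mfderiv IM IX ((Prod.snd : ℝ × X → X) ∘ (Prod.snd : ℝ × ℝ × X → ℝ × X)) p := rfl
  rw [h, mfderiv_comp (I' := 𝓘(ℝ, ℝ).prod IX) p mdifferentiableAt_snd mdifferentiableAt_snd,
    mfderiv_snd, mfderiv_snd]
  rfl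

theorem dxv_apply (p : ℝ × ℝ × X) (a : TangentSpace IM p) : dxv p a = a.2.1 := by
  have h : dxv p = mvfderiv IM ((Prod.fst : ℝ × X → ℝ) ∘ (Prod.snd : ℝ × ℝ × X → ℝ × X)) p := rfl
  rw [h, mvfderiv_comp (I := 𝓘(ℝ, ℝ).prod IX) p mdifferentiableAt_fst mdifferentiableAt_snd,
    mvfderiv, mfderiv_fst, mfderiv_snd]
  rfl

theorem partialV_eq (p : ℝ × ℝ × X) : partialV p = ((0, 1, 0) : ℝ × ℝ × E2) := by
  have h : HasMFDerivAt 𝓘(ℝ, ℝ) IM (fun s : ℝ ↦ ((p.1, s, p.2.2) : ℝ × ℝ × X)) p.2.1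
      ((0 : ℝ →L[ℝ] ℝ).prod ((ContinuousLinearMap.id ℝ ℝ).prod (0 : ℝ →L[ℝ] E2))) :=
    (hasMFDerivAt_const p.1 p.2.1).prodMk
      ((hasMFDerivAt_id p.2.1).prodMk (hasMFDerivAt_const p.2.2 p.2.1))
  rw [partialV, h.mfderiv]
  rfl

theorem smooth_projX : ContMDiff IM IX ∞ (fun p : ℝ × ℝ × X ↦ p.2.2) :=
  contMDiff_snd.comp contMDiff_snd

/-- The projection to `ℝ × X`. -/
def projUX (p : ℝ × ℝ × X) : ℝ × X := (p.1, p.2.2)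

theorem smooth_projUX : ContMDiff IM JX ∞ (projUX (X := X)) :=
  contMDiff_fst.prodMk smooth_projX

/-- The derivative of a function on `ℝ × ℝ × X` which does not depend on `x_v`. -/
theorem mvfderiv_family {f : ℝ → X → ℝ} {p : ℝ × ℝ × X}
    (hf : MDifferentiableAt JX 𝓘(ℝ, ℝ) (fun m : ℝ × X ↦ f m.1 m.2) (p.1, p.2.2))
    (a : TangentSpace IM p) :
    mvfderiv IM (fun p : ℝ × ℝ × X ↦ f p.1 p.2.2) p a =
      dxu p a * deriv (fun τ ↦ f τ p.2.2) p.1 + mvfderiv IX (f p.1) p.2.2 (projX p a) := by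
  have hA : HasMFDerivAt IM JX (projUX (X := X)) p
      ((ContinuousLinearMap.fst ℝ ℝ (ℝ × E2)).prod
        ((ContinuousLinearMap.snd ℝ ℝ E2).comp (ContinuousLinearMap.snd ℝ ℝ (ℝ × E2)))) :=
    (hasMFDerivAt_fst p).prodMk ((hasMFDerivAt_snd _).comp p (hasMFDerivAt_snd p))
  have h0 := hf.hasMFDerivAt.comp p hA
  rw [mfderiv_prod_eq_add hf] at h0
  have i1 : HasMFDerivAt 𝓘(ℝ, ℝ) JX (fun τ : ℝ ↦ (τ, p.2.2)) p.1
      ((ContinuousLinearMap.id ℝ ℝ).prod (0 : ℝ →L[ℝ] E2)) :=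
    (hasMFDerivAt_id p.1).prodMk (hasMFDerivAt_const p.2.2 p.1)
  have i2 : HasMFDerivAt IX JX (fun y : X ↦ (p.1, y)) p.2.2
      ((0 : E2 →L[ℝ] ℝ).prod (ContinuousLinearMap.id ℝ E2)) :=
    (hasMFDerivAt_const p.1 p.2.2).prodMk (hasMFDerivAt_id p.2.2)
  have d1 : MDifferentiableAt 𝓘(ℝ, ℝ) 𝓘(ℝ, ℝ) (fun τ ↦ f τ p.2.2) p.1 :=
    hf.comp p.1 i1.mdifferentiableAt
  have d2 : MDifferentiableAt IX 𝓘(ℝ, ℝ) (f p.1) p.2.2 :=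
    hf.comp p.2.2 i2.mdifferentiableAt
  have c1 : mfderiv JX 𝓘(ℝ, ℝ) (fun z : ℝ × X ↦ f z.1 p.2.2) (p.1, p.2.2) =
      (mfderiv 𝓘(ℝ, ℝ) 𝓘(ℝ, ℝ) (fun τ ↦ f τ p.2.2) p.1).comp (ContinuousLinearMap.fst ℝ ℝ E2) :=
    (d1.hasMFDerivAt.comp (p.1, p.2.2) (hasMFDerivAt_fst (I := 𝓘(ℝ, ℝ)) (I' := IX) _)).mfderiv
  have c2 : mfderiv JX 𝓘(ℝ, ℝ) (fun z : ℝ × X ↦ f p.1 z.2) (p.1, p.2.2) =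
      (mfderiv IX 𝓘(ℝ, ℝ) (f p.1) p.2.2).comp (ContinuousLinearMap.snd ℝ ℝ E2) :=
    (d2.hasMFDerivAt.comp (p.1, p.2.2) (hasMFDerivAt_snd (I := 𝓘(ℝ, ℝ)) (I' := IX) _)).mfderiv
  have h1 := h0.mfderiv
  have h2 : mvfderiv IM (fun p : ℝ × ℝ × X ↦ f p.1 p.2.2) p a =
      mfderiv IM 𝓘(ℝ, ℝ) ((fun m : ℝ × X ↦ f m.1 m.2) ∘ projUX) p a := rfl
  rw [h2, h1, dxu_apply, projX_apply]
  have h3 : deriv (fun τ ↦ f τ p.2.2) p.1 = fderiv ℝ (fun τ ↦ f τ p.2.2) p.1 1 := rfl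
  have h4 : a.1 * deriv (fun τ ↦ f τ p.2.2) p.1 = fderiv ℝ (fun τ ↦ f τ p.2.2) p.1 a.1 := by
    rw [h3, ← smul_eq_mul, ← map_smul, smul_eq_mul, mul_one]
  rw [h4, ← mfderiv_eq_fderiv]
  exact congrArg₂ (· + ·) (DFunLike.congr_fun c1 ((a.1, a.2.2) : ℝ × E2))
    (DFunLike.congr_fun c2 ((a.1, a.2.2) : ℝ × E2))

/-- The one-form on `ℝ × ℝ × X` defined by a family of one-forms on `X`. -/
def pullForm (θ : ℝ → ∀ x : X, TangentSpace IX x →L[ℝ] ℝ) (p : ℝ × ℝ × X) :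
    TangentSpace IM p →L[ℝ] ℝ := (θ p.1 p.2.2).comp (projX p)

theorem mdifferentiableAt_projX {V : ∀ p : ℝ × ℝ × X, TangentSpace IM p} {p : ℝ × ℝ × X}
    (hV : MDifferentiableAt IM IM.tangent
      (fun y ↦ (V y : TangentBundle IM (ℝ × ℝ × X))) p) :
    MDifferentiableAt IM IX.tangent
      (fun y ↦ (⟨y.2.2, projX y (V y)⟩ : TangentBundle IX X)) p := by
  have h1 : ContMDiff IM.tangent IX.tangent ∞
      (tangentMap IM IX (fun p : ℝ × ℝ × X ↦ p.2.2)) :=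
    smooth_projX.contMDiff_tangentMap (by simp)
  exact (h1.mdifferentiableAt (by simp)).comp p hV

theorem formDiffAt_pullForm {θ : ℝ → ∀ x : X, TangentSpace IX x →L[ℝ] ℝ} {p : ℝ × ℝ × X}
    (hθ : SmoothFormAt θ (p.1, p.2.2)) : FormDiffAt IM (pullForm θ) p := by
  intro V hV
  have h0 := ((hθ.mdifferentiableAt (by simp)).comp p
    ((smooth_projUX (X := X)).mdifferentiableAt (x := p) (by simp)))
  have h1 : MDifferentiableAt IM (IX.prod 𝓘(ℝ, ℝ))
      (fun m : ℝ × ℝ × X ↦ TotalSpace.mk' ℝ (E := Bundle.Trivial X ℝ) m.2.2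
        (θ m.1 m.2.2 (projX m (V m)))) p :=
    MDifferentiableAt.clm_bundle_apply (F₁ := E2) (F₂ := ℝ) (E₁ := fun y : X ↦ TangentSpace IX y)
      (E₂ := Bundle.Trivial X ℝ) (b := fun m : ℝ × ℝ × X ↦ m.2.2) h0
      (mdifferentiableAt_projX hV)
  exact ((mdifferentiableAt_totalSpace _ _).1 h1).2

theorem mvfderiv_comp_projX {f : X → ℝ} {p : ℝ × ℝ × X}
    (hf : MDifferentiableAt IX 𝓘(ℝ, ℝ) f p.2.2) :
    mvfderiv IM (fun p : ℝ × ℝ × X ↦ f p.2.2) p = (mvfderiv IX f p.2.2).comp (projX p) :=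
  mvfderiv_comp (g := f) (f := fun p : ℝ × ℝ × X ↦ p.2.2) p hf
    ((smooth_projX (X := X)).mdifferentiableAt (by simp))

theorem SmoothFormAt.slice {f : ℝ × X → ℝ} {t : ℝ} {x : X}
    (hf : ContMDiffAt JX 𝓘(ℝ, ℝ) ∞ f (t, x)) :
    ContMDiffAt IX 𝓘(ℝ, ℝ) ∞ (fun y ↦ f (t, y)) x :=
  hf.comp x (contMDiffAt_const.prodMk contMDiffAt_id)

/-- A smooth family of one-forms has exterior derivatives on `X` and on `ℝ × ℝ × X`. -/
theorem SmoothFormAt.exists_isExtDerivAt {θ : ℝ → ∀ x : X, TangentSpace IX x →L[ℝ] ℝ}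
    {p : ℝ × ℝ × X} (hθ : SmoothFormAt θ (p.1, p.2.2)) :
    ∃ η : TangentSpace IX p.2.2 → TangentSpace IX p.2.2 → ℝ,
      IsExtDerivAt IX (θ p.1) p.2.2 η ∧
      IsExtDerivAt IM (pullForm θ) p fun a b ↦
        dxu p a * partialU θ p.1 p.2.2 (projX p b) - dxu p b * partialU θ p.1 p.2.2 (projX p a)
          + η (projX p a) (projX p b) := by
  set x₀ := p.2.2 with hx₀
  have hsrc : x₀ ∈ (chartAt E2 x₀).source := mem_chart_source E2 x₀
  -- Near the point `θ = ∑ f i dx_i`, hence `dθ = ∑ d(f i) ∧ dx_i`, both on `X` and on the product.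
  -- On the product `d(f i)` has the extra term `∂_u (f i) dx_u`, which produces `dx_u ∧ ∂_u θ`.
  let f : Fin 2 → ℝ → X → ℝ := fun i t y ↦ θ t y (locFrame x₀ i y)
  have hf : ∀ i, ContMDiffAt JX 𝓘(ℝ, ℝ) ∞ (fun m : ℝ × X ↦ f i m.1 m.2) (p.1, x₀) := fun i ↦
    hθ.apply (smoothVecAt_locFrame p.1 x₀ i)
  have hfx : ∀ i, MDifferentiableAt IX 𝓘(ℝ, ℝ) (f i p.1) x₀ := fun i ↦
    (SmoothFormAt.slice (hf i)).mdifferentiableAt (by simp)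
  have hc : ∀ i, ContMDiffAt IX 𝓘(ℝ, ℝ) 2 (coordFun x₀ i) x₀ := fun i ↦
    (coordFun_smooth x₀ i hsrc).of_le two_le_infty
  have hcM : ∀ i, ContMDiffAt IM 𝓘(ℝ, ℝ) 2 (fun p : ℝ × ℝ × X ↦ coordFun x₀ i p.2.2) p := fun i ↦
    (hc i).comp p ((smooth_projX (X := X)).contMDiffAt.of_le two_le_infty)
  have dX' : ∀ i, IsExtDerivAt IX (fun y ↦ f i p.1 y • mvfderiv IX (coordFun x₀ i) y) x₀ _ := fun i ↦
    IsExtDerivAt.smul (hfx i) (formDiffAt_mvfderiv (hc i)) (isExtDerivAt_mvfderiv (hc i))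
  have fX : ∀ i, FormDiffAt IX (fun y ↦ f i p.1 y • mvfderiv IX (coordFun x₀ i) y) x₀ := fun i ↦
    FormDiffAt.smul (hfx i) (formDiffAt_mvfderiv (hc i))
  have hfM : ∀ i, MDifferentiableAt IM 𝓘(ℝ, ℝ) (fun p : ℝ × ℝ × X ↦ f i p.1 p.2.2) p := fun i ↦
    ((hf i).mdifferentiableAt (by simp)).comp p
      ((smooth_projUX (X := X)).mdifferentiableAt (x := p) (by simp))
  have dM : ∀ i, IsExtDerivAt IM (fun m : ℝ × ℝ × X ↦ f i m.1 m.2.2 •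
      mvfderiv IM (fun m : ℝ × ℝ × X ↦ coordFun x₀ i m.2.2) m) p _ := fun i ↦
    IsExtDerivAt.smul (hfM i) (formDiffAt_mvfderiv (hcM i)) (isExtDerivAt_mvfderiv (hcM i))
  have fM : ∀ i, FormDiffAt IM (fun m : ℝ × ℝ × X ↦ f i m.1 m.2.2 •
      mvfderiv IM (fun m : ℝ × ℝ × X ↦ coordFun x₀ i m.2.2) m) p := fun i ↦
    FormDiffAt.smul (hfM i) (formDiffAt_mvfderiv (hcM i))
  have hn := (chartAt E2 x₀).open_source.mem_nhds hsrc
  refine ⟨_, ((dX' 0).add (fX 0) (fX 1) (dX' 1)).congr ?_,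
    ((((dM 0).add (fM 0) (fM 1) (dM 1)).congr ?_).congr_right ?_)⟩
  · filter_upwards [hn] with y hy
    exact (form_eq_sum_coordFun hy _).symm
  · have : ∀ᶠ m : ℝ × ℝ × X in 𝓝 p, m.2.2 ∈ (chartAt E2 x₀).source :=
      (continuous_snd.comp continuous_snd).continuousAt.eventually hn
    filter_upwards [this] with m hm
    rw [mvfderiv_comp_projX ((coordFun_smooth x₀ 0 hm).mdifferentiableAt (by simp)),
      mvfderiv_comp_projX ((coordFun_smooth x₀ 1 hm).mdifferentiableAt (by simp)), pullForm,
      form_eq_sum_coordFun hm (θ m.1 m.2.2)]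
    rfl
  · intro a b
    have hd : ∀ i, DifferentiableAt ℝ (fun τ ↦ f i τ x₀) p.1 := fun i ↦ by
      have h1 : ContMDiffAt 𝓘(ℝ, ℝ) 𝓘(ℝ, ℝ) ∞ (fun τ ↦ f i τ x₀) p.1 :=
        (hf i).comp p.1 (contMDiffAt_id.prodMk contMDiffAt_const)
      exact h1.contDiffAt.differentiableAt (by simp)
    have hp : ∀ v : TangentSpace IX x₀, partialU θ p.1 x₀ v =
        deriv (fun τ ↦ f 0 τ x₀) p.1 * mvfderiv IX (coordFun x₀ 0) x₀ v
        + deriv (fun τ ↦ f 1 τ x₀) p.1 * mvfderiv IX (coordFun x₀ 1) x₀ v := by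
      intro v
      let c : Fin 2 → (E2 →L[ℝ] ℝ) := fun i ↦ mvfderiv IX (coordFun x₀ i) x₀
      have e : (fun τ ↦ (θ τ x₀ : E2 →L[ℝ] ℝ)) = fun τ ↦ f 0 τ x₀ • c 0 + f 1 τ x₀ • c 1 := by
        funext τ
        exact form_eq_sum_coordFun hsrc (θ τ x₀)
      have e2 : HasDerivAt (fun τ ↦ f 0 τ x₀ • c 0 + f 1 τ x₀ • c 1)
          (deriv (fun τ ↦ f 0 τ x₀) p.1 • c 0 + deriv (fun τ ↦ f 1 τ x₀) p.1 • c 1) p.1 :=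
        ((hd 0).hasDerivAt.smul_const (c 0)).add ((hd 1).hasDerivAt.smul_const (c 1))
      unfold partialU
      rw [e, e2.deriv]
      rfl
    rw [mvfderiv_family ((hf 0).mdifferentiableAt (by simp)),
      mvfderiv_family ((hf 0).mdifferentiableAt (by simp)),
      mvfderiv_family ((hf 1).mdifferentiableAt (by simp)),
      mvfderiv_family ((hf 1).mdifferentiableAt (by simp)), hp, hp,
      mvfderiv_comp_projX ((coordFun_smooth x₀ 0 hsrc).mdifferentiableAt (by simp)),
      mvfderiv_comp_projX ((coordFun_smooth x₀ 1 hsrc).mdifferentiableAt (by simp))]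
    simp only [ContinuousLinearMap.comp_apply]
    ring

theorem SmoothFormAt.isExtDerivAt_pullForm {θ : ℝ → ∀ x : X, TangentSpace IX x →L[ℝ] ℝ}
    {p : ℝ × ℝ × X} (hθ : SmoothFormAt θ (p.1, p.2.2))
    {η : TangentSpace IX p.2.2 → TangentSpace IX p.2.2 → ℝ}
    (h : IsExtDerivAt IX (θ p.1) p.2.2 η) :
    IsExtDerivAt IM (pullForm θ) p fun a b ↦
        dxu p a * partialU θ p.1 p.2.2 (projX p b) - dxu p b * partialU θ p.1 p.2.2 (projX p a)
          + η (projX p a) (projX p b) := by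
  obtain ⟨η', h1, h2⟩ := hθ.exists_isExtDerivAt
  exact h2.congr_right fun a b ↦ by rw [h.unique h1]

/-- The vector of `ℝ × ℝ × X` with the given components. -/
def vecM (p : ℝ × ℝ × X) (a b : ℝ) (z : TangentSpace IX p.2.2) : TangentSpace IM p :=
  ((a, b, z) : ℝ × ℝ × E2)

@[simp]
theorem dxu_vecM (p : ℝ × ℝ × X) (a b : ℝ) (z : TangentSpace IX p.2.2) :
    dxu p (vecM p a b z) = a := dxu_apply p _

@[simp]
theorem dxv_vecM (p : ℝ × ℝ × X) (a b : ℝ) (z : TangentSpace IX p.2.2) :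
    dxv p (vecM p a b z) = b := dxv_apply p _

@[simp]
theorem projX_vecM (p : ℝ × ℝ × X) (a b : ℝ) (z : TangentSpace IX p.2.2) :
    projX p (vecM p a b z) = z := projX_apply p _

theorem vecM_ext {p : ℝ × ℝ × X} {a b : TangentSpace IM p} (h1 : dxu p a = dxu p b)
    (h2 : dxv p a = dxv p b) (h3 : projX p a = projX p b) : a = b := by
  rw [dxu_apply, dxu_apply] at h1
  rw [dxv_apply, dxv_apply] at h2
  rw [projX_apply, projX_apply] at h3
  exact Prod.ext h1 (Prod.ext h2 h3)

/-- The tangent bundle of a product is the product of the tangent bundles; this identification is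
used twice. -/
theorem contMDiffAt_vecM {a b : ℝ × ℝ × X → ℝ} {Z : ℝ → ∀ x : X, TangentSpace IX x}
    {p : ℝ × ℝ × X} (ha : ContMDiffAt IM 𝓘(ℝ, ℝ) ∞ a p) (hb : ContMDiffAt IM 𝓘(ℝ, ℝ) ∞ b p)
    (hZ : SmoothVecAt Z (p.1, p.2.2)) :
    ContMDiffAt IM IM.tangent ∞
      (fun m ↦ (⟨m, vecM m (a m) (b m) (Z m.1 m.2.2)⟩ : TangentBundle IM (ℝ × ℝ × X))) p := by
  have hR : ∀ {f c : ℝ × ℝ × X → ℝ}, ContMDiffAt IM 𝓘(ℝ, ℝ) ∞ f p →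
      ContMDiffAt IM 𝓘(ℝ, ℝ) ∞ c p →
      ContMDiffAt IM 𝓘(ℝ, ℝ).tangent ∞ (fun m ↦ (⟨f m, c m⟩ : TangentBundle 𝓘(ℝ, ℝ) ℝ)) p := by
    intro f c hf hc
    rw [contMDiffAt_totalSpace]
    refine ⟨hf, hc.congr_of_eventuallyEq (Eventually.of_forall fun m ↦ ?_)⟩
    simp only
    rw [trivializationAt_model_space_apply]
  have h1 := hR (f := fun m ↦ m.1) contMDiff_fst.contMDiffAt ha
  have h2 := hR (f := fun m ↦ m.2.1) (contMDiff_fst.comp contMDiff_snd).contMDiffAt hb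
  have h3 : ContMDiffAt IM IX.tangent ∞
      (fun m : ℝ × ℝ × X ↦ (⟨m.2.2, Z m.1 m.2.2⟩ : TangentBundle IX X)) p :=
    ContMDiffAt.comp p (g := fun p : ℝ × X ↦ (⟨p.2, Z p.1 p.2⟩ : TangentBundle IX X))
      (f := projUX) hZ smooth_projUX.contMDiffAt
  have e1 := (contMDiff_equivTangentBundleProd_symm (I := 𝓘(ℝ, ℝ)) (I' := IX) (M := ℝ) (M' := X)
    (n := ∞)).contMDiffAt.comp p (h2.prodMk h3)
  have e2 := (contMDiff_equivTangentBundleProd_symm (I := 𝓘(ℝ, ℝ)) (I' := 𝓘(ℝ, ℝ).prod IX) (M := ℝ)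
    (M' := ℝ × X) (n := ∞)).contMDiffAt.comp p (h1.prodMk e1)
  exact e2

end Families

/-! ### Smoothness in bundles of homomorphisms. -/

section HomBundle

variable {EB : Type*} [NormedAddCommGroup EB] [NormedSpace ℝ EB]
  {HB : Type*} [TopologicalSpace HB] {IB : ModelWithCorners ℝ EB HB}
  {B : Type*} [TopologicalSpace B] [ChartedSpace HB B]
  {EN : Type*} [NormedAddCommGroup EN] [NormedSpace ℝ EN]
  {HN : Type*} [TopologicalSpace HN] {IN : ModelWithCorners ℝ EN HN}
  {N : Type*} [TopologicalSpace N] [ChartedSpace HN N]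
  {F₁ F₂ : Type*} [NormedAddCommGroup F₁] [NormedSpace ℝ F₁] [NormedAddCommGroup F₂]
  [NormedSpace ℝ F₂] {E₁ E₂ : B → Type*} [∀ b, AddCommGroup (E₁ b)] [∀ b, Module ℝ (E₁ b)]
  [∀ b, TopologicalSpace (E₁ b)] [∀ b, AddCommGroup (E₂ b)] [∀ b, Module ℝ (E₂ b)]
  [∀ b, TopologicalSpace (E₂ b)] [TopologicalSpace (TotalSpace F₁ E₁)] [FiberBundle F₁ E₁]
  [VectorBundle ℝ F₁ E₁] [TopologicalSpace (TotalSpace F₂ E₂)] [FiberBundle F₂ E₂]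
  [VectorBundle ℝ F₂ E₂] [∀ b, IsTopologicalAddGroup (E₂ b)] [∀ b, ContinuousSMul ℝ (E₂ b)]

/-- A section of a bundle of homomorphisms is smooth if its values on a local frame are. -/
theorem contMDiffAt_hom_of_frame {ι : Type*} [Fintype ι] [FiniteDimensional ℝ F₁]
    (bas : Module.Basis ι ℝ F₁)
    {f : N → B} {φ : ∀ m : N, E₁ (f m) →L[ℝ] E₂ (f m)} {p : N} (hf : ContMDiffAt IN IB ∞ f p)
    (h : ∀ i, ContMDiffAt IN (IB.prod 𝓘(ℝ, F₂)) ∞ (fun m ↦ TotalSpace.mk' F₂ (f m)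
      (φ m ((trivializationAt F₁ E₁ (f p)).symm (f m) (bas i)))) p) :
    ContMDiffAt IN (IB.prod 𝓘(ℝ, F₁ →L[ℝ] F₂)) ∞
      (fun m ↦ TotalSpace.mk' (F₁ →L[ℝ] F₂) (E := fun b ↦ E₁ b →L[ℝ] E₂ b) (f m) (φ m)) p := by
  have key := contMDiffAt_hom_bundle (IM := IN) (IB := IB) (n := ∞) (F₁ := F₁) (F₂ := F₂)
    (E₁ := E₁) (E₂ := E₂) (x₀ := p) (fun m ↦ ⟨f m, φ m⟩)
  refine key.2 ⟨hf, ?_⟩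
  have hs : ContMDiffAt IN 𝓘(ℝ, F₁ →L[ℝ] F₂) ∞ (fun m ↦ ∑ i,
      (ContinuousLinearMap.smulRightL ℝ F₁ F₂ (LinearMap.toContinuousLinearMap (bas.coord i)))
        (trivializationAt F₂ E₂ (f p)
          ⟨f m, φ m ((trivializationAt F₁ E₁ (f p)).symm (f m) (bas i))⟩).2) p := by
    refine ContMDiffAt.sum fun i _ ↦ ?_
    exact (ContinuousLinearMap.contMDiffAt _).comp p (contMDiffAt_totalSpace.1 (h i)).2
  refine hs.congr_of_eventuallyEq ?_
  have hb1 := hf.continuousAt.eventually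
    ((trivializationAt F₁ E₁ (f p)).open_baseSet.mem_nhds
      (FiberBundle.mem_baseSet_trivializationAt' (f p)))
  have hb2 := hf.continuousAt.eventually
    ((trivializationAt F₂ E₂ (f p)).open_baseSet.mem_nhds
      (FiberBundle.mem_baseSet_trivializationAt' (f p)))
  filter_upwards [hb1, hb2] with m h1 h2
  have h1' : f m ∈ (trivializationAt F₁ E₁ (f p)).baseSet := h1
  have h2' : f m ∈ (trivializationAt F₂ E₂ (f p)).baseSet := h2
  refine (ContinuousLinearMap.inCoordinates_eq h1' h2').trans ?_
  apply ContinuousLinearMap.coe_injective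
  refine bas.ext fun j ↦ ?_
  simp only [ContinuousLinearMap.coe_coe, ContinuousLinearMap.comp_apply, _root_.sum_apply]
  refine Eq.trans ?_ (Finset.sum_eq_single j (fun i _ hij ↦ ?_) (by simp)).symm
  · change _ = (bas.coord j (bas j)) • (trivializationAt F₂ E₂ (f p)
      ⟨f m, φ m ((trivializationAt F₁ E₁ (f p)).symm (f m) (bas j))⟩).2
    rw [Module.Basis.coord_apply, Module.Basis.repr_self, Finsupp.single_eq_same, one_smul,
      ← Trivialization.symmL_apply (R := ℝ) _ h1',
      ← Trivialization.symm_continuousLinearEquivAt_eq' (R := ℝ) _ h1']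
    rfl
  · change (bas.coord i (bas j)) • (trivializationAt F₂ E₂ (f p)
      ⟨f m, φ m ((trivializationAt F₁ E₁ (f p)).symm (f m) (bas i))⟩).2 = _
    rw [Module.Basis.coord_apply, Module.Basis.repr_self, Finsupp.single_eq_of_ne hij, zero_smul]

end HomBundle

/-! ### Coframes of a plane -/

section Plane

variable {V : Type*} [AddCommGroup V] [Module ℝ V]

/-- The map `(l, n)` to the plane is injective, hence bijective by dimension; the dual vectors are
the preimages of the standard basis. -/
theorem exists_dual_pair (hV : Module.finrank ℝ V = 2) {l n : V →ₗ[ℝ] ℝ}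
    (h : ∀ v, l v = 0 → n v = 0 → v = 0) :
    ∃ e₁ e₂ : V, l e₁ = 1 ∧ n e₁ = 0 ∧ l e₂ = 0 ∧ n e₂ = 1 ∧
      ∀ v, v = l v • e₁ + n v • e₂ := by
  have : FiniteDimensional ℝ V := Module.finite_of_finrank_pos (by omega)
  have inj : Function.Injective (l.prod n) := by
    rw [injective_iff_map_eq_zero]
    intro v hv
    exact h v (congrArg Prod.fst hv) (congrArg Prod.snd hv)
  have surj : Function.Surjective (l.prod n) :=
    (LinearMap.injective_iff_surjective_of_finrank_eq_finrank (by simp [hV])).1 inj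
  obtain ⟨e₁, h₁⟩ := surj (1, 0)
  obtain ⟨e₂, h₂⟩ := surj (0, 1)
  have a1 : l e₁ = 1 := congrArg Prod.fst h₁
  have a2 : n e₁ = 0 := congrArg Prod.snd h₁
  have a3 : l e₂ = 0 := congrArg Prod.fst h₂
  have a4 : n e₂ = 1 := congrArg Prod.snd h₂
  refine ⟨e₁, e₂, a1, a2, a3, a4, fun v ↦ inj ?_⟩
  simp [a1, a2, a3, a4]

end Plane

/-! ### Orthonormal coframes, volume form and Hodge star on a surface. -/

section Surface

variable {X : Type*} [TopologicalSpace X] [ChartedSpace E2 X] [IsManifold IX ∞ X]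

theorem finrank_tangentSpace (x : X) : Module.finrank ℝ (TangentSpace IX x) = 2 :=
  finrank_euclideanSpace_fin (𝕜 := ℝ) (n := 2)

theorem inner_self_eq_zero' (q : SurfaceMetric X) {x : X} {v : TangentSpace IX x}
    (h : q.inner x v v = 0) : v = 0 := by
  by_contra hv
  exact (q.pos x v hv).ne' h

theorem inner_ext (q : SurfaceMetric X) {x : X} {v w : TangentSpace IX x}
    (h : ∀ z, q.inner x v z = q.inner x w z) : v = w := by
  rw [← sub_eq_zero]
  apply inner_self_eq_zero' q
  rw [map_sub (q.inner x) v w, _root_.sub_apply, h, sub_self]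

/-- `ContinuousLinearMap.inverse` has a default value on maps that are not invertible. Here
definiteness makes `q` injective into the dual, and equality of dimensions makes it an isomorphism.
-/
theorem sharp_spec (q : SurfaceMetric X) (x : X) (θ : TangentSpace IX x →L[ℝ] ℝ)
    (w : TangentSpace IX x) : q.inner x (sharp q x θ) w = θ w := by
  let A : E2 →L[ℝ] (E2 →L[ℝ] ℝ) := q.inner x
  have inj : Function.Injective A := fun v w h ↦ inner_ext q fun z ↦ DFunLike.congr_fun h z
  have hfr : Module.finrank ℝ E2 = Module.finrank ℝ (E2 →L[ℝ] ℝ) := by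
    rw [← LinearEquiv.finrank_eq (LinearMap.toContinuousLinearMap (𝕜 := ℝ) (E := E2) (F' := ℝ))]
    simp
  let e : E2 ≃L[ℝ] (E2 →L[ℝ] ℝ) :=
    (LinearEquiv.ofInjectiveOfFinrankEq A.toLinearMap inj hfr).toContinuousLinearEquiv
  have he : A = (e : E2 →L[ℝ] (E2 →L[ℝ] ℝ)) := by ext; rfl
  have h1 : A (A.inverse θ) = θ := by
    rw [he, ContinuousLinearMap.inverse_equiv]
    exact e.apply_symm_apply θ
  exact DFunLike.congr_fun h1 w

theorem eq_sharp {q : SurfaceMetric X} {x : X} {θ : TangentSpace IX x →L[ℝ] ℝ}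
    {v : TangentSpace IX x} (h : ∀ w, q.inner x v w = θ w) : v = sharp q x θ :=
  inner_ext q fun w ↦ by rw [h, sharp_spec]

/-- `(l, n)` is an orthonormal coframe of `q` at `x`. -/
def IsOrthoCoframe (q : SurfaceMetric X) (x : X) (l n : TangentSpace IX x →L[ℝ] ℝ) : Prop :=
  ∀ v w, q.inner x v w = l v * l w + n v * n w

namespace IsOrthoCoframe

variable {q : SurfaceMetric X} {x : X} {l n : TangentSpace IX x →L[ℝ] ℝ}

/-- For an orthonormal coframe the metric duals `l♯` and `n♯` coincide with the algebraic dual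
basis. -/
theorem exists_dual (h : IsOrthoCoframe q x l n) :
    l (sharp q x l) = 1 ∧ n (sharp q x l) = 0 ∧ l (sharp q x n) = 0 ∧ n (sharp q x n) = 1 ∧
      ∀ v, v = l v • sharp q x l + n v • sharp q x n := by
  obtain ⟨e₁, e₂, h1, h2, h3, h4, h5⟩ := exists_dual_pair (finrank_tangentSpace x)
    (l := l.toLinearMap) (n := n.toLinearMap) (fun v hl hn ↦ inner_self_eq_zero' q (by
      have hl' : l v = 0 := hl
      have hn' : n v = 0 := hn
      rw [h, hl', hn']; ring))
  simp only [ContinuousLinearMap.coe_coe] at h1 h2 h3 h4 h5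
  have e1 : e₁ = sharp q x l := eq_sharp fun w ↦ by rw [h, h1, h2]; ring
  have e2 : e₂ = sharp q x n := eq_sharp fun w ↦ by rw [h, h3, h4]; ring
  rw [← e1, ← e2]
  exact ⟨h1, h2, h3, h4, h5⟩

theorem sharp_eq (h : IsOrthoCoframe q x l n) (θ : TangentSpace IX x →L[ℝ] ℝ) :
    sharp q x θ = θ (sharp q x l) • sharp q x l + θ (sharp q x n) • sharp q x n := by
  obtain ⟨h1, h2, h3, h4, h5⟩ := h.exists_dual
  refine (eq_sharp fun w ↦ ?_).symm
  have e : θ w = θ (l w • sharp q x l + n w • sharp q x n) := congrArg θ (h5 w)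
  rw [e, h]
  simp only [map_add, map_smul, smul_eq_mul, h1, h2, h3, h4]
  ring

theorem form_eq (h : IsOrthoCoframe q x l n) (θ : TangentSpace IX x →L[ℝ] ℝ)
    (v : TangentSpace IX x) : θ v = θ (sharp q x l) * l v + θ (sharp q x n) * n v := by
  obtain ⟨h1, h2, h3, h4, h5⟩ := h.exists_dual
  have e : θ v = θ (l v • sharp q x l + n v • sharp q x n) := congrArg θ (h5 v)
  rw [e]
  simp only [map_add, map_smul, smul_eq_mul]
  ring

/-- The value of an alternating form in an orthonormal coframe. -/
theorem alt_eq (h : IsOrthoCoframe q x l n)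
    {A : TangentSpace IX x → TangentSpace IX x → ℝ}
    (hadd : ∀ u v w, A (u + v) w = A u w + A v w) (hsmul : ∀ (c : ℝ) v w, A (c • v) w = c * A v w)
    (halt : ∀ v w, A v w = - A w v) (v w : TangentSpace IX x) :
    A v w = A (sharp q x l) (sharp q x n) * (l v * n w - l w * n v) := by
  obtain ⟨h1, h2, h3, h4, h5⟩ := h.exists_dual
  have hadd' : ∀ u v w, A w (u + v) = A w u + A w v := fun u v w ↦ by
    rw [halt, hadd, halt u, halt v]; ring
  have hsmul' : ∀ (c : ℝ) v w, A w (c • v) = c * A w v := fun c v w ↦ by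
    rw [halt, hsmul, halt v]; ring
  have h0 : ∀ v, A v v = 0 := fun v ↦ by linarith [halt v v]
  have e : A v w = A (l v • sharp q x l + n v • sharp q x n)
      (l w • sharp q x l + n w • sharp q x n) := congrArg₂ A (h5 v) (h5 w)
  rw [e]
  simp only [hadd, hadd', hsmul, hsmul', h0, halt (sharp q x n) (sharp q x l)]
  ring

/-- The matrix of `(l, n)` on the standard basis is invertible: its determinant times that of the
coordinates of the dual basis is `1`. -/
theorem wedge_ne_zero (h : IsOrthoCoframe q x l n) :
    l (tangentBasis x 0) * n (tangentBasis x 1) - l (tangentBasis x 1) * n (tangentBasis x 0)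
      ≠ 0 := by
  obtain ⟨h1, h2, h3, h4, h5⟩ := h.exists_dual
  have hb : ∀ v : TangentSpace IX x, ∃ a b : ℝ, v = a • tangentBasis x 0 + b • tangentBasis x 1 := by
    intro v
    let v' : E2 := v
    refine ⟨v' 0, v' 1, ?_⟩
    have : v' = v' 0 • EuclideanSpace.single 0 (1 : ℝ) + v' 1 • EuclideanSpace.single 1 (1 : ℝ) := by
      ext i; fin_cases i <;> simp
    exact this
  obtain ⟨a, b, hab⟩ := hb (sharp q x l)
  obtain ⟨c, d, hcd⟩ := hb (sharp q x n)
  rw [hab, map_add, map_smul, map_smul, smul_eq_mul, smul_eq_mul] at h1 h2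
  rw [hcd, map_add, map_smul, map_smul, smul_eq_mul, smul_eq_mul] at h3 h4
  intro h0
  have : (1 : ℝ) = (a * d - b * c) * (l (tangentBasis x 0) * n (tangentBasis x 1)
      - l (tangentBasis x 1) * n (tangentBasis x 0)) := by
    linear_combination (-n (tangentBasis x 0) * c - n (tangentBasis x 1) * d) * h1
      + (l (tangentBasis x 0) * c + l (tangentBasis x 1) * d) * h2 - h4
  rw [h0, mul_zero] at this
  exact one_ne_zero this

end IsOrthoCoframe

theorem orient_swap (o : SurfaceOrientation X) {x : X} (v w : TangentSpace IX x) :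
    o.form x v w = - o.form x w v := by
  have h := o.alt x (v + w)
  simp only [map_add, _root_.add_apply, o.alt, zero_add, add_zero] at h
  linarith

/-- The sign of the coframe `(l, n)` with respect to the orientation. -/
def frameSign (o : SurfaceOrientation X) {x : X} (l n : TangentSpace IX x →L[ℝ] ℝ) : ℝ :=
  SignType.sign (o.form x (tangentBasis x 0) (tangentBasis x 1) *
    (l (tangentBasis x 0) * n (tangentBasis x 1) - l (tangentBasis x 1) * n (tangentBasis x 0)))

namespace IsOrthoCoframe

variable {q : SurfaceMetric X} {x : X} {l n : TangentSpace IX x →L[ℝ] ℝ}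

theorem orient_eq (h : IsOrthoCoframe q x l n) (o : SurfaceOrientation X)
    (v w : TangentSpace IX x) :
    o.form x v w = o.form x (sharp q x l) (sharp q x n) * (l v * n w - l w * n v) :=
  h.alt_eq (A := fun v w ↦ o.form x v w) (fun u v w ↦ by rw [map_add]; rfl)
    (fun c v w ↦ by rw [map_smul]; rfl) (orient_swap o) v w

theorem orient_ne_zero (h : IsOrthoCoframe q x l n) (o : SurfaceOrientation X) :
    o.form x (sharp q x l) (sharp q x n) ≠ 0 := by
  intro h0
  refine o.ne_zero x ?_
  ext v w
  rw [h.orient_eq o, h0, zero_mul]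
  rfl

theorem frameSign_sq (h : IsOrthoCoframe q x l n) (o : SurfaceOrientation X) :
    frameSign o l n * frameSign o l n = 1 := by
  have h1 := h.orient_ne_zero o
  have h2 := h.wedge_ne_zero
  unfold frameSign
  rw [h.orient_eq o]
  have : (o.form x (sharp q x l) (sharp q x n) *
    (l (tangentBasis x 0) * n (tangentBasis x 1) - l (tangentBasis x 1) * n (tangentBasis x 0))) *
    (l (tangentBasis x 0) * n (tangentBasis x 1) - l (tangentBasis x 1) * n (tangentBasis x 0)) ≠ 0 :=
    mul_ne_zero (mul_ne_zero h1 h2) h2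
  rcases lt_or_gt_of_ne this with h | h
  · rw [sign_neg h]; simp
  · rw [sign_pos h]; simp

/-- The Gram determinant is the square of the determinant `D` of the coframe. After division by the
absolute value of the orienting form `c D`, only the sign of `c` is left, which is `frameSign`. -/
theorem volumeForm_eq (h : IsOrthoCoframe q x l n) (o : SurfaceOrientation X)
    (v w : TangentSpace IX x) :
    volumeForm o q x v w = frameSign o l n * (l v * n w - l w * n v) := by
  have h1 := h.orient_ne_zero o
  have h2 := h.wedge_ne_zero
  unfold volumeForm frameSign
  rw [_root_.smul_apply, _root_.smul_apply, h.orient_eq o v w,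
    h.orient_eq o (tangentBasis x 0) (tangentBasis x 1)]
  set D := l (tangentBasis x 0) * n (tangentBasis x 1) - l (tangentBasis x 1) * n (tangentBasis x 0)
    with hD
  set c := o.form x (sharp q x l) (sharp q x n) with hc
  have hdet : Matrix.det (Matrix.of fun i j ↦ q.inner x (tangentBasis x i) (tangentBasis x j))
      = D ^ 2 := by
    rw [Matrix.det_fin_two]
    simp only [Matrix.of_apply, h _ _, hD]
    ring
  rw [hdet, Real.sqrt_sq_eq_abs, abs_mul, smul_eq_mul]
  have hs : SignType.sign (c * D * D) = SignType.sign c := by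
    rw [mul_assoc, sign_mul, sign_pos (mul_self_pos.2 h2), mul_one]
  rw [hs]
  have h3 : |D| ≠ 0 := abs_ne_zero.2 h2
  have h4 : |c| ≠ 0 := abs_ne_zero.2 h1
  have h5 : c = SignType.sign c * |c| := (sign_mul_abs c).symm
  field_simp
  nth_rewrite 1 [h5]
  ring

theorem hodgeStar_eq (h : IsOrthoCoframe q x l n) (o : SurfaceOrientation X)
    (θ : TangentSpace IX x →L[ℝ] ℝ) :
    hodgeStar o q x θ = (frameSign o l n * θ (sharp q x l)) • n
      - (frameSign o l n * θ (sharp q x n)) • l := by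
  obtain ⟨h1, h2, h3, h4, h5⟩ := h.exists_dual
  ext v
  unfold hodgeStar
  rw [h.volumeForm_eq, h.sharp_eq θ]
  simp only [map_add, map_smul, smul_eq_mul, h1, h2, h3, h4, _root_.sub_apply, _root_.smul_apply]
  ring

end IsOrthoCoframe

/-! ### Smoothness of sharp and of coframes -/

theorem exists_locFrame_coeff {x₀ y : X}
    (hy : y ∈ (trivializationAt E2 (TangentSpace IX : X → Type _) x₀).baseSet)
    (v : TangentSpace IX y) : ∃ c d : ℝ, v = c • locFrame x₀ 0 y + d • locFrame x₀ 1 y := by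
  let w : E2 := (trivializationAt E2 (TangentSpace IX) x₀).continuousLinearMapAt ℝ y v
  refine ⟨w 0, w 1, ?_⟩
  rw [← locFrame_sum hy, ← Trivialization.symmL_apply (R := ℝ) _ hy,
    Trivialization.symmL_continuousLinearMapAt _ hy]

/-- Cramer's rule: two independent smooth forms with smooth values on a field determine its frame
coefficients as smooth functions. -/
theorem SmoothVecAt.of_pairing {a b : ℝ → ∀ x : X, TangentSpace IX x →L[ℝ] ℝ}
    {f g : ℝ × X → ℝ} {Z : ℝ → ∀ x : X, TangentSpace IX x} {p : ℝ × X}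
    (ha : SmoothFormAt a p) (hb : SmoothFormAt b p) (hf : ContMDiffAt JX 𝓘(ℝ, ℝ) ∞ f p)
    (hg : ContMDiffAt JX 𝓘(ℝ, ℝ) ∞ g p)
    (h : ∀ᶠ m in 𝓝 p, a m.1 m.2 (Z m.1 m.2) = f m ∧ b m.1 m.2 (Z m.1 m.2) = g m)
    {v w : TangentSpace IX p.2} (hne : a p.1 p.2 v * b p.1 p.2 w - a p.1 p.2 w * b p.1 p.2 v ≠ 0) :
    SmoothVecAt Z p := by
  let A : Fin 2 → ℝ × X → ℝ := fun i m ↦ a m.1 m.2 (locFrame p.2 i m.2)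
  let B : Fin 2 → ℝ × X → ℝ := fun i m ↦ b m.1 m.2 (locFrame p.2 i m.2)
  have hA : ∀ i, ContMDiffAt JX 𝓘(ℝ, ℝ) ∞ (A i) p := fun i ↦
    ha.apply (smoothVecAt_locFrame p.1 p.2 i)
  have hB : ∀ i, ContMDiffAt JX 𝓘(ℝ, ℝ) ∞ (B i) p := fun i ↦
    hb.apply (smoothVecAt_locFrame p.1 p.2 i)
  let D : ℝ × X → ℝ := fun m ↦ A 0 m * B 1 m - A 1 m * B 0 m
  have hD : ContMDiffAt JX 𝓘(ℝ, ℝ) ∞ D p := ((hA 0).mul (hB 1)).sub ((hA 1).mul (hB 0))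
  have hD0 : D p ≠ 0 := by
    intro h0
    apply hne
    obtain ⟨c, d, rfl⟩ := exists_locFrame_coeff (FiberBundle.mem_baseSet_trivializationAt' p.2) v
    obtain ⟨c', d', rfl⟩ := exists_locFrame_coeff (FiberBundle.mem_baseSet_trivializationAt' p.2) w
    simp only [map_add, map_smul, smul_eq_mul]
    simp only [D, A, B] at h0
    linear_combination (c * d' - d * c') * h0
  have hDi : ContMDiffAt JX 𝓘(ℝ, ℝ) ∞ (fun m ↦ (D m)⁻¹) p := hD.inv₀ hD0
  refine SmoothVecAt.of_coeff
    (f := ![fun m ↦ (f m * B 1 m - g m * A 1 m) * (D m)⁻¹,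
      fun m ↦ (A 0 m * g m - B 0 m * f m) * (D m)⁻¹]) (fun i ↦ ?_) ?_
  · fin_cases i
    · exact ((hf.mul (hB 1)).sub (hg.mul (hA 1))).mul hDi
    · exact (((hA 0).mul hg).sub ((hB 0).mul hf)).mul hDi
  · have hbs := mem_trivializationAt_baseSet p.2
    filter_upwards [h, (continuousAt_snd (p := p)).eventually hbs,
      hD.continuousAt.eventually_ne hD0] with m hm hs hD1
    obtain ⟨c, d, hcd⟩ := exists_locFrame_coeff hs (Z m.1 m.2)
    obtain ⟨h1, h2⟩ := hm
    have e1 : c * A 0 m + d * A 1 m = f m := by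
      rw [← h1, hcd, map_add, map_smul, map_smul]; rfl
    have e2 : c * B 0 m + d * B 1 m = g m := by
      rw [← h2, hcd, map_add, map_smul, map_smul]; rfl
    have e3 : c = (f m * B 1 m - g m * A 1 m) * (D m)⁻¹ := by
      field_simp
      rw [← e1, ← e2]
      simp only [D]; ring
    have e4 : d = (A 0 m * g m - B 0 m * f m) * (D m)⁻¹ := by
      field_simp
      rw [← e1, ← e2]
      simp only [D]; ring
    rw [hcd]
    exact congrArg₂ (fun s t : ℝ ↦ s • locFrame p.2 0 m.2 + t • locFrame p.2 1 m.2) e3 e4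

theorem IsSmoothMetric.apply {q : ℝ → SurfaceMetric X} (hq : IsSmoothMetric q)
    {Z W : ℝ → ∀ x : X, TangentSpace IX x} {p : ℝ × X} (hZ : SmoothVecAt Z p)
    (hW : SmoothVecAt W p) :
    ContMDiffAt JX 𝓘(ℝ, ℝ) ∞ (fun m ↦ (q m.1).inner m.2 (Z m.1 m.2) (W m.1 m.2)) p := by
  have h0 : ContMDiffAt JX (IX.prod 𝓘(ℝ, E2 →L[ℝ] ℝ)) ∞
      (fun m : ℝ × X ↦ TotalSpace.mk' (E2 →L[ℝ] ℝ)
        (E := fun y : X ↦ TangentSpace IX y →L[ℝ] Bundle.Trivial X ℝ y) m.2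
          ((q m.1).inner m.2 (Z m.1 m.2))) p :=
    ContMDiffAt.clm_bundle_apply (F₁ := E2) (F₂ := E2 →L[ℝ] ℝ) (E₁ := fun y : X ↦ TangentSpace IX y)
      (E₂ := fun y : X ↦ TangentSpace IX y →L[ℝ] Bundle.Trivial X ℝ y)
      (b := fun m : ℝ × X ↦ m.2) hq.contMDiffAt hZ
  exact SmoothFormAt.apply (θ := fun t x ↦ (q t).inner x (Z t x)) h0 hW

theorem IsSmoothMetric.flat {q : ℝ → SurfaceMetric X} (hq : IsSmoothMetric q)
    {Z : ℝ → ∀ x : X, TangentSpace IX x} {p : ℝ × X} (hZ : SmoothVecAt Z p) :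
    SmoothFormAt (fun t x ↦ (q t).inner x (Z t x)) p :=
  SmoothFormAt.of_locFrame fun i ↦ hq.apply hZ (smoothVecAt_locFrame p.1 p.2 i)

/-- The flats of the two local frame fields are independent at the point, and their values on `θ♯`
are `θ(e_i)`; `SmoothVecAt.of_pairing` then applies. -/
theorem IsSmoothMetric.sharp {q : ℝ → SurfaceMetric X} (hq : IsSmoothMetric q)
    {θ : ℝ → ∀ x : X, TangentSpace IX x →L[ℝ] ℝ} {p : ℝ × X} (hθ : SmoothFormAt θ p) :
    SmoothVecAt (fun t x ↦ sharp (q t) x (θ t x)) p := by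
  have hF := smoothVecAt_locFrame p.1 p.2
  obtain ⟨e₁, e₂, h1, h2, h3, h4, h5⟩ := exists_dual_pair (finrank_tangentSpace p.2)
    (l := ((q p.1).inner p.2 (locFrame p.2 0 p.2)).toLinearMap)
    (n := ((q p.1).inner p.2 (locFrame p.2 1 p.2)).toLinearMap) (fun v hl hn ↦ by
      have hl' : (q p.1).inner p.2 (locFrame p.2 0 p.2) v = 0 := hl
      have hn' : (q p.1).inner p.2 (locFrame p.2 1 p.2) v = 0 := hn
      obtain ⟨c, d, hcd⟩ := exists_locFrame_coeff (FiberBundle.mem_baseSet_trivializationAt' p.2) v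
      apply inner_self_eq_zero' (q p.1)
      nth_rewrite 1 [hcd]
      simp only [map_add, map_smul, _root_.add_apply, _root_.smul_apply, hl', hn']
      simp)
  simp only [ContinuousLinearMap.coe_coe] at h1 h2 h3 h4
  refine SmoothVecAt.of_pairing (hq.flat (hF 0)) (hq.flat (hF 1)) (hθ.apply (hF 0))
    (hθ.apply (hF 1)) (Eventually.of_forall fun m ↦ ?_) (v := e₁) (w := e₂) ?_
  · constructor <;> rw [(q m.1).symm, sharp_spec]
  · simp [h1, h2, h3, h4]

/-- `IsKundtData` does not ask for smoothness of `q` in the parameter; the Brinkmann form does, and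
it is recovered here from the coframe. -/
theorem isSmoothMetric_of_coframe {q : ℝ → SurfaceMetric X}
    {l n : ℝ → ∀ x : X, TangentSpace IX x →L[ℝ] ℝ} (hl : ∀ p, SmoothFormAt l p)
    (hn : ∀ p, SmoothFormAt n p) (h : ∀ t x, IsOrthoCoframe (q t) x (l t x) (n t x)) :
    IsSmoothMetric q := by
  intro p
  refine contMDiffAt_hom_of_frame (E₁ := fun y : X ↦ TangentSpace IX y)
    (E₂ := fun y : X ↦ TangentSpace IX y →L[ℝ] Bundle.Trivial X ℝ y)
    (EuclideanSpace.basisFun (Fin 2) ℝ).toBasis (f := fun m : ℝ × X ↦ m.2) (φ := fun m ↦ (q m.1).inner m.2) contMDiffAt_snd fun i ↦ ?_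
  have hF := smoothVecAt_locFrame p.1 p.2
  have h1 : SmoothFormAt (fun t x ↦ (q t).inner x (locFrame p.2 i x)) p := by
    refine SmoothFormAt.of_locFrame fun j ↦ ?_
    refine (((hl p).apply (hF i)).mul ((hl p).apply (hF j))).add
      (((hn p).apply (hF i)).mul ((hn p).apply (hF j))) |>.congr_of_eventuallyEq ?_
    exact Eventually.of_forall fun m ↦ h _ _ _ _
  have h2 : ((EuclideanSpace.basisFun (Fin 2) ℝ).toBasis i : E2) = EuclideanSpace.single i 1 := by
    simp
  rw [h2]
  exact h1

/-- The kernel of `l` is a line orthogonal to the unit vector `l♯`. The form dual to a unit vector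
of this line completes `l`. -/
theorem exists_isOrthoCoframe {q : SurfaceMetric X} {x : X} {l : TangentSpace IX x →L[ℝ] ℝ}
    (hl : l (sharp q x l) = 1) : ∃ n, IsOrthoCoframe q x l n := by
  set e := sharp q x l with he
  have : FiniteDimensional ℝ (TangentSpace IX x) := 
    Module.finite_of_finrank_pos (by rw [finrank_tangentSpace]; norm_num)
  have hsurj : LinearMap.range l.toLinearMap = ⊤ := LinearMap.range_eq_top.2 fun c ↦ ⟨c • e, by
    have : l (c • e) = c := by rw [map_smul, hl, smul_eq_mul, mul_one]
    exact this⟩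
  have hk := LinearMap.finrank_range_add_finrank_ker l.toLinearMap
  rw [hsurj, finrank_top, Module.finrank_self, finrank_tangentSpace] at hk
  obtain ⟨w, hw0, hw⟩ := finrank_eq_one_iff'.1 (show Module.finrank ℝ (LinearMap.ker l.toLinearMap) = 1
    by omega)
  have hlw : l w.1 = 0 := w.2
  have hpos : 0 < q.inner x w.1 w.1 := q.pos x _ fun h ↦ hw0 (Subtype.ext h)
  have hexp : ∀ v, ∃ c : ℝ, v = l v • e + c • w.1 := by
    intro v
    have hz : l (v - l v • e) = 0 := by
      rw [map_sub, map_smul, hl, smul_eq_mul, mul_one, sub_self]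
    obtain ⟨c, hc⟩ := hw ⟨v - l v • e, hz⟩
    refine ⟨c, ?_⟩
    have := congrArg Subtype.val hc
    have hc' : c • w.1 = v - l v • e := this
    rw [hc']; abel
  refine ⟨(√(q.inner x w.1 w.1))⁻¹ • q.inner x w.1, fun v v' ↦ ?_⟩
  obtain ⟨c, hc⟩ := hexp v
  obtain ⟨c', hc'⟩ := hexp v'
  have e1 : q.inner x e w.1 = 0 := by rw [he, sharp_spec, hlw]
  have e2 : q.inner x e e = 1 := by nth_rewrite 1 [he]; rw [sharp_spec, hl]
  have e3 : q.inner x w.1 e = 0 := by rw [q.symm, e1]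
  have e4 : q.inner x v v' = l v * l v' + c * c' * q.inner x w.1 w.1 := by
    rw [show q.inner x v v' = q.inner x (l v • e + c • w.1) (l v' • e + c' • w.1) from
      congrArg₂ (fun a b ↦ q.inner x a b) hc hc']
    simp only [map_add, map_smul, _root_.add_apply, _root_.smul_apply, smul_eq_mul, e1, e2, e3]
    ring
  have e5 : ∀ (v : TangentSpace IX x) (c : ℝ), v = l v • e + c • w.1 →
      q.inner x w.1 v = c * q.inner x w.1 w.1 := fun v c h ↦ by
    rw [show q.inner x w.1 v = q.inner x w.1 (l v • e + c • w.1) from congrArg _ h]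
    simp only [map_add, map_smul, smul_eq_mul, e3]
    ring
  rw [e4, _root_.smul_apply, _root_.smul_apply, e5 v c hc, e5 v' c' hc', smul_eq_mul, smul_eq_mul]
  have hs := Real.sq_sqrt hpos.le
  have hs0 : √(q.inner x w.1 w.1) ≠ 0 := (Real.sqrt_pos.2 hpos).ne'
  field_simp
  rw [hs]
  ring

theorem smoothFormAt_orient (o : SurfaceOrientation X) {Z : ℝ → ∀ x : X, TangentSpace IX x}
    {p : ℝ × X} (hZ : SmoothVecAt Z p) : SmoothFormAt (fun t x ↦ o.form x (Z t x)) p := by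
  have ho : ContMDiffAt JX (IX.prod 𝓘(ℝ, E2 →L[ℝ] E2 →L[ℝ] ℝ)) ∞
      (fun m : ℝ × X ↦ TotalSpace.mk' (E2 →L[ℝ] E2 →L[ℝ] ℝ)
        (E := fun y : X ↦ TangentSpace IX y →L[ℝ] TangentSpace IX y →L[ℝ] Bundle.Trivial X ℝ y) m.2
          (o.form m.2)) p :=
    ContMDiffAt.comp p (g := fun x : X ↦ TotalSpace.mk' (E2 →L[ℝ] E2 →L[ℝ] ℝ)
        (E := fun y : X ↦ TangentSpace IX y →L[ℝ] TangentSpace IX y →L[ℝ] Bundle.Trivial X ℝ y) x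
          (o.form x)) (f := Prod.snd) o.smooth.contMDiffAt contMDiffAt_snd
  exact ContMDiffAt.clm_bundle_apply (F₁ := E2) (F₂ := E2 →L[ℝ] ℝ)
      (E₁ := fun y : X ↦ TangentSpace IX y)
      (E₂ := fun y : X ↦ TangentSpace IX y →L[ℝ] Bundle.Trivial X ℝ y)
      (b := fun m : ℝ × X ↦ m.2) ho hZ

/-- A smooth family of unit one-forms on an oriented surface is part of a smooth orthonormal
coframe. -/
theorem exists_smooth_coframe (o : SurfaceOrientation X) {q : ℝ → SurfaceMetric X}
    (hq : IsSmoothMetric q) {l : ℝ → ∀ x : X, TangentSpace IX x →L[ℝ] ℝ}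
    (hl : ∀ p, SmoothFormAt l p) (hu : ∀ t x, l t x (sharp (q t) x (l t x)) = 1) :
    ∃ n : ℝ → ∀ x : X, TangentSpace IX x →L[ℝ] ℝ, (∀ p, SmoothFormAt n p) ∧
      ∀ t x, IsOrthoCoframe (q t) x (l t x) (n t x) := by
  -- The pointwise completion `n₀` is unique only up to sign. Contracting the orienting form with
  -- `l♯` gives a smooth nonzero multiple `c n₀` of it, of squared length `c²`, and normalizing
  -- selects a smooth sign.
  let m : ℝ → ∀ x : X, TangentSpace IX x →L[ℝ] ℝ := fun t x ↦ o.form x (sharp (q t) x (l t x))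
  have hm : ∀ p, SmoothFormAt m p := fun p ↦ smoothFormAt_orient o (hq.sharp (hl p))
  have key : ∀ t x, ∃ (n₀ : TangentSpace IX x →L[ℝ] ℝ) (c : ℝ), c ≠ 0 ∧
      IsOrthoCoframe (q t) x (l t x) n₀ ∧ m t x = c • n₀ := by
    intro t x
    obtain ⟨n₀, hn₀⟩ := exists_isOrthoCoframe (hu t x)
    refine ⟨n₀, _, hn₀.orient_ne_zero o, hn₀, ?_⟩
    obtain ⟨h1, h2, h3, h4, h5⟩ := hn₀.exists_dual
    ext w
    simp only [m]
    rw [hn₀.orient_eq o, h1, h2, _root_.smul_apply, smul_eq_mul]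
    ring
  have hnorm : ∀ t x (n₀ : TangentSpace IX x →L[ℝ] ℝ) (c : ℝ),
      IsOrthoCoframe (q t) x (l t x) n₀ → m t x = c • n₀ →
      m t x (sharp (q t) x (m t x)) = c ^ 2 := by
    intro t x n₀ c h1 h2
    obtain ⟨a1, a2, a3, a4, a5⟩ := h1.exists_dual
    rw [h1.sharp_eq, h2]
    simp only [map_add, map_smul, _root_.smul_apply, smul_eq_mul, a2, a4]
    ring
  refine ⟨fun t x ↦ (√(m t x (sharp (q t) x (m t x))))⁻¹ • m t x, fun p ↦ ?_, fun t x v w ↦ ?_⟩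
  · obtain ⟨n₀, c, hc, h1, h2⟩ := key p.1 p.2
    have hpos : m p.1 p.2 (sharp (q p.1) p.2 (m p.1 p.2)) ≠ 0 := by
      rw [hnorm _ _ _ _ h1 h2]; positivity
    have hs : ContMDiffAt JX 𝓘(ℝ, ℝ) ∞
        (fun r : ℝ × X ↦ √(m r.1 r.2 (sharp (q r.1) r.2 (m r.1 r.2)))) p :=
      (Real.contDiffAt_sqrt hpos).contMDiffAt.comp p ((hm p).apply (hq.sharp (hm p)))
    refine SmoothFormAt.smul (hs.inv₀ ?_) (hm p)
    rw [hnorm _ _ _ _ h1 h2, Real.sqrt_sq_eq_abs]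
    exact abs_ne_zero.2 hc
  · obtain ⟨n₀, c, hc, h1, h2⟩ := key t x
    simp only
    rw [hnorm _ _ _ _ h1 h2, h2, h1 v w, Real.sqrt_sq_eq_abs]
    simp only [_root_.smul_apply, smul_eq_mul]
    have h3 : |c| ≠ 0 := abs_ne_zero.2 hc
    have h4 : |c| ^ 2 = c ^ 2 := sq_abs c
    field_simp
    rw [h4]
    ring

/-! ### The coframe of a Kundt configuration -/

/-- A family of one-forms at a point of `X`, as a curve in the dual of the model space. -/
def formCurve (θ : ℝ → ∀ x : X, TangentSpace IX x →L[ℝ] ℝ) (x : X) (τ : ℝ) : E2 →L[ℝ] ℝ := θ τ x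

theorem partialU_eq_deriv (θ : ℝ → ∀ x : X, TangentSpace IX x →L[ℝ] ℝ) (t : ℝ) (x : X) :
    partialU θ t x = deriv (formCurve θ x) t := rfl

/-- A smooth family of one-forms is differentiable in the parameter. -/
theorem SmoothFormAt.hasDerivAt {θ : ℝ → ∀ x : X, TangentSpace IX x →L[ℝ] ℝ} {t : ℝ} {x : X}
    (hθ : SmoothFormAt θ (t, x)) :
    HasDerivAt (formCurve θ x) (deriv (formCurve θ x) t) t := by
  let f : Fin 2 → ℝ → ℝ := fun i τ ↦ θ τ x (locFrame x i x)
  have hd : ∀ i, DifferentiableAt ℝ (f i) t := fun i ↦ by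
    have h1 : ContMDiffAt 𝓘(ℝ, ℝ) 𝓘(ℝ, ℝ) ∞ (f i) t :=
      (hθ.apply (smoothVecAt_locFrame t x i)).comp t (contMDiffAt_id.prodMk contMDiffAt_const)
    exact h1.contDiffAt.differentiableAt (by simp)
  let c : Fin 2 → (E2 →L[ℝ] ℝ) := fun i ↦ mvfderiv IX (coordFun x i) x
  have e : formCurve θ x = fun τ ↦ f 0 τ • c 0 + f 1 τ • c 1 := by
    funext τ
    exact form_eq_sum_coordFun (mem_chart_source E2 x) (θ τ x)
  have e2 : DifferentiableAt ℝ (fun τ ↦ f 0 τ • c 0 + f 1 τ • c 1) t :=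
    ((hd 0).smul_const (c 0)).add ((hd 1).smul_const (c 1))
  rw [← e] at e2
  exact e2.hasDerivAt

/-- The one-form `d_X F / (2 lam)`. -/
def lForm (lam : ℝ) (F : ℝ → X → ℝ) (t : ℝ) (x : X) : TangentSpace IX x →L[ℝ] ℝ :=
  (1 / (2 * lam)) • dX F t x

theorem smoothFormAt_lForm (lam : ℝ) {F : ℝ → X → ℝ} (hF : IsSmoothFun F) (p : ℝ × X) :
    SmoothFormAt (lForm lam F) p :=
  SmoothFormAt.smul (f := fun _ _ ↦ 1 / (2 * lam)) contMDiffAt_const (smoothFormAt_dX hF p)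

theorem dX_eq_lForm {lam : ℝ} (hlam : lam ≠ 0) (F : ℝ → X → ℝ) (t : ℝ) (x : X) :
    dX F t x = (2 * lam) • lForm lam F t x := by
  rw [lForm, smul_smul, mul_one_div, div_self (by positivity), one_smul]

theorem partialU_dX {lam : ℝ} (hlam : lam ≠ 0) {F : ℝ → X → ℝ} (hF : IsSmoothFun F) (t : ℝ) (x : X) :
    partialU (dX F) t x = (2 * lam) • partialU (lForm lam F) t x := by
  have h := (smoothFormAt_lForm lam hF (t, x)).hasDerivAt.const_smul (2 * lam)
  have e : formCurve (dX F) x = fun τ ↦ (2 * lam) • formCurve (lForm lam F) x τ := by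
    funext τ
    exact dX_eq_lForm hlam F τ x
  rw [partialU_eq_deriv, e]
  exact h.deriv

theorem SmoothFormAt.continuousAt_apply {θ : ℝ → ∀ x : X, TangentSpace IX x →L[ℝ] ℝ} {t : ℝ} {x : X}
    (hθ : SmoothFormAt θ (t, x)) (v : TangentSpace IX x) : ContinuousAt (fun τ ↦ θ τ x v) t :=
  ContinuousAt.clm_apply (f := formCurve θ x) (g := fun _ ↦ (v : E2)) hθ.hasDerivAt.continuousAt
    continuousAt_const

/-- The sign is that of a continuous function of the parameter with nonzero value at `t`. It can
thus be treated as a constant when the Hodge star is differentiated. -/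
theorem frameSign_eventually_eq (o : SurfaceOrientation X)
    {l n : ℝ → ∀ x : X, TangentSpace IX x →L[ℝ] ℝ} {t : ℝ} {x : X} {q : SurfaceMetric X}
    (hl : SmoothFormAt l (t, x)) (hn : SmoothFormAt n (t, x))
    (h : IsOrthoCoframe q x (l t x) (n t x)) :
    ∀ᶠ τ in 𝓝 t, frameSign o (l τ x) (n τ x) = frameSign o (l t x) (n t x) := by
  have hc : ContinuousAt (fun τ ↦ o.form x (tangentBasis x 0) (tangentBasis x 1) *
    (l τ x (tangentBasis x 0) * n τ x (tangentBasis x 1)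
      - l τ x (tangentBasis x 1) * n τ x (tangentBasis x 0))) t :=
    continuousAt_const.mul (((hl.continuousAt_apply _).mul (hn.continuousAt_apply _)).sub
      ((hl.continuousAt_apply _).mul (hn.continuousAt_apply _)))
  have hne : o.form x (tangentBasis x 0) (tangentBasis x 1) *
    (l t x (tangentBasis x 0) * n t x (tangentBasis x 1)
      - l t x (tangentBasis x 1) * n t x (tangentBasis x 0)) ≠ 0 := by
    rw [h.orient_eq o]
    exact mul_ne_zero (mul_ne_zero (h.orient_ne_zero o) h.wedge_ne_zero) h.wedge_ne_zero
  rcases lt_or_gt_of_ne hne with h0 | h0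
  · filter_upwards [hc.eventually (gt_mem_nhds h0)] with τ hτ
    unfold frameSign
    rw [sign_neg h0, sign_neg hτ]
  · filter_upwards [hc.eventually (lt_mem_nhds h0)] with τ hτ
    unfold frameSign
    rw [sign_pos h0, sign_pos hτ]

/-- The source term of `d_X β` in an orthonormal coframe. -/
theorem kundt_source_eq (o : SurfaceOrientation X) {lam : ℝ} (hlam : lam ≠ 0) {F : ℝ → X → ℝ}
    (hF : IsSmoothFun F) {q : ℝ → SurfaceMetric X} {n : ℝ → ∀ x : X, TangentSpace IX x →L[ℝ] ℝ}
    (hn : ∀ p, SmoothFormAt n p)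
    (h : ∀ t x, IsOrthoCoframe (q t) x (lForm lam F t x) (n t x)) (t : ℝ) (x : X)
    (v w : TangentSpace IX x) :
    ((Real.exp (-F t x) / (4 * lam ^ 2) *
      coInner (q t) x
        (partialU (fun τ y ↦ hodgeStar o (q τ) y (dX F τ y)) t x
          + hodgeStar o (q t) x (partialU (dX F) t x))
        (dX F t x)) • volumeForm o (q t) x) v w =
    Real.exp (-F t x) * (partialU n t x (sharp (q t) x (lForm lam F t x))
        - partialU (lForm lam F) t x (sharp (q t) x (n t x)))
      * (lForm lam F t x v * n t x w - lForm lam F t x w * n t x v) := by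
  set l := lForm lam F with hl
  obtain ⟨h1, h2, h3, h4, h5⟩ := (h t x).exists_dual
  have hstar : ∀ τ, hodgeStar o (q τ) x (dX F τ x) =
      (frameSign o (l τ x) (n τ x) * (2 * lam)) • n τ x := by
    intro τ
    obtain ⟨a1, a2, a3, a4, a5⟩ := (h τ x).exists_dual
    rw [(h τ x).hodgeStar_eq o, dX_eq_lForm hlam]
    simp only [_root_.smul_apply, smul_eq_mul, ← hl, a1, a3]
    simp
  have hsign := frameSign_eventually_eq o (smoothFormAt_lForm lam hF (t, x)) (hn (t, x)) (h t x)
  set s := frameSign o (l t x) (n t x) with hs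
  have hpU : partialU (fun τ y ↦ hodgeStar o (q τ) y (dX F τ y)) t x
      = (s * (2 * lam)) • partialU n t x := by
    have e : formCurve (fun τ y ↦ hodgeStar o (q τ) y (dX F τ y)) x =ᶠ[𝓝 t]
        fun τ ↦ (s * (2 * lam)) • formCurve n x τ := by
      filter_upwards [hsign] with τ hτ
      have e' := hstar τ
      rw [hτ] at e'
      exact e'
    have := ((hn (t, x)).hasDerivAt.const_smul (s * (2 * lam))).congr_of_eventuallyEq e
    exact this.deriv
  -- One sign comes from the Hodge stars and one from the volume form; their product is `1`, so the
  -- source term does not depend on the orientation.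
  have hss : s * s = 1 := (h t x).frameSign_sq o
  have hco : coInner (q t) x
        (partialU (fun τ y ↦ hodgeStar o (q τ) y (dX F τ y)) t x
          + hodgeStar o (q t) x (partialU (dX F) t x)) (dX F t x)
      = 4 * lam ^ 2 * s * (partialU n t x (sharp (q t) x (l t x))
        - partialU l t x (sharp (q t) x (n t x))) := by
    rw [coInner, (h t x).sharp_eq (dX F t x), hpU, (h t x).hodgeStar_eq o, partialU_dX hlam hF,
      dX_eq_lForm hlam, ← hl, ← hs]
    simp only [_root_.smul_apply, smul_eq_mul, h1, h2, h3, h4, map_add, map_smul, _root_.add_apply,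
      _root_.sub_apply]
    ring
  rw [_root_.smul_apply, _root_.smul_apply, (h t x).volumeForm_eq, hco, smul_eq_mul, ← hs]
  have hl2 : (4 * lam ^ 2) ≠ 0 := by positivity
  calc _ = (s * s) * (Real.exp (-F t x) * (4 * lam ^ 2 / (4 * lam ^ 2)) *
        (partialU n t x (sharp (q t) x (l t x)) - partialU l t x (sharp (q t) x (n t x)))
        * (l t x v * n t x w - l t x w * n t x v)) := by ring
    _ = _ := by rw [hss, div_self hl2]; ring

end Surface

/-! ### Connections given by connection forms in a global frame. -/

section Connection

variable {E : Type*} [NormedAddCommGroup E] [NormedSpace ℝ E]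
  {H : Type*} [TopologicalSpace H] {I : ModelWithCorners ℝ E H}
  {M : Type*} [TopologicalSpace M] [ChartedSpace H M] [IsManifold I ∞ M]

theorem mvfderiv_scalar_comp {g : ℝ → ℝ} {g' : ℝ} {f : M → ℝ} {x : M}
    (hg : HasDerivAt g g' (f x)) (hf : MDifferentiableAt I 𝓘(ℝ, ℝ) f x) (v : TangentSpace I x) :
    mvfderiv I (fun y ↦ g (f y)) x v = g' * mvfderiv I f x v := by
  have h := (hg.hasFDerivAt.hasMFDerivAt.comp x hf.hasMFDerivAt).mfderiv
  have h2 : mvfderiv I (fun y ↦ g (f y)) x v = mfderiv I 𝓘(ℝ, ℝ) (g ∘ f) x v := rfl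
  rw [h2, h, mul_comm]
  rfl

theorem mdifferentiableAt_sum_real {κ : Type*} {s : Finset κ} {f : κ → M → ℝ} {x : M}
    (h : ∀ i ∈ s, MDifferentiableAt I 𝓘(ℝ, ℝ) (f i) x) :
    MDifferentiableAt I 𝓘(ℝ, ℝ) (fun y ↦ ∑ i ∈ s, f i y) x := by
  classical
  induction s using Finset.induction_on with
  | empty => simpa using mdifferentiableAt_const
  | insert a s ha ih =>
    simp only [Finset.sum_insert ha]
    exact (h a (by simp)).add (ih fun i hi ↦ h i (by simp [hi]))

theorem mvfderiv_sum_apply {κ : Type*} {s : Finset κ} {f : κ → M → ℝ} {x : M}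
    (h : ∀ i ∈ s, MDifferentiableAt I 𝓘(ℝ, ℝ) (f i) x) (v : TangentSpace I x) :
    mvfderiv I (fun y ↦ ∑ i ∈ s, f i y) x v = ∑ i ∈ s, mvfderiv I (f i) x v := by
  classical
  induction s using Finset.induction_on with
  | empty => simp [mvfderiv_const]
  | insert a s ha ih =>
    simp only [Finset.sum_insert ha]
    have hs : ∀ i ∈ s, MDifferentiableAt I 𝓘(ℝ, ℝ) (f i) x := fun i hi ↦ h i (by simp [hi])
    rw [mvfderiv_fun_add (h a (by simp)) (mdifferentiableAt_sum_real hs), _root_.add_apply, ih hs]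

variable (I M) in
/-- A global frame `e` of the tangent bundle with a differentiable dual coframe `ε`. -/
structure GlobalFrame (ι : Type*) [Fintype ι] where
  e : ι → ∀ x : M, TangentSpace I x
  ε : ι → ∀ x : M, TangentSpace I x →L[ℝ] ℝ
  expand : ∀ x (v : TangentSpace I x), v = ∑ i, ε i x v • e i x
  indep : ∀ x (a b : ι → ℝ), ∑ i, a i • e i x = ∑ i, b i • e i x → a = b
  diff : ∀ i x, FormDiffAt I (ε i) x

namespace GlobalFrame

variable {ι : Type*} [Fintype ι] (C : GlobalFrame I M ι)

theorem coeff_sum (x : M) (a : ι → ℝ) (i : ι) : C.ε i x (∑ j, a j • C.e j x) = a i :=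
  congrFun (C.indep x (fun i ↦ C.ε i x (∑ j, a j • C.e j x)) a (C.expand x _).symm) i

theorem ext {x : M} {v w : TangentSpace I x} (h : ∀ i, C.ε i x v = C.ε i x w) : v = w := by
  rw [C.expand x v, C.expand x w]
  exact Finset.sum_congr rfl fun i _ ↦ by rw [h]

/-- The covariant derivative with connection forms `Γ` in the global frame. -/
def covFun (Γ : ι → ι → ∀ x : M, TangentSpace I x →L[ℝ] ℝ) (V : ∀ x : M, TangentSpace I x) (x : M) :
    TangentSpace I x →L[ℝ] TangentSpace I x :=
  ∑ i, (mvfderiv I (fun y ↦ C.ε i y (V y)) x + ∑ j, C.ε j x (V x) • Γ i j x).smulRight (C.e i x)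

theorem ε_covFun (Γ : ι → ι → ∀ x : M, TangentSpace I x →L[ℝ] ℝ) (V : ∀ x : M, TangentSpace I x)
    (x : M) (v : TangentSpace I x) (i : ι) :
    C.ε i x (C.covFun Γ V x v) =
      mvfderiv I (fun y ↦ C.ε i y (V y)) x v + ∑ j, Γ i j x v * C.ε j x (V x) := by
  have : C.covFun Γ V x v = ∑ i, (mvfderiv I (fun y ↦ C.ε i y (V y)) x v
      + ∑ j, Γ i j x v * C.ε j x (V x)) • C.e i x := by
    simp only [covFun, _root_.sum_apply, ContinuousLinearMap.smulRight_apply, _root_.add_apply,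
      _root_.smul_apply, smul_eq_mul, mul_comm]
  rw [this, coeff_sum]

/-- The covariant derivative with connection forms `Γ` in the global frame. -/
def cov (Γ : ι → ι → ∀ x : M, TangentSpace I x →L[ℝ] ℝ) :
    CovariantDerivative I E (TangentSpace I : M → Type _) where
  toFun := C.covFun Γ
  isCovariantDerivativeOnUniv := by
    constructor
    · intro V W x hV hW _
      ext v
      refine C.ext fun i ↦ ?_
      have e1 : C.ε i x ((C.covFun Γ V x + C.covFun Γ W x) v) =
          C.ε i x (C.covFun Γ V x v) + C.ε i x (C.covFun Γ W x v) := by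
        rw [_root_.add_apply, map_add]
      rw [e1, ε_covFun, ε_covFun, ε_covFun]
      have e2 : (fun y ↦ C.ε i y ((V + W) y)) = fun y ↦ C.ε i y (V y) + C.ε i y (W y) := by
        funext y; rw [Pi.add_apply, map_add]
      rw [e2, mvfderiv_fun_add (C.diff i x V hV) (C.diff i x W hW)]
      simp only [Pi.add_apply, map_add, mul_add, Finset.sum_add_distrib, _root_.add_apply]
      ring
    · intro V f x hV hf _
      ext v
      refine C.ext fun i ↦ ?_
      have e1 : C.ε i x ((f x • C.covFun Γ V x + (mvfderiv I f x).smulRight (V x)) v) =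
          f x * C.ε i x (C.covFun Γ V x v) + mvfderiv I f x v * C.ε i x (V x) := by
        rw [_root_.add_apply, map_add, _root_.smul_apply, map_smul,
          ContinuousLinearMap.smulRight_apply, map_smul, smul_eq_mul, smul_eq_mul]
      refine Eq.trans ?_ e1.symm
      rw [ε_covFun, ε_covFun]
      have e2 : (fun y ↦ C.ε i y ((f • V) y)) = fun y ↦ f y * C.ε i y (V y) := by
        funext y; rw [Pi.smul_apply', map_smul, smul_eq_mul]
      rw [e2, mvfderiv_fun_mul hf (C.diff i x V hV)]
      simp only [Pi.smul_apply', map_smul, smul_eq_mul, _root_.add_apply, _root_.smul_apply]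
      rw [mul_add, Finset.mul_sum]
      have : ∑ j, Γ i j x v * (f x * C.ε j x (V x)) = ∑ j, f x * (Γ i j x v * C.ε j x (V x)) :=
        Finset.sum_congr rfl fun j _ ↦ by ring
      rw [this]
      ring

theorem ε_cov (Γ : ι → ι → ∀ x : M, TangentSpace I x →L[ℝ] ℝ) (V : ∀ x : M, TangentSpace I x)
    (x : M) (v : TangentSpace I x) (i : ι) :
    C.ε i x (C.cov Γ V x v) =
      mvfderiv I (fun y ↦ C.ε i y (V y)) x v + ∑ j, Γ i j x v * C.ε j x (V x) :=
  C.ε_covFun Γ V x v i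

/-- The first and second structure equations characterize the Levi-Civita connection. -/
theorem isLeviCivita_cov {Γ : ι → ι → ∀ x : M, TangentSpace I x →L[ℝ] ℝ}
    {g : ∀ x : M, TangentSpace I x →L[ℝ] TangentSpace I x →L[ℝ] ℝ} {η : ι → ι → ℝ}
    (hg : ∀ x v w, g x v w = ∑ i, ∑ j, η i j * (C.ε i x v * C.ε j x w))
    (hskew : ∀ x v (a b : ι → ℝ), ∑ i, ∑ j, η i j *
      ((∑ k, Γ i k x v * a k) * b j + a i * ∑ k, Γ j k x v * b k) = 0)
    (hd : ∀ i x, IsExtDerivAt I (C.ε i) x fun v w ↦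
      -(∑ j, Γ i j x v * C.ε j x w - ∑ j, Γ i j x w * C.ε j x v)) :
    IsLeviCivita I g (C.cov Γ) where
  torsion_free x V W hV hW := by
    refine C.ext fun i ↦ ?_
    have h := hd i x V W hV hW
    rw [map_sub, ε_cov, ε_cov]
    linarith
  metric x V W hV hW v := by
    have e1 : (fun y ↦ g y (V y) (W y)) =
        fun y ↦ ∑ i, ∑ j, η i j * (C.ε i y (V y) * C.ε j y (W y)) := by
      funext y; rw [hg]
    rw [hg, hg, e1]
    have e3 : mvfderiv I (fun y ↦ ∑ i, ∑ j, η i j * (C.ε i y (V y) * C.ε j y (W y))) x v =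
        ∑ i, ∑ j, η i j * (C.ε i x (V x) * mvfderiv I (fun y ↦ C.ε j y (W y)) x v
          + C.ε j x (W x) * mvfderiv I (fun y ↦ C.ε i y (V y)) x v) := by
      have hp : ∀ i j, MDifferentiableAt I 𝓘(ℝ, ℝ)
          (fun y ↦ η i j * (C.ε i y (V y) * C.ε j y (W y))) x := fun i j ↦
        mdifferentiableAt_const.mul ((C.diff i x V hV).mul (C.diff j x W hW))
      have hm : ∀ i j, mvfderiv I (fun y ↦ η i j * (C.ε i y (V y) * C.ε j y (W y))) x v =
          η i j * (C.ε i x (V x) * mvfderiv I (fun y ↦ C.ε j y (W y)) x v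
          + C.ε j x (W x) * mvfderiv I (fun y ↦ C.ε i y (V y)) x v) := fun i j ↦ by
        have hab : MDifferentiableAt I 𝓘(ℝ, ℝ) (fun y ↦ C.ε i y (V y) * C.ε j y (W y)) x :=
          (C.diff i x V hV).mul (C.diff j x W hW)
        rw [mvfderiv_fun_mul mdifferentiableAt_const hab,
          mvfderiv_fun_mul (C.diff i x V hV) (C.diff j x W hW), mvfderiv_const]
        simp only [_root_.add_apply, _root_.smul_apply, smul_eq_mul, _root_.zero_apply]
        ring
      rw [mvfderiv_sum_apply (fun i _ ↦ (mdifferentiableAt_sum_real fun j _ ↦ hp i j))]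
      refine Finset.sum_congr rfl fun i _ ↦ ?_
      rw [mvfderiv_sum_apply (fun j _ ↦ hp i j)]
      exact Finset.sum_congr rfl fun j _ ↦ hm i j
    -- The derivatives of the components cancel, and what remains is minus the expression that
    -- vanishes by skewness of `Γ`.
    rw [e3, ← sub_eq_zero, ← Finset.sum_add_distrib, ← Finset.sum_sub_distrib]
    have h0 := hskew x v (fun i ↦ C.ε i x (V x)) (fun i ↦ C.ε i x (W x))
    rw [← neg_eq_zero, ← h0, ← Finset.sum_neg_distrib]
    refine Finset.sum_congr rfl fun i _ ↦ ?_
    rw [← Finset.sum_add_distrib, ← Finset.sum_sub_distrib, ← Finset.sum_neg_distrib]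
    refine Finset.sum_congr rfl fun j _ ↦ ?_
    rw [ε_cov, ε_cov]
    ring

end GlobalFrame

end Connection

/-! ### Kundt data as structure equations of an orthonormal coframe. -/

section FrameData

variable {X : Type*} [TopologicalSpace X] [ChartedSpace E2 X] [IsManifold IX ∞ X]

theorem SmoothFormAt.formDiffAt {θ : ℝ → ∀ x : X, TangentSpace IX x →L[ℝ] ℝ} {t : ℝ} {x : X}
    (hθ : SmoothFormAt θ (t, x)) : FormDiffAt IX (θ t) x := by
  apply FormDiffAt.of_section
  have h : ContMDiffAt IX JX ∞ (fun y : X ↦ (t, y)) x := contMDiffAt_const.prodMk contMDiffAt_id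
  exact (ContMDiffAt.comp x hθ h).mdifferentiableAt (by simp)

theorem IsSmoothFun.slice {F : ℝ → X → ℝ} (hF : IsSmoothFun F) (t : ℝ) :
    ContMDiff IX 𝓘(ℝ, ℝ) ∞ (F t) :=
  ContMDiff.comp (I' := JX) (g := fun p : ℝ × X ↦ F p.1 p.2) hF
    (contMDiff_const.prodMk contMDiff_id)

theorem IsSmoothFun.exp_mul {F : ℝ → X → ℝ} (hF : IsSmoothFun F) (c : ℝ) :
    IsSmoothFun fun t x ↦ Real.exp (c * F t x) :=
  (Real.contDiff_exp.comp (contDiff_const.mul contDiff_id)).contMDiff.comp hF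

theorem isExtDerivAt_lForm (lam : ℝ) {F : ℝ → X → ℝ} (hF : IsSmoothFun F) (t : ℝ) (x : X) :
    IsExtDerivAt IX (lForm lam F t) x fun _ _ ↦ 0 := by
  have := isExtDerivAt_mvfderiv (I := IX) (((hF.slice t).of_le two_le_infty).contMDiffAt (x := x))
  refine (IsExtDerivAt.smul (f := fun _ ↦ 1 / (2 * lam)) mdifferentiableAt_const
    (formDiffAt_mvfderiv (((hF.slice t).of_le two_le_infty).contMDiffAt))
    this).congr_right fun v w ↦ ?_
  rw [mvfderiv_const]
  simp

/-- The structure equations of the coframe `(l, n)`, `l = d_X F / (2 lam)`, of a Kundt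
configuration. -/
structure IsFrameData (lam : ℝ) (F : ℝ → X → ℝ) (q : ℝ → SurfaceMetric X)
    (n β : ℝ → ∀ x : X, TangentSpace IX x →L[ℝ] ℝ) : Prop where
  smooth_F : IsSmoothFun F
  smooth_n : ∀ p, SmoothFormAt n p
  smooth_β : ∀ p, SmoothFormAt β p
  ortho : ∀ t x, IsOrthoCoframe (q t) x (lForm lam F t x) (n t x)
  d_n : ∀ t x, IsExtDerivAt IX (n t) x fun v w ↦
    lam * (lForm lam F t x v * n t x w - lForm lam F t x w * n t x v)
  d_β : ∀ t x, IsExtDerivAt IX (β t) x fun v w ↦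
    Real.exp (-F t x) * (partialU n t x (sharp (q t) x (lForm lam F t x))
        - partialU (lForm lam F) t x (sharp (q t) x (n t x)))
      * (lForm lam F t x v * n t x w - lForm lam F t x w * n t x v)

/-- The exponents `c = 1/2` and `c = -1/2` are the ones needed: since `d_X F = 2 lam l`, they
convert `d om = 0` into `dn = lam l ∧ n` and back. -/
theorem isExtDerivAt_exp_smul {F : ℝ → X → ℝ} (hF : IsSmoothFun F)
    {θ : ℝ → ∀ x : X, TangentSpace IX x →L[ℝ] ℝ} {t : ℝ} {x : X} (hθ : SmoothFormAt θ (t, x))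
    {η : TangentSpace IX x → TangentSpace IX x → ℝ} (h : IsExtDerivAt IX (θ t) x η) (c : ℝ) :
    IsExtDerivAt IX (fun y ↦ Real.exp (c * F t y) • θ t y) x fun v w ↦
      Real.exp (c * F t x) * (η v w + c * (dX F t x v * θ t x w - dX F t x w * θ t x v)) := by
  have h1 := IsExtDerivAt.smul (((hF.exp_mul c).slice t).mdifferentiableAt (by simp) (x := x))
    hθ.formDiffAt h
  refine h1.congr_right fun v w ↦ ?_
  have hd : HasDerivAt (fun r ↦ Real.exp (c * r)) (Real.exp (c * F t x) * c) (F t x) := by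
    have := ((hasDerivAt_id (F t x)).const_mul c).exp
    simpa using this
  rw [mvfderiv_scalar_comp hd ((hF.slice t).mdifferentiableAt (by simp)),
    mvfderiv_scalar_comp hd ((hF.slice t).mdifferentiableAt (by simp))]
  unfold dX
  ring

theorem IsKundtData.frameData {lam : ℝ} (hlam : lam ≠ 0) {o : SurfaceOrientation X}
    {g : LorentzMetric IM (ℝ × ℝ × X)} {H F : ℝ → X → ℝ} {q : ℝ → SurfaceMetric X}
    {om β : ℝ → ∀ x : X, TangentSpace IX x →L[ℝ] ℝ} (h : IsKundtData lam o g H F q om β) :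
    IsFrameData lam F q (fun t x ↦ Real.exp (1 / 2 * F t x) • om t x) β := by
  have hn : ∀ p, SmoothFormAt (fun t x ↦ Real.exp (1 / 2 * F t x) • om t x) p := fun p ↦
    SmoothFormAt.smul ((h.smooth_F.exp_mul (1 / 2)) p) (h.smooth_om p)
  have ho : ∀ t x, IsOrthoCoframe (q t) x (lForm lam F t x) (Real.exp (1 / 2 * F t x) • om t x) := by
    intro t x v w
    rw [h.metric_X]
    have e : Real.exp (F t x) = Real.exp (1 / 2 * F t x) * Real.exp (1 / 2 * F t x) := by
      rw [← Real.exp_add]; congr 1; ring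
    simp only [lForm, _root_.smul_apply, smul_eq_mul]
    rw [e]
    field_simp
    ring
  refine ⟨h.smooth_F, hn, h.smooth_β, ho, fun t x ↦ ?_, fun t x ↦ ?_⟩
  · refine (isExtDerivAt_exp_smul h.smooth_F (h.smooth_om (t, x))
      (isExtDeriv_iff.1 (h.closed_om t) x) (1 / 2)).congr_right fun v w ↦ ?_
    simp only [lForm, _root_.smul_apply, smul_eq_mul, Pi.zero_apply, _root_.zero_apply]
    field_simp
    ring
  · exact IsExtDerivAt.congr_right (isExtDeriv_iff.1 (h.d_β t) x)
      fun v w ↦ kundt_source_eq o hlam h.smooth_F hn ho t x v w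

/-- The rescaling `om = e^{-F/2} n` inverts the one in `IsKundtData.frameData`. -/
theorem IsFrameData.kundtData {lam : ℝ} (hlam : lam ≠ 0) (o : SurfaceOrientation X)
    {g : LorentzMetric IM (ℝ × ℝ × X)} {H F : ℝ → X → ℝ} {q : ℝ → SurfaceMetric X}
    {n β : ℝ → ∀ x : X, TangentSpace IX x →L[ℝ] ℝ} (h : IsFrameData lam F q n β)
    (hH : IsSmoothFun H) (hq : ∀ t, IsCompleteMetric (q t))
    (hg : ∀ (p : ℝ × ℝ × X) (a b : TangentSpace IM p),
      g.val p a b = H p.1 p.2.2 * (dxu p a * dxu p b)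
      + Real.exp (F p.1 p.2.2) *
        (dxu p a * (dxv p b + β p.1 p.2.2 (projX p b))
          + (dxv p a + β p.1 p.2.2 (projX p a)) * dxu p b)
      + (q p.1).inner p.2.2 (projX p a) (projX p b)) :
    IsKundtData lam o g H F q (fun t x ↦ Real.exp (-1 / 2 * F t x) • n t x) β := by
  have hm : ∀ (t : ℝ) (x : X) (v w : TangentSpace IX x),
      (q t).inner x v w = 1 / (4 * lam ^ 2) * (dX F t x v * dX F t x w) + Real.exp (F t x) *
        ((Real.exp (-1 / 2 * F t x) • n t x) v * (Real.exp (-1 / 2 * F t x) • n t x) w) := by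
    intro t x v w
    have e : Real.exp (F t x) * (Real.exp (-1 / 2 * F t x) * Real.exp (-1 / 2 * F t x)) = 1 := by
      rw [← Real.exp_add, ← Real.exp_add]
      ring_nf
      exact Real.exp_zero
    rw [h.ortho]
    simp only [lForm, _root_.smul_apply, smul_eq_mul]
    calc _ = 1 / (4 * lam ^ 2) * (dX F t x v * dX F t x w) + 1 * (n t x v * n t x w) := by
          field_simp; ring
      _ = 1 / (4 * lam ^ 2) * (dX F t x v * dX F t x w) +
          (Real.exp (F t x) * (Real.exp (-1 / 2 * F t x) * Real.exp (-1 / 2 * F t x)))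
            * (n t x v * n t x w) := by rw [e]
      _ = _ := by ring
  refine ⟨hH, h.smooth_F, fun p ↦ SmoothFormAt.smul
    (f := fun t x ↦ Real.exp (-1 / 2 * F t x)) ((h.smooth_F.exp_mul (-1 / 2)) p) (h.smooth_n p),
    h.smooth_β, hq, hm, fun t ↦ isExtDeriv_iff.2 fun x ↦ ?_, fun t ↦ isExtDeriv_iff.2 fun x ↦ ?_,
    fun p a b ↦ ?_⟩
  · refine (isExtDerivAt_exp_smul h.smooth_F (h.smooth_n (t, x)) (h.d_n t x)
      (-1 / 2)).congr_right fun v w ↦ ?_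
    simp only [lForm, _root_.smul_apply, smul_eq_mul, Pi.zero_apply, _root_.zero_apply]
    field_simp
    ring
  · exact IsExtDerivAt.congr_right (h.d_β t x)
      fun v w ↦ (kundt_source_eq o hlam h.smooth_F h.smooth_n h.ortho t x v w).symm
  · rw [hg, hm]
    ring

end FrameData

/-! ### The Poincaré lemma on a surface. -/

section Primitive

variable {X : Type*} [TopologicalSpace X] [ChartedSpace E2 X] [IsManifold IX ∞ X]

theorem extChartAt_target_mem_nhds_of_mem {x₀ : X} {z : E2} (hz : z ∈ (extChartAt IX x₀).target) :
    (extChartAt IX x₀).target ∈ 𝓝 z :=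
  (isOpen_extChartAt_target x₀).mem_nhds hz

theorem contMDiffAt_extChartAt_symm' {x₀ : X} {z : E2} (hz : z ∈ (extChartAt IX x₀).target) :
    ContMDiffAt 𝓘(ℝ, E2) IX ∞ (extChartAt IX x₀).symm z :=
  (contMDiffOn_extChartAt_symm x₀).contMDiffAt (extChartAt_target_mem_nhds_of_mem hz)

theorem fderiv_comp_extChartAt_symm {x₀ : X} {z : E2} (hz : z ∈ (extChartAt IX x₀).target)
    {f : X → ℝ} (hf : MDifferentiableAt IX 𝓘(ℝ, ℝ) f ((extChartAt IX x₀).symm z)) (w : E2) :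
    fderiv ℝ (f ∘ (extChartAt IX x₀).symm) z w = mvfderiv IX f ((extChartAt IX x₀).symm z)
      (mfderiv 𝓘(ℝ, E2) IX (extChartAt IX x₀).symm z w) := by
  have h := mfderiv_comp z hf ((contMDiffAt_extChartAt_symm' hz).mdifferentiableAt (by simp))
  rw [← mfderiv_eq_fderiv, h]
  rfl

theorem contDiffAt_comp_extChartAt_symm {x₀ : X} {z : E2} (hz : z ∈ (extChartAt IX x₀).target)
    {V : Type*} [NormedAddCommGroup V] [NormedSpace ℝ V]
    {f : X → V} (hf : ContMDiffAt IX 𝓘(ℝ, V) ∞ f ((extChartAt IX x₀).symm z)) :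
    ContDiffAt ℝ ∞ (f ∘ (extChartAt IX x₀).symm) z :=
  (hf.comp z (contMDiffAt_extChartAt_symm' hz)).contDiffAt

theorem mvfderiv_coordFun_symm {x₀ : X} {z : E2} (hz : z ∈ (extChartAt IX x₀).target) (i : Fin 2)
    (w : E2) : mvfderiv IX (coordFun x₀ i) ((extChartAt IX x₀).symm z)
      (mfderiv 𝓘(ℝ, E2) IX (extChartAt IX x₀).symm z w) = w i := by
  have hy : (extChartAt IX x₀).symm z ∈ (chartAt E2 x₀).source := by
    rw [← extChartAt_source (I := IX)]; exact (extChartAt IX x₀).map_target hz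
  rw [← fderiv_comp_extChartAt_symm hz ((coordFun_smooth x₀ i hy).mdifferentiableAt (by simp))]
  have e : coordFun x₀ i ∘ (extChartAt IX x₀).symm =ᶠ[𝓝 z] (EuclideanSpace.proj i : E2 →L[ℝ] ℝ) := by
    filter_upwards [extChartAt_target_mem_nhds_of_mem hz] with w hw
    simp only [Function.comp_apply, coordFun]
    rw [(extChartAt IX x₀).right_inv hw]
    rfl
  rw [e.fderiv_eq, ContinuousLinearMap.fderiv]
  rfl

theorem smoothVecAt_locFrame_of_mem {x₀ y : X} (t : ℝ)
    (hy : y ∈ (trivializationAt E2 (TangentSpace IX : X → Type _) x₀).baseSet) (i : Fin 2) :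
    SmoothVecAt (fun _ y ↦ locFrame x₀ i y) (t, y) := by
  set e := trivializationAt E2 (TangentSpace IX : X → Type _) x₀
  have h1 : ContMDiffAt IX (IX.prod 𝓘(ℝ, E2)) ∞
      (fun y : X ↦ (y, (EuclideanSpace.single i (1 : ℝ) : E2))) y :=
    contMDiffAt_id.prodMk contMDiffAt_const
  have h2 := (e.contMDiffOn_symm (IB := IX) (n := ∞)).contMDiffAt
    ((e.open_target).mem_nhds (show (y, (EuclideanSpace.single i (1 : ℝ) : E2)) ∈ e.target by
      rw [e.mem_target]; exact hy))
  have h3 := h2.comp y h1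
  have h4 : ContMDiffAt IX IX.tangent ∞ (fun y ↦ (⟨y, locFrame x₀ i y⟩ : TangentBundle IX X)) y := by
    refine h3.congr_of_eventuallyEq ?_
    filter_upwards [e.open_baseSet.mem_nhds hy] with m hm
    exact e.mk_symm hm _
  exact ContMDiffAt.comp (t, y) (g := fun y ↦ (⟨y, locFrame x₀ i y⟩ : TangentBundle IX X))
    (f := Prod.snd) h4 contMDiffAt_snd

/-- A closed one-form is locally exact. -/
theorem exists_primitive {θ : ∀ x : X, TangentSpace IX x →L[ℝ] ℝ}
    (hθ : ∀ p, SmoothFormAt (fun _ ↦ θ) p) (hc : ∀ x, IsExtDerivAt IX θ x fun _ _ ↦ 0) (x₀ : X) :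
    ∃ f : X → ℝ, ∀ᶠ y in 𝓝 x₀, ContMDiffAt IX 𝓘(ℝ, ℝ) ∞ f y ∧ mvfderiv IX f y = θ y := by
  set ψ := extChartAt IX x₀ with hψ
  let f : Fin 2 → X → ℝ := fun i y ↦ θ y (locFrame x₀ i y)
  have hf : ∀ i, ∀ y ∈ (trivializationAt E2 (TangentSpace IX : X → Type _) x₀).baseSet,
      ContMDiffAt IX 𝓘(ℝ, ℝ) ∞ (f i) y := fun i y hy ↦
    SmoothFormAt.slice (f := fun p : ℝ × X ↦ f i p.2) (t := 0)
      ((hθ (0, y)).apply (smoothVecAt_locFrame_of_mem 0 hy i))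
  have hev : ∀ᶠ y in 𝓝 x₀, (∀ i, ContMDiffAt IX 𝓘(ℝ, ℝ) ∞ (f i) y) ∧ y ∈ ψ.source := by
    refine (eventually_all.2 fun i ↦ ?_).and (extChartAt_source_mem_nhds x₀)
    filter_upwards [mem_trivializationAt_baseSet x₀] with y hy using hf i y hy
  have hsymm : Tendsto ψ.symm (𝓝 (ψ x₀)) (𝓝 x₀) := by
    have h := continuousAt_extChartAt_symm (I := IX) x₀
    rw [ContinuousAt, extChartAt_to_inv] at h
    exact h
  have hev2 : ∀ᶠ z in 𝓝 (ψ x₀), z ∈ ψ.target ∧ ∀ i, ContMDiffAt IX 𝓘(ℝ, ℝ) ∞ (f i) (ψ.symm z) := by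
    filter_upwards [extChartAt_target_mem_nhds x₀, hsymm.eventually hev] with z h1 h2
    exact ⟨h1, h2.1⟩
  obtain ⟨r, hr, hball⟩ := Metric.eventually_nhds_iff_ball.1 hev2
  let c : Fin 2 → (E2 →L[ℝ] ℝ) := fun i ↦ EuclideanSpace.proj i
  let a : E2 → (E2 →L[ℝ] ℝ) := fun z ↦ (f 0 ∘ ψ.symm) z • c 0 + (f 1 ∘ ψ.symm) z • c 1
  have hg : ∀ i, ∀ z ∈ Metric.ball (ψ x₀) r, ContDiffAt ℝ ∞ (f i ∘ ψ.symm) z := fun i z hz ↦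
    contDiffAt_comp_extChartAt_symm (hball z hz).1 ((hball z hz).2 i)
  have ha : ∀ z ∈ Metric.ball (ψ x₀) r, ContDiffAt ℝ ∞ a z := fun z hz ↦
    ((hg 0 z hz).smul contDiffAt_const).add ((hg 1 z hz).smul contDiffAt_const)
  have hda : ∀ z ∈ Metric.ball (ψ x₀) r, ∀ v w, fderiv ℝ a z v w
      = fderiv ℝ (f 0 ∘ ψ.symm) z v * w 0 + fderiv ℝ (f 1 ∘ ψ.symm) z v * w 1 := by
    intro z hz v w
    have h : HasFDerivAt a ((fderiv ℝ (f 0 ∘ ψ.symm) z).smulRight (c 0)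
        + (fderiv ℝ (f 1 ∘ ψ.symm) z).smulRight (c 1)) z :=
      (((hg 0 z hz).differentiableAt (by simp)).hasFDerivAt.smul_const (c 0)).add
        (((hg 1 z hz).differentiableAt (by simp)).hasFDerivAt.smul_const (c 1))
    rw [h.fderiv]
    simp [c]
  -- Closedness read in the chart: `dθ = ∑ d(f i) ∧ dx_i` vanishes on all pairs of coordinate
  -- vectors exactly when the derivative of the covector-valued map `a` is symmetric. On a ball this
  -- gives a potential.
  have hsym : ∀ z ∈ Metric.ball (ψ x₀) r, ∀ v w, fderiv ℝ a z v w = fderiv ℝ a z w v := by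
    intro z hz v w
    have hzt := (hball z hz).1
    have hdf : ∀ i, MDifferentiableAt IX 𝓘(ℝ, ℝ) (f i) (ψ.symm z) := fun i ↦
      ((hball z hz).2 i).mdifferentiableAt (by simp)
    have hys : ψ.symm z ∈ (chartAt E2 x₀).source := by
      rw [← extChartAt_source (I := IX)]; exact ψ.map_target hzt
    have hco : ∀ i, ContMDiffAt IX 𝓘(ℝ, ℝ) 2 (coordFun x₀ i) (ψ.symm z) := fun i ↦
      (coordFun_smooth x₀ i hys).of_le two_le_infty
    have hd : ∀ i, IsExtDerivAt IX (fun y ↦ f i y • mvfderiv IX (coordFun x₀ i) y) (ψ.symm z) _ :=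
      fun i ↦ IsExtDerivAt.smul (hdf i) (formDiffAt_mvfderiv (hco i)) (isExtDerivAt_mvfderiv (hco i))
    have hfd : ∀ i, FormDiffAt IX (fun y ↦ f i y • mvfderiv IX (coordFun x₀ i) y) (ψ.symm z) :=
      fun i ↦ FormDiffAt.smul (hdf i) (formDiffAt_mvfderiv (hco i))
    have hsum := ((hd 0).add (hfd 0) (hfd 1) (hd 1)).congr (θ' := θ) (by
      filter_upwards [(chartAt E2 x₀).open_source.mem_nhds hys] with y hy
      exact (form_eq_sum_coordFun hy _).symm)
    have h0 := hsum.unique (hc (ψ.symm z)) (mfderiv 𝓘(ℝ, E2) IX ψ.symm z v)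
      (mfderiv 𝓘(ℝ, E2) IX ψ.symm z w)
    rw [hda z hz, hda z hz, fderiv_comp_extChartAt_symm hzt (hdf 0),
      fderiv_comp_extChartAt_symm hzt (hdf 1), fderiv_comp_extChartAt_symm hzt (hdf 0),
      fderiv_comp_extChartAt_symm hzt (hdf 1)]
    rw [mvfderiv_coordFun_symm hzt, mvfderiv_coordFun_symm hzt, mvfderiv_coordFun_symm hzt,
      mvfderiv_coordFun_symm hzt] at h0
    linarith
  obtain ⟨h, hh⟩ := (convex_ball (ψ x₀) r).exists_forall_hasFDerivAt_of_fderiv_symmetric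
    Metric.isOpen_ball (fun z hz ↦ ((ha z hz).differentiableAt (by simp)).differentiableWithinAt) hsym
  have hsm : ContDiffOn ℝ ∞ h (Metric.ball (ψ x₀) r) := by
    rw [contDiffOn_infty_iff_fderiv_of_isOpen Metric.isOpen_ball]
    refine ⟨fun z hz ↦ (hh z hz).differentiableAt.differentiableWithinAt, ?_⟩
    refine ContDiffOn.congr (fun z hz ↦ (ha z hz).contDiffWithinAt) fun z hz ↦ (hh z hz).fderiv
  refine ⟨h ∘ ψ, ?_⟩
  have hnear : ∀ᶠ y in 𝓝 x₀, ψ y ∈ Metric.ball (ψ x₀) r :=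
    (continuousAt_extChartAt (I := IX) x₀).eventually (Metric.ball_mem_nhds _ hr)
  filter_upwards [hnear, extChartAt_source_mem_nhds (I := IX) x₀] with y hy hys
  have hys' : y ∈ (chartAt E2 x₀).source := by rwa [← extChartAt_source (I := IX)]
  refine ⟨?_, ?_⟩
  · exact ((hsm.contDiffAt (Metric.isOpen_ball.mem_nhds hy)).contMDiffAt).comp y
      (contMDiffAt_extChartAt' hys')
  · have e := mfderiv_comp y (hh _ hy).hasMFDerivAt.mdifferentiableAt
      (mdifferentiableAt_extChartAt (I := IX) hys')
    rw [form_eq_sum_coordFun hys' (θ y)]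
    have e2 : ∀ i, mvfderiv IX (coordFun x₀ i) y =
        (c i).comp (mfderiv IX 𝓘(ℝ, E2) ψ y) := by
      intro i
      have h2 := (c i).hasMFDerivAt.comp y (mdifferentiableAt_extChartAt (I := IX) hys').hasMFDerivAt
      exact h2.mfderiv
    rw [e2, e2]
    refine Eq.trans e ?_
    rw [(hh _ hy).hasMFDerivAt.mfderiv]
    have e3 : a (ψ y) = f 0 y • c 0 + f 1 y • c 1 := by
      simp only [a, Function.comp_apply]
      rw [ψ.left_inv hys]
    rw [e3]
    rfl

end Primitive

/-! ### Surfaces with a closed global coframe: flat boxes. -/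

section Translation

variable {X : Type*} [TopologicalSpace X] [ChartedSpace E2 X] [IsManifold IX ∞ X]

variable (X) in
/-- A global frame `(P, Q)` of a surface with closed dual coframe `(a, b)`. -/
structure TransFrame where
  P : ∀ x : X, TangentSpace IX x
  Q : ∀ x : X, TangentSpace IX x
  a : ∀ x : X, TangentSpace IX x →L[ℝ] ℝ
  b : ∀ x : X, TangentSpace IX x →L[ℝ] ℝ
  smooth_a : ∀ p, SmoothFormAt (fun _ ↦ a) p
  smooth_b : ∀ p, SmoothFormAt (fun _ ↦ b) p
  closed_a : ∀ x, IsExtDerivAt IX a x fun _ _ ↦ 0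
  closed_b : ∀ x, IsExtDerivAt IX b x fun _ _ ↦ 0
  a_P : ∀ x, a x (P x) = 1
  a_Q : ∀ x, a x (Q x) = 0
  b_P : ∀ x, b x (P x) = 0
  b_Q : ∀ x, b x (Q x) = 1
  expand : ∀ x (v : TangentSpace IX x), v = a x v • P x + b x v • Q x

namespace TransFrame

variable (C : TransFrame X)

/-- The vector field with constant coefficients `w` in the frame `(P, Q)`. -/
def field (w : E2) (x : X) : TangentSpace IX x := w 0 • C.P x + w 1 • C.Q x

/-- The frame as a linear map. -/
def frameMap (x : X) : E2 →L[ℝ] TangentSpace IX x :=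
  (EuclideanSpace.proj 0 : E2 →L[ℝ] ℝ).smulRight (C.P x)
    + (EuclideanSpace.proj 1 : E2 →L[ℝ] ℝ).smulRight (C.Q x)

theorem frameMap_apply (x : X) (w : E2) : C.frameMap x w = C.field w x := rfl

theorem a_field (w : E2) (x : X) : C.a x (C.field w x) = w 0 := by
  rw [field, map_add, map_smul, map_smul, C.a_P, C.a_Q]; simp

theorem b_field (w : E2) (x : X) : C.b x (C.field w x) = w 1 := by
  rw [field, map_add, map_smul, map_smul, C.b_P, C.b_Q]; simp

theorem eq_field {x : X} {v : TangentSpace IX x} {w : E2} (ha : C.a x v = w 0) (hb : C.b x v = w 1) :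
    v = C.field w x := by
  rw [C.expand x v, ha, hb]; rfl

theorem smooth_field (w : E2) :
    ContMDiff IX IX.tangent ∞ (fun x ↦ (⟨x, C.field w x⟩ : TangentBundle IX X)) := by
  intro x
  have h : SmoothVecAt (fun _ ↦ C.field w) ((0 : ℝ), x) :=
    SmoothVecAt.of_pairing (f := fun _ ↦ w 0) (g := fun _ ↦ w 1) (C.smooth_a _) (C.smooth_b _)
      contMDiffAt_const contMDiffAt_const
      (Eventually.of_forall fun m ↦ ⟨C.a_field w m.2, C.b_field w m.2⟩)
      (v := C.P x) (w := C.Q x) (by simp [C.a_P, C.a_Q, C.b_P, C.b_Q])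
  have h2 : ContMDiffAt IX JX ∞ (fun y : X ↦ ((0 : ℝ), y)) x := contMDiffAt_const.prodMk contMDiffAt_id
  exact ContMDiffAt.comp x h h2

/-- Local coordinates in which `(P, Q)` is the coordinate frame. -/
theorem exists_box (x : X) : ∃ (σ : E2 → X) (Φ : X → E2), σ 0 = x ∧ Φ x = 0 ∧
    (∀ᶠ w in 𝓝 (0 : E2), ContMDiffAt 𝓘(ℝ, E2) IX ∞ σ w ∧ Φ (σ w) = w ∧
      HasMFDerivAt 𝓘(ℝ, E2) IX σ w (C.frameMap (σ w))) ∧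
    ∀ᶠ y in 𝓝 x, ContMDiffAt IX 𝓘(ℝ, E2) ∞ Φ y ∧ σ (Φ y) = y := by
  obtain ⟨fa, hfa⟩ := exists_primitive C.smooth_a C.closed_a x
  obtain ⟨fb, hfb⟩ := exists_primitive C.smooth_b C.closed_b x
  set ψ := extChartAt IX x with hψ
  let s0 : E2 := EuclideanSpace.single 0 1
  let s1 : E2 := EuclideanSpace.single 1 1
  -- Primitives of `a` and `b` serve as coordinates. The derivative of `Φ` is `(a, b)`, which is
  -- invertible, so the inverse function theorem gives the inverse `σ`, whose derivative is the
  -- frame `(P, Q)`.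
  let Φ : X → E2 := fun y ↦ (fa y - fa x) • s0 + (fb y - fb x) • s1
  let T : ∀ y : X, TangentSpace IX y →L[ℝ] E2 := fun y ↦
    (C.a y).smulRight s0 + (C.b y).smulRight s1
  have hT : ∀ y v, T y v = C.a y v • s0 + C.b y v • s1 := fun y v ↦ rfl
  have hgood : ∀ᶠ y in 𝓝 x, ContMDiffAt IX 𝓘(ℝ, E2) ∞ Φ y ∧
      HasMFDerivAt IX 𝓘(ℝ, E2) Φ y (T y) := by
    filter_upwards [hfa, hfb] with y h1 h2
    have hs : ContMDiffAt IX 𝓘(ℝ, E2) ∞ Φ y :=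
      ((h1.1.sub contMDiffAt_const).smul contMDiffAt_const).add
        ((h2.1.sub contMDiffAt_const).smul contMDiffAt_const)
    refine ⟨hs, ?_⟩
    have hlin : ∀ (f : X → ℝ) (θ : TangentSpace IX y →L[ℝ] ℝ) (s : E2),
        ContMDiffAt IX 𝓘(ℝ, ℝ) ∞ f y → mvfderiv IX f y = θ →
        HasMFDerivAt IX 𝓘(ℝ, E2) (fun y ↦ (f y - f x) • s) y (θ.smulRight s) := by
      intro f θ s hf hθ
      have g1 : HasFDerivAt (fun r : ℝ ↦ (r - f x) • s) ((1 : ℝ →L[ℝ] ℝ).smulRight s) (f y) :=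
        ((hasFDerivAt_id (f y)).sub_const (f x)).smul_const s
      have g2 := g1.hasMFDerivAt.comp y (hf.mdifferentiableAt (by simp)).hasMFDerivAt
      refine g2.congr_mfderiv ?_
      rw [← hθ]
      rfl
    exact (hlin fa _ s0 h1.1 h1.2).add (hlin fb _ s1 h2.1 h2.2)
  have hsymm : Tendsto ψ.symm (𝓝 (ψ x)) (𝓝 x) := by
    have h := continuousAt_extChartAt_symm (I := IX) x
    rw [ContinuousAt, extChartAt_to_inv] at h
    exact h
  let G : E2 → E2 := Φ ∘ ψ.symm
  have hGood : ∀ z ∈ ψ.target, (ContMDiffAt IX 𝓘(ℝ, E2) ∞ Φ (ψ.symm z) ∧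
      HasMFDerivAt IX 𝓘(ℝ, E2) Φ (ψ.symm z) (T (ψ.symm z))) →
      ContDiffAt ℝ ∞ G z ∧ ∃ G' : E2 ≃L[ℝ] E2, HasFDerivAt G (G' : E2 →L[ℝ] E2) z := by
    intro z hz ⟨h1, h2⟩
    refine ⟨contDiffAt_comp_extChartAt_symm hz h1, ?_⟩
    have hd := ((contMDiffAt_extChartAt_symm' hz).mdifferentiableAt (by simp)).hasMFDerivAt
    have hG : HasFDerivAt G ((T (ψ.symm z)).comp (mfderiv 𝓘(ℝ, E2) IX ψ.symm z)) z :=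
      (h2.comp z hd).hasFDerivAt
    have inj : Function.Injective ((T (ψ.symm z)).comp (mfderiv 𝓘(ℝ, E2) IX ψ.symm z) : E2 →L[ℝ] E2) := by
      intro v w hvw
      have hTi : ∀ u u' : TangentSpace IX (ψ.symm z), T (ψ.symm z) u = T (ψ.symm z) u' → u = u' := by
        intro u u' h
        rw [hT, hT] at h
        have h0 := congrArg (fun r : E2 ↦ r 0) h
        have h1 := congrArg (fun r : E2 ↦ r 1) h
        simp [s0, s1] at h0 h1
        rw [C.expand _ u, C.expand _ u', h0, h1]
      have hD := hTi _ _ hvw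
      ext i
      rw [← mvfderiv_coordFun_symm hz i v, ← mvfderiv_coordFun_symm hz i w]
      exact congrArg _ hD
    let e : E2 ≃L[ℝ] E2 := (LinearEquiv.ofInjectiveEndo
      ((T (ψ.symm z)).comp (mfderiv 𝓘(ℝ, E2) IX ψ.symm z) : E2 →L[ℝ] E2).toLinearMap
        inj).toContinuousLinearEquiv
    exact ⟨e, hG⟩
  have hz0 : ψ x ∈ ψ.target := mem_extChartAt_target x
  have hback : ψ.symm (ψ x) = x := extChartAt_to_inv x
  have hΦx : Φ x = 0 := by simp [Φ]
  obtain ⟨hG1, G', hG'⟩ := hGood (ψ x) hz0 (by rw [hback]; exact hgood.self_of_nhds)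
  let e := hG1.toOpenPartialHomeomorph G hG' (by simp)
  have hsrc : ψ x ∈ e.source := hG1.mem_toOpenPartialHomeomorph_source hG' (by simp)
  have he : ∀ z, e z = G z := fun z ↦ rfl
  have hG0 : G (ψ x) = 0 := by simp only [G, Function.comp_apply, hback, hΦx]
  have htgt : (0 : E2) ∈ e.target := by
    rw [← hG0, ← he]; exact e.map_source hsrc
  have hes : e.symm 0 = ψ x := by rw [← hG0, ← he, e.left_inv hsrc]
  have hetend : Tendsto e.symm (𝓝 0) (𝓝 (ψ x)) := by
    have := e.continuousAt_symm htgt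
    rwa [ContinuousAt, hes] at this
  let σ : E2 → X := fun w ↦ ψ.symm (e.symm w)
  have hσtend : Tendsto σ (𝓝 0) (𝓝 x) := hsymm.comp hetend
  refine ⟨σ, Φ, by simp only [σ]; rw [hes, hback], hΦx, ?_, ?_⟩
  · have hinv : ∀ᶠ w in 𝓝 (0 : E2), Φ (σ w) = w := by
      filter_upwards [e.open_target.mem_nhds htgt] with w hw
      change e (e.symm w) = w
      exact e.right_inv hw
    filter_upwards [e.open_target.mem_nhds htgt, hinv.eventually_nhds, hσtend.eventually hgood,
      hetend.eventually (extChartAt_target_mem_nhds x)] with w hw h1 h2 h3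
    obtain ⟨hg1, g', hg'⟩ := hGood (e.symm w) h3 h2
    have hcs : ContDiffAt ℝ ∞ e.symm w := e.contDiffAt_symm hw hg' hg1
    have hσ : ContMDiffAt 𝓘(ℝ, E2) IX ∞ σ w :=
      (contMDiffAt_extChartAt_symm' h3).comp w hcs.contMDiffAt
    refine ⟨hσ, h1.self_of_nhds, ?_⟩
    have hd := (hσ.mdifferentiableAt (by simp)).hasMFDerivAt
    have hcomp : HasFDerivAt (Φ ∘ σ) ((T (σ w)).comp (mfderiv 𝓘(ℝ, E2) IX σ w) : E2 →L[ℝ] E2) w :=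
      (h2.2.comp w hd).hasFDerivAt
    have hid : HasFDerivAt (Φ ∘ σ) (ContinuousLinearMap.id ℝ E2) w :=
      (hasFDerivAt_id w).congr_of_eventuallyEq h1
    have huniq := hcomp.unique hid
    refine hd.congr_mfderiv ?_
    ext v
    have hv : T (σ w) (mfderiv 𝓘(ℝ, E2) IX σ w v) = v := DFunLike.congr_fun huniq v
    rw [hT] at hv
    have h0 := congrArg (fun r : E2 ↦ r 0) hv
    have h1 := congrArg (fun r : E2 ↦ r 1) hv
    simp [s0, s1] at h0 h1
    exact C.eq_field h0 h1
  · have hψt : Tendsto ψ (𝓝 x) (𝓝 (ψ x)) := continuousAt_extChartAt (I := IX) x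
    filter_upwards [hgood, hψt.eventually (e.open_source.mem_nhds hsrc),
      extChartAt_source_mem_nhds (I := IX) x] with y h1 h2 h3
    refine ⟨h1.1, ?_⟩
    have h4 : Φ y = e (ψ y) := by
      rw [he]; simp only [G, Function.comp_apply]; rw [ψ.left_inv h3]
    simp only [σ]
    rw [h4, e.left_inv h2, ψ.left_inv h3]

end TransFrame

end Translation

/-! ### The action of `ℝ²` by the flows of constant-coefficient fields. -/

section Translation

variable {X : Type*} [TopologicalSpace X] [T2Space X] [ChartedSpace E2 X] [IsManifold IX ∞ X]

namespace TransFrame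

variable (C : TransFrame X)

theorem smooth_field_one (w : E2) :
    ContMDiff IX IX.tangent 1 (fun x ↦ (⟨x, C.field w x⟩ : TangentBundle IX X)) :=
  (C.smooth_field w).of_le (by simp)

theorem field_smul (c : ℝ) (w : E2) (x : X) : C.field (c • w) x = c • C.field w x := by
  simp only [field, PiLp.smul_apply, smul_eq_mul, smul_add, smul_smul]

theorem hasMFDerivAt_line {σ : E2 → X} {w v : E2} {s : ℝ}
    (h : HasMFDerivAt 𝓘(ℝ, E2) IX σ (w + s • v) (C.frameMap (σ (w + s • v)))) :
    HasMFDerivAt 𝓘(ℝ, ℝ) IX (fun s : ℝ ↦ σ (w + s • v)) s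
      ((1 : ℝ →L[ℝ] ℝ).smulRight (C.field v (σ (w + s • v)))) := by
  have h1 : HasFDerivAt (fun s : ℝ ↦ w + s • v) ((1 : ℝ →L[ℝ] ℝ).smulRight v) s :=
    ((hasFDerivAt_id s).smul_const v).const_add w
  refine (h.comp s h1.hasMFDerivAt).congr_mfderiv ?_
  ext
  change C.frameMap (σ (w + s • v)) ((1 : ℝ) • v) = (1 : ℝ) • C.field v (σ (w + s • v))
  rw [one_smul, one_smul, frameMap_apply]

/-- Integral curves exist for a time which is locally uniform. -/
theorem exists_integralCurve_uniform (y : X) (v : E2) : ∃ δ > 0, ∀ᶠ z in 𝓝 y, ∃ γ : ℝ → X,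
    γ 0 = z ∧ IsMIntegralCurveOn γ (C.field v) (Set.Ioo (-δ) δ) := by
  obtain ⟨σ, Φ, -, hΦ, hσ, hev⟩ := C.exists_box y
  obtain ⟨ρ, hρ, hball⟩ := Metric.eventually_nhds_iff_ball.1 hσ
  have hΦc : ContinuousAt Φ y := hev.self_of_nhds.1.continuousAt
  have hsmall : ∀ᶠ z in 𝓝 y, Φ z ∈ Metric.ball (0 : E2) (ρ / 2) :=
    hΦc.eventually (by rw [hΦ]; exact Metric.ball_mem_nhds _ (half_pos hρ))
  refine ⟨ρ / (2 * (‖v‖ + 1)), by positivity, ?_⟩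
  filter_upwards [hsmall, hev] with z h1 h2
  refine ⟨fun s ↦ σ (Φ z + s • v), by simp [h2.2], fun s hs ↦ ?_⟩
  refine (C.hasMFDerivAt_line (hball _ ?_).2.2).hasMFDerivWithinAt
  rw [mem_ball_zero_iff] at h1 ⊢
  have h3 : |s| * (2 * (‖v‖ + 1)) < ρ := (lt_div_iff₀ (by positivity)).1 (abs_lt.2 hs)
  calc ‖Φ z + s • v‖ ≤ ‖Φ z‖ + |s| * ‖v‖ := (norm_add_le _ _).trans (by rw [norm_smul]; rfl)
    _ < ρ := by nlinarith [abs_nonneg s, norm_nonneg v]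

/-- By uniqueness the curve agrees near `t₀` with the image of a straight line under the box map,
which is smooth. -/
theorem contMDiffAt_of_isMIntegralCurveAt {γ : ℝ → X} {v : E2} {t₀ : ℝ}
    (h : IsMIntegralCurveAt γ (C.field v) t₀) : ContMDiffAt 𝓘(ℝ, ℝ) IX ∞ γ t₀ := by
  obtain ⟨σ, Φ, hσ0, hΦ, hσ, hev⟩ := C.exists_box (γ t₀)
  have hc : ContMDiffAt 𝓘(ℝ, ℝ) 𝓘(ℝ, E2) ∞ (fun s : ℝ ↦ -t₀ • v + s • v) t₀ :=
    (contDiff_const.add (contDiff_id.smul contDiff_const)).contMDiff.contMDiffAt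
  have h0 : -t₀ • v + t₀ • v = 0 := by module
  have hs : ContMDiffAt 𝓘(ℝ, ℝ) IX ∞ (fun s : ℝ ↦ σ (-t₀ • v + s • v)) t₀ :=
    ContMDiffAt.comp t₀ (g := σ) (by rw [h0]; exact hσ.self_of_nhds.1) hc
  refine hs.congr_of_eventuallyEq ?_
  refine isMIntegralCurveAt_eventuallyEq_of_contMDiffAt_boundaryless
    (C.smooth_field_one v).contMDiffAt h ?_ (by simp only [h0, hσ0])
  have : Tendsto (fun s : ℝ ↦ -t₀ • v + s • v) (𝓝 t₀) (𝓝 0) := by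
    have := hc.continuousAt
    rwa [ContinuousAt, h0] at this
  filter_upwards [this.eventually hσ] with s hs
  exact C.hasMFDerivAt_line hs.2.2

/-- All vector fields with constant coefficients are complete. -/
def Complete : Prop := ∀ (x : X) (v : E2), ∃ γ : ℝ → X, γ 0 = x ∧ IsMIntegralCurve γ (C.field v)

variable {C} (hC : C.Complete)

/-- The time-one flow of the vector field with constant coefficients `v`. -/
def flow (x : X) (v : E2) : X := (hC x v).choose 1

/-- The reparametrized curve `γ (· * s)` is an integral curve of the field of `s • v`; uniqueness at
time one removes the choice in `flow`. -/
theorem integralCurve_eq_flow {γ : ℝ → X} {x : X} {v : E2} (h0 : γ 0 = x)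
    (h : IsMIntegralCurve γ (C.field v)) (s : ℝ) : γ s = flow hC x (s • v) := by
  obtain ⟨h1, h2⟩ := (hC x (s • v)).choose_spec
  have h3 : IsMIntegralCurve (γ ∘ (· * s)) (C.field (s • v)) := by
    have := h.comp_mul s
    have e : C.field (s • v) = s • C.field v := by
      funext x; exact C.field_smul s v x
    rwa [e]
  have h4 := isMIntegralCurve_Ioo_eq_of_contMDiff_boundaryless (t₀ := 0)
    (C.smooth_field_one (s • v)) h3 h2 (by simp [h0, h1])
  have : γ (1 * s) = _ := congrFun h4 1
  rw [one_mul] at this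
  exact this

theorem isMIntegralCurve_flow (x : X) (v : E2) :
    IsMIntegralCurve (fun s : ℝ ↦ flow hC x (s • v)) (C.field v) := by
  obtain ⟨h1, h2⟩ := (hC x v).choose_spec
  have : (fun s : ℝ ↦ flow hC x (s • v)) = (hC x v).choose := by
    funext s; exact (integralCurve_eq_flow hC h1 h2 s).symm
  rwa [this]

@[simp]
theorem flow_zero (x : X) : flow hC x 0 = x := by
  obtain ⟨h1, h2⟩ := (hC x 0).choose_spec
  have := integralCurve_eq_flow hC h1 h2 0
  rw [h1, smul_zero] at this
  exact this.symm

/-- An integral curve defined on an interval around `[0, 1]` computes the flow. -/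
theorem flow_eq_of_isMIntegralCurveOn {γ : ℝ → X} {x : X} {v : E2} {a b : ℝ} (ha : a < 0) (hb : 1 < b)
    (h0 : γ 0 = x) (h : IsMIntegralCurveOn γ (C.field v) (Set.Ioo a b)) : γ 1 = flow hC x v := by
  have := isMIntegralCurveOn_Ioo_eqOn_of_contMDiff_boundaryless (t₀ := 0) (a := a) (b := b)
    ⟨ha, by linarith⟩ (C.smooth_field_one v) h
    ((isMIntegralCurve_flow hC x v).isMIntegralCurveOn _) (by simp [h0])
  simpa using this (show (1 : ℝ) ∈ Set.Ioo a b from ⟨by linarith, hb⟩)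

/-- The flow is a local diffeomorphism at the points of the ball of radius `r`. -/
def FlowGood (y : X) (r : ℝ) : Prop :=
  ∀ w ∈ Metric.ball (0 : E2) r,
    HasMFDerivAt 𝓘(ℝ, E2) IX (flow hC y) w (C.frameMap (flow hC y w))

/-- A curve which is tangent to the constant-coefficient fields on a ball computes the flow. -/
theorem flow_eq_of_hasMFDerivAt {σ : E2 → X} {r : ℝ}
    (h : ∀ w ∈ Metric.ball (0 : E2) r, HasMFDerivAt 𝓘(ℝ, E2) IX σ w (C.frameMap (σ w)))
    {w u : E2} (hw : w ∈ Metric.ball (0 : E2) r) (hu : w + u ∈ Metric.ball (0 : E2) r) :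
    flow hC (σ w) u = σ (w + u) := by
  have hopen : IsOpen {s : ℝ | w + s • u ∈ Metric.ball (0 : E2) r} :=
    Metric.isOpen_ball.preimage (by fun_prop)
  have h0 : (0 : ℝ) ∈ {s : ℝ | w + s • u ∈ Metric.ball (0 : E2) r} := by simpa using hw
  have h1 : (1 : ℝ) ∈ {s : ℝ | w + s • u ∈ Metric.ball (0 : E2) r} := by simpa using hu
  obtain ⟨ε₀, hε₀, hb₀⟩ := Metric.isOpen_iff.1 hopen 0 h0
  obtain ⟨ε₁, hε₁, hb₁⟩ := Metric.isOpen_iff.1 hopen 1 h1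
  -- Convexity controls `[0, 1]`. The margins `ε₀` and `ε₁` are needed because curves are compared
  -- on open intervals containing both ends.
  have hconv : ∀ s ∈ Set.Ioo (-ε₀) (1 + ε₁), w + s • u ∈ Metric.ball (0 : E2) r := by
    intro s hs
    rcases lt_or_ge s 0 with hs0 | hs0
    · exact hb₀ (by rw [Metric.mem_ball, Real.dist_eq, sub_zero, abs_lt]; constructor <;> linarith [hs.1])
    rcases lt_or_ge 1 s with hs1 | hs1
    · exact hb₁ (by rw [Metric.mem_ball, Real.dist_eq, abs_lt]; constructor <;> linarith [hs.2])
    have := (convex_ball (0 : E2) r) hw hu (sub_nonneg.2 hs1) hs0 (by ring)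
    convert this using 1
    module
  have key := flow_eq_of_isMIntegralCurveOn hC (γ := fun s ↦ σ (w + s • u)) (x := σ w) (v := u)
    (a := -ε₀) (b := 1 + ε₁) (by linarith) (by linarith) (by simp)
    (fun s hs ↦ (C.hasMFDerivAt_line (h _ (hconv s hs))).hasMFDerivWithinAt)
  simpa using key.symm

/-- Near the origin the flow is given by the local coordinates. -/
theorem exists_flow_box (y : X) : ∃ (Φ : X → E2) (ρ : ℝ), 0 < ρ ∧ Φ y = 0 ∧ FlowGood hC y ρ ∧
    (∀ w ∈ Metric.ball (0 : E2) ρ, ContMDiffAt 𝓘(ℝ, E2) IX ∞ (flow hC y) w ∧ Φ (flow hC y w) = w) ∧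
    ∀ᶠ z in 𝓝 y, ContMDiffAt IX 𝓘(ℝ, E2) ∞ Φ z ∧ flow hC y (Φ z) = z := by
  obtain ⟨σ, Φ, hσ0, hΦ, hσ, hev⟩ := C.exists_box y
  obtain ⟨ρ, hρ, hball⟩ := Metric.eventually_nhds_iff_ball.1 hσ
  have heq : ∀ w ∈ Metric.ball (0 : E2) ρ, flow hC y w = σ w := by
    intro w hw
    have := flow_eq_of_hasMFDerivAt hC (fun w hw ↦ (hball w hw).2.2) (w := 0) (u := w)
      (Metric.mem_ball_self hρ) (by simpa using hw)
    rwa [hσ0, zero_add] at this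
  have hev' : ∀ w ∈ Metric.ball (0 : E2) ρ, flow hC y =ᶠ[𝓝 w] σ := fun w hw ↦ by
    filter_upwards [Metric.isOpen_ball.mem_nhds hw] with u hu using heq u hu
  refine ⟨Φ, ρ, hρ, hΦ, fun w hw ↦ ?_, fun w hw ↦ ⟨?_, ?_⟩, ?_⟩
  · rw [heq w hw]
    exact (hball w hw).2.2.congr_of_eventuallyEq (hev' w hw)
  · exact (hball w hw).1.congr_of_eventuallyEq (hev' w hw)
  · rw [heq w hw]; exact (hball w hw).2.1
  · have hΦc : ContinuousAt Φ y := hev.self_of_nhds.1.continuousAt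
    have hsmall : ∀ᶠ z in 𝓝 y, Φ z ∈ Metric.ball (0 : E2) ρ :=
      hΦc.eventually (by rw [hΦ]; exact Metric.ball_mem_nhds _ hρ)
    filter_upwards [hev, hsmall] with z h1 h2
    exact ⟨h1.1, by rw [heq _ h2, h1.2]⟩

/-- Inside the box at `y` the flow from `z` is a translate of the flow from `y`, namely `flow z u =
flow y (Φ z + u)`. The radius `ρ / 2` therefore works for all nearby `z`. -/
theorem exists_eventually_flowGood (y : X) : ∃ r > 0, ∀ᶠ z in 𝓝 y, FlowGood hC z r := by
  obtain ⟨Φ, ρ, hρ, hΦ, hgood, hsm, hev⟩ := exists_flow_box hC y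
  refine ⟨ρ / 2, half_pos hρ, ?_⟩
  have hΦc : ContinuousAt Φ y := hev.self_of_nhds.1.continuousAt
  have hsmall : ∀ᶠ z in 𝓝 y, Φ z ∈ Metric.ball (0 : E2) (ρ / 2) :=
    hΦc.eventually (by rw [hΦ]; exact Metric.ball_mem_nhds _ (half_pos hρ))
  filter_upwards [hev, hsmall] with z h1 h2
  have hin : ∀ u ∈ Metric.ball (0 : E2) (ρ / 2), Φ z + u ∈ Metric.ball (0 : E2) ρ := fun u hu ↦ by
    rw [mem_ball_zero_iff] at *
    linarith [norm_add_le (Φ z) u]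
  have hz : Φ z ∈ Metric.ball (0 : E2) ρ := Metric.ball_subset_ball (by linarith) h2
  have heq : ∀ u ∈ Metric.ball (0 : E2) (ρ / 2), flow hC z u = flow hC y (Φ z + u) := fun u hu ↦ by
    have := flow_eq_of_hasMFDerivAt hC hgood hz (hin u hu)
    rwa [h1.2] at this
  intro u hu
  have h3 : HasMFDerivAt 𝓘(ℝ, E2) 𝓘(ℝ, E2) (fun u : E2 ↦ Φ z + u) u (ContinuousLinearMap.id ℝ E2) :=
    ((hasFDerivAt_id u).const_add (Φ z)).hasMFDerivAt
  have h4 := (hgood _ (hin u hu)).comp u h3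
  rw [heq u hu]
  refine (h4.congr_mfderiv ?_).congr_of_eventuallyEq ?_
  · rfl
  · filter_upwards [Metric.isOpen_ball.mem_nhds hu] with u' hu' using heq u' hu'

theorem exists_flowGood_of_isCompact {K : Set X} (hK : IsCompact K) :
    ∃ r > 0, ∀ z ∈ K, FlowGood hC z r := by
  refine hK.induction_on (p := fun S ↦ ∃ r > 0, ∀ z ∈ S, FlowGood hC z r) ⟨1, one_pos, by simp⟩
    (fun s t hst ⟨r, hr, h⟩ ↦ ⟨r, hr, fun z hz ↦ h z (hst hz)⟩) ?_ fun y _ ↦ ?_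
  · rintro s t ⟨r, hr, h⟩ ⟨r', hr', h'⟩
    refine ⟨min r r', lt_min hr hr', ?_⟩
    rintro z (hz | hz) w hw
    · exact h z hz w (Metric.ball_subset_ball (min_le_left _ _) hw)
    · exact h' z hz w (Metric.ball_subset_ball (min_le_right _ _) hw)
  · obtain ⟨r, hr, h⟩ := exists_eventually_flowGood hC y
    exact ⟨_, mem_nhdsWithin_of_mem_nhds h, r, hr, fun z hz ↦ hz⟩

/-- The curve `s ↦ flow (flow x (s v)) (s w)` is an integral curve of the field of `v + w`, since
near each `s₀` everything happens in the box at `flow x (s₀ v)`, where both flows are translations.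
Compactness of the orbit segment over `[-1, 2]` gives a common radius `r`; as `|s₀| ≤ 2`, the bound
`‖w‖ < r / 2` keeps `s₀ w` inside. -/
theorem flow_add_small (x : X) (v : E2) :
    ∃ r > 0, ∀ w ∈ Metric.ball (0 : E2) r, flow hC (flow hC x v) w = flow hC x (v + w) := by
  have hcont : Continuous (fun s : ℝ ↦ flow hC x (s • v)) := (isMIntegralCurve_flow hC x v).continuous
  obtain ⟨r, hr, hgood⟩ := exists_flowGood_of_isCompact hC
    ((isCompact_Icc (a := (-1 : ℝ)) (b := 2)).image hcont)
  refine ⟨r / 2, half_pos hr, fun w hw ↦ ?_⟩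
  rw [mem_ball_zero_iff] at hw
  have key := flow_eq_of_isMIntegralCurveOn hC
    (γ := fun s : ℝ ↦ flow hC (flow hC x (s • v)) (s • w)) (x := x) (v := v + w)
    (a := -1) (b := 2) (by norm_num) (by norm_num) (by simp) ?_
  · simpa using key
  rw [isMIntegralCurveOn_iff_isMIntegralCurveAt isOpen_Ioo]
  intro s₀ hs₀
  have hg : FlowGood hC (flow hC x (s₀ • v)) r := hgood _ ⟨s₀, ⟨hs₀.1.le, hs₀.2.le⟩, rfl⟩
  have hin : ∀ᶠ s : ℝ in 𝓝 s₀, (s - s₀) • v ∈ Metric.ball (0 : E2) r ∧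
      (s - s₀) • v + s • w ∈ Metric.ball (0 : E2) r := by
    have c1 : ContinuousAt (fun s : ℝ ↦ (s - s₀) • v) s₀ := by fun_prop
    have c2 : ContinuousAt (fun s : ℝ ↦ (s - s₀) • v + s • w) s₀ := by fun_prop
    refine (c1.eventually (Metric.isOpen_ball.mem_nhds ?_)).and
      (c2.eventually (Metric.isOpen_ball.mem_nhds ?_))
    · simpa using hr
    · have : |s₀| ≤ 2 := abs_le.2 ⟨by linarith [hs₀.1], hs₀.2.le⟩
      simp only [sub_self, zero_smul, zero_add, mem_ball_zero_iff, norm_smul, Real.norm_eq_abs]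
      nlinarith [norm_nonneg w]
  have hcurve : ∀ᶠ s : ℝ in 𝓝 s₀, flow hC (flow hC x (s • v)) (s • w) =
      flow hC (flow hC x (s₀ • v)) (-s₀ • v + s • (v + w)) := by
    filter_upwards [hin] with s hs
    have e1 : flow hC x (s • v) = flow hC (flow hC x (s₀ • v)) ((s - s₀) • v) := by
      have h1 : IsMIntegralCurve (fun τ : ℝ ↦ flow hC x ((τ + s₀) • v)) (C.field v) :=
        (isMIntegralCurve_flow hC x v).comp_add s₀
      have := integralCurve_eq_flow hC (x := flow hC x (s₀ • v)) (by simp) h1 (s - s₀)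
      simpa using this
    rw [e1, flow_eq_of_hasMFDerivAt hC hg hs.1 hs.2]
    congr 1
    module
  have hin2 : ∀ᶠ s : ℝ in 𝓝 s₀, -s₀ • v + s • (v + w) ∈ Metric.ball (0 : E2) r := by
    filter_upwards [hin] with s hs
    have := hs.2
    convert this using 1
    module
  have hmint : IsMIntegralCurveAt (fun s : ℝ ↦ flow hC (flow hC x (s₀ • v)) (-s₀ • v + s • (v + w)))
      (C.field (v + w)) s₀ := by
    filter_upwards [hin2] with s hs
    exact C.hasMFDerivAt_line (hg _ hs)
  filter_upwards [hmint, hcurve.eventually_nhds] with s h1 h2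
  rw [h2.self_of_nhds]
  exact h1.congr_of_eventuallyEq h2

/-- By additivity for small increments, `flow x` near `v` is the box map at `flow x v` precomposed
with translation by `-v`. So the orbit map is a local diffeomorphism everywhere. -/
theorem flow_local (x : X) (v : E2) : ∃ Φ : X → E2, Φ (flow hC x v) = v ∧
    ContMDiffAt 𝓘(ℝ, E2) IX ∞ (flow hC x) v ∧
    HasMFDerivAt 𝓘(ℝ, E2) IX (flow hC x) v (C.frameMap (flow hC x v)) ∧
    (∀ᶠ w in 𝓝 v, Φ (flow hC x w) = w) ∧
    ∀ᶠ z in 𝓝 (flow hC x v), ContMDiffAt IX 𝓘(ℝ, E2) ∞ Φ z ∧ flow hC x (Φ z) = z := by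
  obtain ⟨r, hr, hadd⟩ := flow_add_small hC x v
  obtain ⟨Φ, ρ, hρ, hΦ, hgood, hsm, hev⟩ := exists_flow_box hC (flow hC x v)
  have heq : ∀ᶠ w in 𝓝 v, flow hC x w = flow hC (flow hC x v) (-v + w) := by
    filter_upwards [Metric.ball_mem_nhds v hr] with w hw
    rw [hadd (-v + w) (by rwa [mem_ball_zero_iff, neg_add_eq_sub, ← dist_eq_norm])]
    congr 1; abel
  have h0 : -v + v = 0 := by abel
  have hsm0 := hsm 0 (Metric.mem_ball_self hρ)
  have hg0 := hgood 0 (Metric.mem_ball_self hρ)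
  rw [← h0] at hsm0 hg0
  refine ⟨fun z ↦ Φ z + v, by simp [hΦ], ?_, ?_, ?_, ?_⟩
  · have hc : ContMDiffAt 𝓘(ℝ, E2) 𝓘(ℝ, E2) ∞ (fun w : E2 ↦ -v + w) v :=
      (contDiff_const.add contDiff_id).contMDiff.contMDiffAt
    exact (ContMDiffAt.comp v (g := flow hC (flow hC x v)) hsm0.1 hc).congr_of_eventuallyEq heq
  · have h3 : HasMFDerivAt 𝓘(ℝ, E2) 𝓘(ℝ, E2) (fun u : E2 ↦ -v + u) v (ContinuousLinearMap.id ℝ E2) :=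
      ((hasFDerivAt_id v).const_add (-v)).hasMFDerivAt
    have h4 := HasMFDerivAt.comp v (g := flow hC (flow hC x v)) hg0 h3
    refine (h4.congr_mfderiv ?_).congr_of_eventuallyEq heq
    rw [h0, flow_zero]
    rfl
  · have hsmall : ∀ᶠ w in 𝓝 v, -v + w ∈ Metric.ball (0 : E2) ρ := by
      filter_upwards [Metric.ball_mem_nhds v hρ] with w hw
      rwa [mem_ball_zero_iff, neg_add_eq_sub, ← dist_eq_norm]
    filter_upwards [heq, hsmall] with w h1 h2
    rw [h1, (hsm _ h2).2]
    abel
  · have hΦc : ContinuousAt Φ (flow hC x v) := hev.self_of_nhds.1.continuousAt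
    have hsmall : ∀ᶠ z in 𝓝 (flow hC x v), Φ z ∈ Metric.ball (0 : E2) r :=
      hΦc.eventually (by rw [hΦ]; exact Metric.ball_mem_nhds _ hr)
    filter_upwards [hev, hsmall] with z h1 h2
    refine ⟨h1.1.add contMDiffAt_const, ?_⟩
    rw [add_comm, ← hadd _ h2, h1.2]

theorem hasMFDerivAt_flow (x : X) (v : E2) :
    HasMFDerivAt 𝓘(ℝ, E2) IX (flow hC x) v (C.frameMap (flow hC x v)) :=
  (flow_local hC x v).choose_spec.2.2.1

theorem contMDiff_flow (x : X) : ContMDiff 𝓘(ℝ, E2) IX ∞ (flow hC x) := fun v ↦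
  (flow_local hC x v).choose_spec.2.1

/-- The flows form an action of `ℝ²`. -/
theorem flow_add (x : X) (v w : E2) : flow hC (flow hC x v) w = flow hC x (v + w) := by
  -- The orbit map now has the frame as its derivative on all of `ℝ²`, so any ball containing `v`
  -- and `v + w` will do.
  refine flow_eq_of_hasMFDerivAt hC (r := ‖v‖ + ‖w‖ + 1) (fun w _ ↦ hasMFDerivAt_flow hC x w) ?_ ?_
  · rw [mem_ball_zero_iff]; linarith [norm_nonneg w]
  · rw [mem_ball_zero_iff]; linarith [norm_add_le v w]

/-- Orbits are open and partition the connected space `X`, so there is only one. -/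
theorem flow_surjective [ConnectedSpace X] (x : X) : Function.Surjective (flow hC x) := by
  rw [← Set.range_eq_univ]
  refine IsClopen.eq_univ ⟨?_, ?_⟩ (Set.range_nonempty _)
  · rw [← isOpen_compl_iff, isOpen_iff_mem_nhds]
    intro y hy
    obtain ⟨Φ, -, -, -, -, hev⟩ := flow_local hC y 0
    rw [flow_zero] at hev
    filter_upwards [hev] with z hz
    rintro ⟨w, hw⟩
    apply hy
    refine ⟨w + -Φ z, ?_⟩
    rw [← flow_add, hw]
    nth_rewrite 1 [← hz.2]
    rw [flow_add, add_neg_cancel, flow_zero]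
  · rw [isOpen_iff_mem_nhds]
    rintro _ ⟨v, rfl⟩
    obtain ⟨Φ, -, -, -, -, hev⟩ := flow_local hC x v
    filter_upwards [hev] with z hz using ⟨_, hz.2⟩

/-- A map on `X` is smooth if its composition with the flow is. -/
theorem contMDiffAt_of_comp_flow {E' H' N : Type*} [NormedAddCommGroup E'] [NormedSpace ℝ E']
    [TopologicalSpace H'] {J : ModelWithCorners ℝ E' H'} [TopologicalSpace N] [ChartedSpace H' N]
    {f : X → N} {x : X} {v : E2}
    (h : ContMDiffAt 𝓘(ℝ, E2) J ∞ (fun w ↦ f (flow hC x w)) v) :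
    ContMDiffAt IX J ∞ f (flow hC x v) := by
  obtain ⟨Φ, h0, -, -, -, hev⟩ := flow_local hC x v
  have h1 : ContMDiffAt IX J ∞ (fun z ↦ f (flow hC x (Φ z))) (flow hC x v) :=
    ContMDiffAt.comp (flow hC x v) (g := fun w ↦ f (flow hC x w)) (f := Φ) (by rwa [h0])
      hev.self_of_nhds.1
  refine h1.congr_of_eventuallyEq ?_
  filter_upwards [hev] with z hz
  rw [hz.2]

end TransFrame

end Translation

/-! ### Completeness of the metric implies completeness of the flows. -/

section Translation

variable {X : Type*} [TopologicalSpace X] [T2Space X] [ChartedSpace E2 X] [IsManifold IX ∞ X]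

/-- The length of a curve of bounded speed bounds the distance of its end points. -/
theorem riemannianEDist_le_of_speed_le (q : SurfaceMetric X) {γ : ℝ → X} {s t K : ℝ} (hst : s ≤ t)
    (hK : 0 ≤ K) (hγ : ∀ τ ∈ Set.Icc s t, ContMDiffAt 𝓘(ℝ, ℝ) IX ∞ γ τ)
    (hs : ∀ τ ∈ Set.Icc s t, q.inner (γ τ) (mfderiv 𝓘(ℝ, ℝ) IX γ τ (1 : ℝ))
      (mfderiv 𝓘(ℝ, ℝ) IX γ τ (1 : ℝ)) ≤ K ^ 2) :
    letI : RiemannianBundle (TangentSpace IX : X → Type _) := ⟨q.toRiemannianMetric⟩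
    riemannianEDist IX (γ s) (γ t) ≤ ENNReal.ofReal (K * (t - s)) := by
  letI : RiemannianBundle (TangentSpace IX : X → Type _) := ⟨q.toRiemannianMetric⟩
  have h1 : riemannianEDist IX (γ s) (γ t) ≤ pathELength IX γ s t :=
    riemannianEDist_le_pathELength
      (fun τ hτ ↦ ((hγ τ hτ).of_le (by simp)).contMDiffWithinAt) rfl rfl hst
  refine h1.trans ?_
  rw [pathELength_eq_lintegral_mfderiv_Icc]
  have h2 : ∀ τ ∈ Set.Icc s t, ‖mfderiv 𝓘(ℝ, ℝ) IX γ τ (1 : ℝ)‖ₑ ≤ ENNReal.ofReal K := by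
    intro τ hτ
    rw [← ofReal_norm_eq_enorm]
    refine ENNReal.ofReal_le_ofReal (abs_le_of_sq_le_sq' ?_ hK).2
    rw [← real_inner_self_eq_norm_sq]
    exact hs τ hτ
  refine (MeasureTheory.setLIntegral_mono' measurableSet_Icc h2).trans ?_
  rw [MeasureTheory.setLIntegral_const, Real.volume_Icc, ENNReal.ofReal_mul hK]

namespace TransFrame

variable (C : TransFrame X)

/-- An integral curve of bounded speed in a complete metric can be continued. -/
theorem exists_extension {q : SurfaceMetric X} (hc : IsCompleteMetric q) {γ : ℝ → X} {v : E2}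
    {a b K : ℝ} (ha : a < 0) (hb : 0 < b) (hγ : IsMIntegralCurveOn γ (C.field v) (Set.Ioo a b))
    (hK : 0 ≤ K)
    (hs : ∀ s ∈ Set.Ioo a b, q.inner (γ s) (C.field v (γ s)) (C.field v (γ s)) ≤ K ^ 2) :
    ∃ b' > b, ∃ γ' : ℝ → X, γ' 0 = γ 0 ∧ IsMIntegralCurveOn γ' (C.field v) (Set.Ioo a b') := by
  -- Times increasing to `b`; the shift by `2` makes all of them positive. Bounded speed makes the
  -- points `γ (τ n)` a Cauchy sequence.
  let τ : ℕ → ℝ := fun n ↦ b - b / (n + 2)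
  have hτ1 : ∀ n, τ n ∈ Set.Ioo 0 b := fun n ↦ by
    have h0 : (0 : ℝ) < n + 2 := by positivity
    have h1 : 0 < b / (n + 2) := by positivity
    have h2 : b / (n + 2) < b := by
      rw [div_lt_iff₀ h0]
      nlinarith [Nat.cast_nonneg (α := ℝ) n]
    exact ⟨by simp only [τ]; linarith, by simp only [τ]; linarith⟩
  have hτ2 : Tendsto τ atTop (𝓝 b) := by
    have h1 : Tendsto (fun n : ℕ ↦ b / ((n : ℝ) + 2)) atTop (𝓝 0) :=
      tendsto_const_nhds.div_atTop (tendsto_atTop_add_const_right _ _ tendsto_natCast_atTop_atTop)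
    simpa [τ] using h1.const_sub b
  have hat : ∀ s ∈ Set.Ioo a b, HasMFDerivAt 𝓘(ℝ, ℝ) IX γ s
      ((1 : ℝ →L[ℝ] ℝ).smulRight (C.field v (γ s))) := fun s hs ↦
    (hγ s hs).hasMFDerivAt (Ioo_mem_nhds hs.1 hs.2)
  have hdist : ∀ s t, s ∈ Set.Ioo 0 b → t ∈ Set.Ioo 0 b →
      letI : RiemannianBundle (TangentSpace IX : X → Type _) := ⟨q.toRiemannianMetric⟩
      riemannianEDist IX (γ s) (γ t) ≤ ENNReal.ofReal (K * |t - s|) := by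
    have key : ∀ s t, s ∈ Set.Ioo 0 b → t ∈ Set.Ioo 0 b → s ≤ t →
        letI : RiemannianBundle (TangentSpace IX : X → Type _) := ⟨q.toRiemannianMetric⟩
        riemannianEDist IX (γ s) (γ t) ≤ ENNReal.ofReal (K * (t - s)) := by
      intro s t hs' ht hst
      have hsub : ∀ r ∈ Set.Icc s t, r ∈ Set.Ioo a b := fun r hr ↦
        ⟨by linarith [hr.1, hs'.1], by linarith [hr.2, ht.2]⟩
      refine riemannianEDist_le_of_speed_le q hst hK
        (fun r hr ↦ C.contMDiffAt_of_isMIntegralCurveAt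
          (hγ.isMIntegralCurveAt (Ioo_mem_nhds (hsub r hr).1 (hsub r hr).2))) fun r hr ↦ ?_
      have e : mfderiv 𝓘(ℝ, ℝ) IX γ r (1 : ℝ) = C.field v (γ r) := by
        rw [(hat r (hsub r hr)).mfderiv]
        exact one_smul ℝ _
      have := hs r (hsub r hr)
      rwa [← e] at this
    intro s t hs' ht
    letI : RiemannianBundle (TangentSpace IX : X → Type _) := ⟨q.toRiemannianMetric⟩
    rcases le_total s t with h | h
    · rw [abs_of_nonneg (sub_nonneg.2 h)]; exact key s t hs' ht h
    · rw [riemannianEDist_comm, abs_sub_comm, abs_of_nonneg (sub_nonneg.2 h)]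
      exact key t s ht hs' h
  obtain ⟨y, hy⟩ := hc (fun n ↦ γ (τ n)) (by
    intro δ hδ
    have hτc : CauchySeq τ := hτ2.cauchySeq
    obtain ⟨r, hr0, hr⟩ : ∃ r : ℝ, 0 < r ∧ ENNReal.ofReal (K * r) < δ := by
      rcases eq_or_ne δ ⊤ with rfl | htop
      · exact ⟨1, one_pos, ENNReal.ofReal_lt_top⟩
      · have hd : 0 < δ.toReal := ENNReal.toReal_pos hδ.ne' htop
        refine ⟨δ.toReal / (K + 1), by positivity, ?_⟩
        rw [ENNReal.ofReal_lt_iff_lt_toReal (by positivity) htop]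
        rw [mul_div_assoc', div_lt_iff₀ (by positivity)]
        nlinarith
    obtain ⟨N, hN⟩ := Metric.cauchySeq_iff.1 hτc r hr0
    refine ⟨N, fun m hm n hn ↦ (hdist _ _ (hτ1 m) (hτ1 n)).trans_lt (lt_of_le_of_lt ?_ hr)⟩
    refine ENNReal.ofReal_le_ofReal (mul_le_mul_of_nonneg_left ?_ hK)
    have := hN n hn m hm
    rw [Real.dist_eq] at this
    exact this.le)
  -- Near the limit point `y` integral curves live for a common time `δ`. Restarting at some `τ n >
  -- b - δ` passes beyond `b`.
  obtain ⟨δ, hδ, hev⟩ := C.exists_integralCurve_uniform y v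
  obtain ⟨n, ⟨η, hη0, hη⟩, hn⟩ := ((hy.eventually hev).and
    (hτ2.eventually (lt_mem_nhds (show b - δ < b by linarith)))).exists
  have hη' : IsMIntegralCurveOn (η ∘ (· + -τ n)) (C.field v) (Set.Ioo (τ n - δ) (τ n + δ)) := by
    have := hη.comp_add (-τ n)
    refine this.mono fun s hs ↦ ?_
    rw [Set.mem_ofPred]
    exact ⟨by linarith [hs.1], by linarith [hs.2]⟩
  have hpc := isMIntegralCurveOn_piecewise (t₀ := τ n) (C.smooth_field_one v) hγ hη'
    ⟨⟨by linarith [(hτ1 n).1], (hτ1 n).2⟩, by linarith, by linarith⟩ (by simp [hη0])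
  refine ⟨τ n + δ, by linarith, _, ?_, hpc.mono ?_⟩
  · rw [Set.piecewise_eq_of_mem _ _ _ (show (0 : ℝ) ∈ Set.Ioo a b from ⟨ha, hb⟩)]
  · intro s hs
    rcases lt_or_ge s b with h | h
    · exact Or.inl ⟨hs.1, h⟩
    · exact Or.inr ⟨by linarith [(hτ1 n).2], hs.2⟩

/-- The metric `q` and the function `F` are those of a hyperbolic surface in horocyclic
coordinates. -/
structure IsHorocyclic (lam : ℝ) (q : SurfaceMetric X) (F : X → ℝ) : Prop where
  smooth : ContMDiff IX 𝓘(ℝ, ℝ) ∞ F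
  deriv : ∀ x (v : TangentSpace IX x), mvfderiv IX F x v = -2 * C.b x v
  metric : ∀ x (v w : TangentSpace IX x), q.inner x v w =
    (C.b x v * C.b x w + Real.exp (F x) * (C.a x v * C.a x w)) / lam ^ 2

variable {C}

theorem IsHorocyclic.hasDerivAt {lam : ℝ} {q : SurfaceMetric X} {F : X → ℝ}
    (h : C.IsHorocyclic lam q F) {γ : ℝ → X} {v : E2} {s : ℝ}
    (hγ : HasMFDerivAt 𝓘(ℝ, ℝ) IX γ s ((1 : ℝ →L[ℝ] ℝ).smulRight (C.field v (γ s)))) :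
    HasDerivAt (fun s ↦ F (γ s)) (-2 * v 1) s := by
  have h1 : HasFDerivAt (fun s ↦ F (γ s)) ((mvfderiv IX F (γ s)).comp
      ((1 : ℝ →L[ℝ] ℝ).smulRight (C.field v (γ s))) : ℝ →L[ℝ] ℝ) s :=
    (((h.smooth (γ s)).mdifferentiableAt (by simp)).hasMFDerivAt.comp s hγ).hasFDerivAt
  have h2 := h1.hasDerivAt
  refine h2.congr_deriv ?_
  change mvfderiv IX F (γ s) ((1 : ℝ) • C.field v (γ s)) = _
  rw [one_smul, h.deriv, C.b_field]

/-- The derivative of `F` along the field of `v` is `-2 b(v)`, the constant `-2 v₁`, so `F` is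
affine along its curves. -/
theorem IsHorocyclic.eq_on_curve {lam : ℝ} {q : SurfaceMetric X} {F : X → ℝ}
    (h : C.IsHorocyclic lam q F) {γ : ℝ → X} {v : E2} {a b : ℝ} (ha : a < 0) (hb : 0 < b)
    (hγ : IsMIntegralCurveOn γ (C.field v) (Set.Ioo a b)) {s : ℝ} (hs : s ∈ Set.Ioo a b) :
    F (γ s) = F (γ 0) - 2 * v 1 * s := by
  have hd : ∀ s ∈ Set.Ioo a b, HasDerivAt (fun s ↦ F (γ s) + 2 * v 1 * s) 0 s := fun s hs ↦ by
    have h1 := h.hasDerivAt ((hγ s hs).hasMFDerivAt (Ioo_mem_nhds hs.1 hs.2))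
    have h2 := h1.add ((hasDerivAt_id s).const_mul (2 * v 1))
    refine h2.congr_deriv (by simp)
  have := isOpen_Ioo.is_const_of_deriv_eq_zero isPreconnected_Ioo
    (fun s hs ↦ (hd s hs).differentiableAt.differentiableWithinAt) (fun s hs ↦ (hd s hs).deriv)
    hs (show (0 : ℝ) ∈ Set.Ioo a b from ⟨ha, hb⟩)
  simp only [mul_zero, add_zero] at this
  linarith

/-- The squared speed is `(v₁² + e^F v₀²) / lam²`, and on a curve over `(a, b)` the function `F` is
at most `F (γ 0) + 2 |v₁| (b - a)`. Hence the speed is bounded and the curve continues. -/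
theorem IsHorocyclic.exists_extension {lam : ℝ} {q : SurfaceMetric X} {F : X → ℝ}
    (h : C.IsHorocyclic lam q F) (hc : IsCompleteMetric q) {γ : ℝ → X} {v : E2}
    {a b : ℝ} (ha : a < 0) (hb : 0 < b) (hγ : IsMIntegralCurveOn γ (C.field v) (Set.Ioo a b)) :
    ∃ b' > b, ∃ γ' : ℝ → X, γ' 0 = γ 0 ∧ IsMIntegralCurveOn γ' (C.field v) (Set.Ioo a b') := by
  have hB : 0 ≤ (v 1 ^ 2 + Real.exp (F (γ 0) + 2 * |v 1| * (b - a)) * v 0 ^ 2) / lam ^ 2 := by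
    positivity
  refine C.exists_extension hc (K := √((v 1 ^ 2 + Real.exp (F (γ 0) + 2 * |v 1| * (b - a)) * v 0 ^ 2)
    / lam ^ 2)) ha hb hγ (Real.sqrt_nonneg _) fun s hs ↦ ?_
  rw [Real.sq_sqrt hB, h.metric, C.a_field, C.b_field, h.eq_on_curve ha hb hγ hs]
  have h1 : -(v 1 * s) ≤ |v 1| * (b - a) := by
    refine (neg_le_abs _).trans ?_
    rw [abs_mul]
    refine mul_le_mul_of_nonneg_left (abs_le.2 ⟨?_, ?_⟩) (abs_nonneg _) <;> linarith [hs.1, hs.2]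
  rw [sq (v 1), sq (v 0)]
  gcongr
  · exact mul_self_nonneg _
  · linarith

/-- If a maximal curve did not exist for all time, the supremum `A` of the symmetric existence times
would be finite. The curve on `(-A, A)` can be continued at both ends, which contradicts the
supremum. -/
theorem IsHorocyclic.complete {lam : ℝ} {q : SurfaceMetric X} {F : X → ℝ}
    (h : C.IsHorocyclic lam q F) (hc : IsCompleteMetric q) : C.Complete := by
  intro x v
  rw [exists_isMIntegralCurve_iff_exists_isMIntegralCurveOn_Ioo (C.smooth_field_one v)]
  by_contra! hno
  obtain ⟨A₁, hA₁⟩ := hno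
  let S : Set ℝ := {a | 0 < a ∧ ∃ γ, γ 0 = x ∧ IsMIntegralCurveOn γ (C.field v) (Set.Ioo (-a) a)}
  have hS0 : S.Nonempty := by
    obtain ⟨δ, hδ, hev⟩ := C.exists_integralCurve_uniform x v
    exact ⟨δ, hδ, hev.self_of_nhds⟩
  have hSb : BddAbove S := by
    refine ⟨A₁, ?_⟩
    rintro a ⟨-, γ, h0, hγ⟩
    by_contra! hlt
    exact hA₁ γ h0 (hγ.mono (Set.Ioo_subset_Ioo (by linarith) hlt.le))
  set A := sSup S with hA
  have hlt : ∀ a < A, ∃ γ, γ 0 = x ∧ IsMIntegralCurveOn γ (C.field v) (Set.Ioo (-a) a) := by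
    intro a ha
    obtain ⟨a', ⟨-, γ, h0, hγ⟩, h1⟩ := exists_lt_of_lt_csSup hS0 ha
    exact ⟨γ, h0, hγ.mono (Set.Ioo_subset_Ioo (by linarith) h1.le)⟩
  have hApos : 0 < A := by
    obtain ⟨a, ha⟩ := hS0
    exact ha.1.trans_le (le_csSup hSb ha)
  haveI : Nonempty X := ⟨x⟩
  choose! G hG0 hG using hlt
  have hcomp : ∀ a a' t, |t| < a → a ≤ a' → a' < A → G a t = G a' t := by
    intro a a' t ht haa ha'
    have hapos := (abs_nonneg t).trans_lt ht
    exact isMIntegralCurveOn_Ioo_eqOn_of_contMDiff_boundaryless (t₀ := 0) ⟨by linarith, hapos⟩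
      (C.smooth_field_one v) (hG a (haa.trans_lt ha'))
      ((hG a' ha').mono (Set.Ioo_subset_Ioo (by linarith) haa))
      (by rw [hG0 a (haa.trans_lt ha'), hG0 a' ha']) (abs_lt.1 ht)
  -- At time `t` the curve of existence time halfway between `|t|` and `A` is used; by uniqueness
  -- the pieces agree.
  let γ : ℝ → X := fun t ↦ G ((|t| + A) / 2) t
  have hγ : IsMIntegralCurveOn γ (C.field v) (Set.Ioo (-A) A) := by
    rw [isMIntegralCurveOn_iff_isMIntegralCurveAt isOpen_Ioo]
    intro t ht
    have htA : |t| < A := abs_lt.2 ht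
    set a := (|t| + A) / 2 with hadef
    have hta : |t| < a := by linarith
    have haA : a < A := by linarith
    have hnhds : Set.Ioo (-a) a ∈ 𝓝 t := Ioo_mem_nhds (abs_lt.1 hta).1 (abs_lt.1 hta).2
    have heq : γ =ᶠ[𝓝 t] G a := ?_
    · filter_upwards [(hG a haA).isMIntegralCurveAt hnhds, heq.eventually_nhds] with s h1 h2
      rw [h2.self_of_nhds]
      exact h1.congr_of_eventuallyEq h2
    filter_upwards [hnhds] with s hs
    have hsa : |s| < a := abs_lt.2 hs
    rcases le_total ((|s| + A) / 2) a with hle | hle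
    · exact hcomp _ _ s (by linarith) hle haA
    · exact (hcomp _ _ s hsa hle (by linarith)).symm
  obtain ⟨b, hb, γ₁, hγ₁0, hγ₁⟩ := h.exists_extension hc (by linarith) hApos hγ
  -- The left end is extended by reversing time, extending to the right along `-v`, and reversing
  -- again.
  have hneg : C.field (-v) = (-1 : ℝ) • C.field v := by
    funext y
    rw [← neg_one_smul ℝ v]
    exact C.field_smul _ _ _
  have hrev : IsMIntegralCurveOn (γ₁ ∘ (· * (-1))) (C.field (-v)) (Set.Ioo (-b) A) := by
    rw [hneg]
    refine (hγ₁.comp_mul (-1)).mono fun s hs ↦ ?_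
    rw [Set.mem_ofPred]
    exact ⟨by linarith [hs.2], by linarith [hs.1]⟩
  obtain ⟨b', hb', γ₂, hγ₂0, hγ₂⟩ := h.exists_extension hc (by linarith) hApos hrev
  have hfin : IsMIntegralCurveOn (γ₂ ∘ (· * (-1))) (C.field v) (Set.Ioo (-b') b) := by
    have e : C.field v = (-1 : ℝ) • C.field (-v) := by rw [hneg, smul_smul]; simp
    rw [e]
    refine (hγ₂.comp_mul (-1)).mono fun s hs ↦ ?_
    rw [Set.mem_ofPred]
    exact ⟨by linarith [hs.2], by linarith [hs.1]⟩
  have hγ0 : γ 0 = x := hG0 _ (by simp only [abs_zero]; linarith)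
  have hmem : min b b' ∈ S := by
    refine ⟨lt_min (by linarith) (by linarith), _, ?_, hfin.mono (Set.Ioo_subset_Ioo ?_ ?_)⟩
    · simp [hγ₂0, hγ₁0, hγ0]
    · linarith [min_le_right b b']
    · exact min_le_left _ _
  have := le_csSup hSb hmem
  linarith [lt_min hb hb']

end TransFrame

end Translation

/-! ### Horocyclic coordinates, half-plane quotients and the topology of `X`. -/

section Translation

variable {X : Type*} [TopologicalSpace X] [ChartedSpace E2 X] [IsManifold IX ∞ X]

theorem SmoothFormAt.const_slice {θ : ℝ → ∀ x : X, TangentSpace IX x →L[ℝ] ℝ} {t : ℝ}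
    (hθ : ∀ x, SmoothFormAt θ (t, x)) (p : ℝ × X) : SmoothFormAt (fun _ ↦ θ t) p := by
  have h : ContMDiffAt JX JX ∞ (fun p : ℝ × X ↦ (t, p.2)) p := contMDiffAt_const.prodMk contMDiffAt_snd
  exact ContMDiffAt.comp p (show ContMDiffAt JX (IX.prod 𝓘(ℝ, E2 →L[ℝ] ℝ)) ∞
    (fun p : ℝ × X ↦ (TotalSpace.mk' (E2 →L[ℝ] ℝ) p.2 (θ p.1 p.2) :
      TotalSpace (E2 →L[ℝ] ℝ) (fun x : X ↦ TangentSpace IX x →L[ℝ] ℝ))) (t, p.2) from hθ p.2) h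

/-- The closed coframe `(lam om, -d_X F / 2)` of a Kundt surface. -/
theorem IsKundtData.exists_transFrame {lam : ℝ} (hlam : lam ≠ 0) {o : SurfaceOrientation X}
    {g : LorentzMetric IM (ℝ × ℝ × X)} {H F : ℝ → X → ℝ} {q : ℝ → SurfaceMetric X}
    {om β : ℝ → ∀ x : X, TangentSpace IX x →L[ℝ] ℝ} (h : IsKundtData lam o g H F q om β) (t : ℝ) :
    ∃ C : TransFrame X, C.IsHorocyclic lam (q t) (F t) := by
  have hd : ∀ x : X, ∃ e₁ e₂ : TangentSpace IX x, lam * om t x e₁ = 1 ∧ lam * om t x e₂ = 0 ∧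
      -1 / 2 * dX F t x e₁ = 0 ∧ -1 / 2 * dX F t x e₂ = 1 ∧
      ∀ v, v = (lam * om t x v) • e₁ + (-1 / 2 * dX F t x v) • e₂ := by
    intro x
    have := exists_dual_pair (finrank_tangentSpace x)
      (l := ((lam • om t x : TangentSpace IX x →L[ℝ] ℝ)).toLinearMap)
      (n := (((-1 / 2 : ℝ) • dX F t x : TangentSpace IX x →L[ℝ] ℝ)).toLinearMap) (fun v hl hn ↦ by
        have hl' : lam * om t x v = 0 := hl
        have hn' : -1 / 2 * dX F t x v = 0 := hn
        have h1 : om t x v = 0 := (mul_eq_zero.1 hl').resolve_left hlam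
        have h2 : dX F t x v = 0 := by linarith
        refine inner_self_eq_zero' (q t) ?_
        rw [h.metric_X, h1, h2]; ring)
    obtain ⟨e₁, e₂, h1, h2, h3, h4, h5⟩ := this
    exact ⟨e₁, e₂, h1, h3, h2, h4, h5⟩
  choose P Q h1 h2 h3 h4 h5 using hd
  have sa : ∀ p, SmoothFormAt (fun (_ : ℝ) x ↦ lam • om t x) p := fun p ↦
    SmoothFormAt.smul (f := fun _ _ ↦ lam) contMDiffAt_const
      (SmoothFormAt.const_slice (fun x ↦ h.smooth_om (t, x)) p)
  have sb : ∀ p, SmoothFormAt (fun (_ : ℝ) x ↦ (-1 / 2 : ℝ) • dX F t x) p := fun p ↦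
    SmoothFormAt.smul (f := fun _ _ ↦ (-1 / 2 : ℝ)) contMDiffAt_const
      (SmoothFormAt.const_slice (fun x ↦ smoothFormAt_dX h.smooth_F (t, x)) p)
  have hconst : ∀ (c : ℝ) (θ : ∀ x : X, TangentSpace IX x →L[ℝ] ℝ) (x : X),
      FormDiffAt IX θ x → IsExtDerivAt IX θ x (fun _ _ ↦ 0) →
      IsExtDerivAt IX (fun y ↦ c • θ y) x fun _ _ ↦ 0 := by
    intro c θ x hθ hc
    refine (IsExtDerivAt.smul (f := fun _ ↦ c) mdifferentiableAt_const hθ hc).congr_right fun v w ↦ ?_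
    rw [mvfderiv_const]
    simp
  let C : TransFrame X :=
    { P := P
      Q := Q
      a := fun x ↦ lam • om t x
      b := fun x ↦ (-1 / 2 : ℝ) • dX F t x
      smooth_a := sa
      smooth_b := sb
      closed_a := fun x ↦ hconst _ _ _ (SmoothFormAt.formDiffAt (h.smooth_om (t, x)))
        (isExtDeriv_iff.1 (h.closed_om t) x)
      closed_b := fun x ↦ hconst _ _ _ (formDiffAt_mvfderiv
          (((h.smooth_F.slice t).of_le two_le_infty).contMDiffAt))
        (isExtDerivAt_mvfderiv (((h.smooth_F.slice t).of_le two_le_infty).contMDiffAt))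
      a_P := h1
      a_Q := h2
      b_P := h3
      b_Q := h4
      expand := h5 }
  refine ⟨C, h.smooth_F.slice t, fun x v ↦ ?_, fun x v w ↦ ?_⟩
  · change mvfderiv IX (F t) x v = -2 * (-1 / 2 * mvfderiv IX (F t) x v)
    ring
  · rw [h.metric_X]
    change _ = (-1 / 2 * dX F t x v * (-1 / 2 * dX F t x w)
      + Real.exp (F t x) * (lam * om t x v * (lam * om t x w))) / lam ^ 2
    field_simp
    ring

variable [T2Space X]

/-- The vector with coordinates `a` and `b`. -/
def vec (a b : ℝ) : E2 := !₂[a, b]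

@[simp] theorem vec_zero (a b : ℝ) : vec a b 0 = a := rfl

@[simp] theorem vec_one (a b : ℝ) : vec a b 1 = b := rfl

theorem vec_ext {v w : E2} (h0 : v 0 = w 0) (h1 : v 1 = w 1) : v = w := by
  ext i; fin_cases i <;> assumption

theorem vec_eq (a b : ℝ) :
    vec a b = a • EuclideanSpace.single 0 (1 : ℝ) + b • EuclideanSpace.single 1 (1 : ℝ) := by
  apply vec_ext <;> simp

theorem contDiffAt_vec {E' : Type*} [NormedAddCommGroup E'] [NormedSpace ℝ E'] {f g : E' → ℝ} {x : E'}
    (hf : ContDiffAt ℝ ∞ f x) (hg : ContDiffAt ℝ ∞ g x) :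
    ContDiffAt ℝ ∞ (fun y ↦ vec (f y) (g y)) x := by
  simp_rw [vec_eq]
  exact (hf.smul contDiffAt_const).add (hg.smul contDiffAt_const)

namespace TransFrame

variable {C : TransFrame X} (hC : C.Complete)

theorem IsHorocyclic.apply_flow {lam : ℝ} {q : SurfaceMetric X} {F : X → ℝ}
    (h : C.IsHorocyclic lam q F) (p : X) (v : E2) : F (flow hC p v) = F p - 2 * v 1 := by
  have := h.eq_on_curve (a := -2) (b := 2) (s := 1) (by norm_num) (by norm_num)
    ((isMIntegralCurve_flow hC p v).isMIntegralCurveOn _) ⟨by norm_num, by norm_num⟩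
  simpa using this

/-- The periods of the flow in the direction of `P`. -/
def periods (p : X) : AddSubgroup ℝ where
  carrier := {a | flow hC p (vec a 0) = p}
  add_mem' := by
    intro a b (ha : _ = p) (hb : _ = p)
    change flow hC p (vec (a + b) 0) = p
    have e : vec (a + b) 0 = vec a 0 + vec b 0 := vec_ext (by simp) (by simp)
    rw [e, ← flow_add, ha, hb]
  zero_mem' := by
    have e : vec 0 0 = 0 := vec_ext (by simp) (by simp)
    change flow hC p (vec 0 0) = p
    rw [e, flow_zero]
  neg_mem' := by
    intro a (ha : _ = p)
    change flow hC p (vec (-a) 0) = p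
    have e : vec a 0 + vec (-a) 0 = 0 := vec_ext (by simp) (by simp)
    have := flow_add hC p (vec a 0) (vec (-a) 0)
    rwa [ha, e, flow_zero] at this

/-- Since `F (flow p v) = F p - 2 v₁`, the point determines `v₁`; the remaining ambiguity is a
period in the direction of `P`. -/
theorem IsHorocyclic.flow_eq_flow_iff {lam : ℝ} {q : SurfaceMetric X} {F : X → ℝ}
    (h : C.IsHorocyclic lam q F) {p : X} {v w : E2} :
    flow hC p v = flow hC p w ↔ v 1 = w 1 ∧ v 0 - w 0 ∈ periods hC p := by
  constructor
  · intro hvw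
    have h1 : v 1 = w 1 := by
      have := congrArg F hvw
      rw [h.apply_flow, h.apply_flow] at this
      linarith
    refine ⟨h1, ?_⟩
    change flow hC p (vec (v 0 - w 0) 0) = p
    have e : vec (v 0 - w 0) 0 = v + -w := vec_ext (by simp [sub_eq_add_neg]) (by simp [h1])
    rw [e, ← flow_add, hvw, flow_add, add_neg_cancel, flow_zero]
  · rintro ⟨h1, h2 : flow hC p (vec (v 0 - w 0) 0) = p⟩
    have e : v = vec (v 0 - w 0) 0 + w := vec_ext (by simp) (by simp [h1])
    rw [e, ← flow_add, h2]

/-- A subgroup of `ℝ` is dense or cyclic, and density is impossible because the orbit map is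
injective near `0`. -/
theorem exists_periods_eq (p : X) : ∃ c : ℝ, 0 ≤ c ∧ ∀ a, a ∈ periods hC p ↔ ∃ n : ℤ, a = n * c := by
  rcases AddSubgroup.dense_or_cyclic (periods hC p) with hd | ⟨c, hc⟩
  · exfalso
    obtain ⟨Φ, h0, -, -, hev, -⟩ := flow_local hC p 0
    have hcont : Tendsto (fun a : ℝ ↦ vec a 0) (𝓝 0) (𝓝 0) := by
      have : ContDiffAt ℝ ∞ (fun a : ℝ ↦ vec a 0) 0 := contDiffAt_vec contDiffAt_id contDiffAt_const
      have h := this.continuousAt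
      rwa [ContinuousAt, show vec 0 0 = 0 from vec_ext (by simp) (by simp)] at h
    obtain ⟨δ, hδ, hball⟩ := Metric.eventually_nhds_iff.1 (hcont.eventually hev)
    obtain ⟨a, ha, ha0, haδ⟩ := hd.exists_between hδ
    have h1 := hball (y := a) (by rw [Real.dist_eq, sub_zero, abs_of_pos ha0]; exact haδ)
    have ha' : flow hC p (vec a 0) = p := ha
    rw [ha'] at h1
    rw [flow_zero] at h0
    have h2 := congrArg (fun v : E2 ↦ v 0) (h1.symm.trans h0)
    simp at h2
    linarith
  · refine ⟨|c|, abs_nonneg c, fun a ↦ ?_⟩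
    rw [hc, ← AddSubgroup.zmultiples_eq_closure, AddSubgroup.mem_zmultiples_iff]
    simp only [zsmul_eq_mul]
    rcases abs_choice c with h | h <;> rw [h]
    · exact ⟨fun ⟨n, hn⟩ ↦ ⟨n, hn.symm⟩, fun ⟨n, hn⟩ ↦ ⟨n, hn.symm⟩⟩
    · exact ⟨fun ⟨n, hn⟩ ↦ ⟨-n, by rw [← hn]; push_cast; ring⟩,
        fun ⟨n, hn⟩ ↦ ⟨-n, by rw [hn]; push_cast; ring⟩⟩

/-- The projection is the orbit map after `G (x, y) = (κ x, log y + c₀)`. The scale `κ` is free, so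
that a period can be normalized to `1`. -/
theorem IsHorocyclic.isHalfPlaneQuotient [ConnectedSpace X] {lam : ℝ} {q : SurfaceMetric X}
    {F : X → ℝ} (h : C.IsHorocyclic lam q F) (p : X) {κ : ℝ} (hκ : 0 < κ) {r : E2 → E2 → Prop}
    (hr : ∀ z w : E2, (z 1 = w 1 ∧ κ * z 0 - κ * w 0 ∈ periods hC p) ↔ r z w) :
    IsHalfPlaneQuotient lam q r := by
  -- This constant makes `e^F = 1 / (κ y)²` at `flow p (G z)`, so that `e^F a² + b²` pulls back to
  -- `(dx² + dy²) / y²`.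
  let c₀ : ℝ := F p / 2 + Real.log κ
  let G : E2 → E2 := fun z ↦ vec (κ * z 0) (Real.log (z 1) + c₀)
  have hproj : ∀ i : Fin 2, ContDiff ℝ ∞ (fun z : E2 ↦ z i) := fun i ↦
    (EuclideanSpace.proj i : E2 →L[ℝ] ℝ).contDiff
  have hG : ∀ z ∈ halfPlane, ContDiffAt ℝ ∞ G z := fun z hz ↦
    contDiffAt_vec (contDiffAt_const.mul (hproj 0).contDiffAt)
      (((hproj 1).contDiffAt.log (ne_of_gt hz)).add contDiffAt_const)
  have hG' : ∀ z ∈ halfPlane, ∀ v : E2, fderiv ℝ G z v = vec (κ * v 0) (v 1 / z 1) := by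
    intro z hz v
    have hz1 : z 1 ≠ 0 := ne_of_gt hz
    have d0 : HasFDerivAt (fun z : E2 ↦ z 0) (EuclideanSpace.proj 0 : E2 →L[ℝ] ℝ) z :=
      (EuclideanSpace.proj 0 : E2 →L[ℝ] ℝ).hasFDerivAt
    have d1 : HasFDerivAt (fun z : E2 ↦ z 1) (EuclideanSpace.proj 1 : E2 →L[ℝ] ℝ) z :=
      (EuclideanSpace.proj 1 : E2 →L[ℝ] ℝ).hasFDerivAt
    have hGeq : G = fun z : E2 ↦ (κ * z 0) • (EuclideanSpace.single 0 (1 : ℝ) : E2)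
        + (Real.log (z 1) + c₀) • (EuclideanSpace.single 1 (1 : ℝ) : E2) := by
      funext z; exact vec_eq _ _
    have hd : HasFDerivAt G ((κ • (EuclideanSpace.proj 0 : E2 →L[ℝ] ℝ)).smulRight
        (EuclideanSpace.single 0 (1 : ℝ) : E2) + ((z 1)⁻¹ • (EuclideanSpace.proj 1 : E2 →L[ℝ] ℝ)).smulRight
        (EuclideanSpace.single 1 (1 : ℝ) : E2)) z := by
      rw [hGeq]
      exact ((d0.const_mul κ).smul_const _).add (((d1.log hz1).add_const c₀).smul_const _)
    rw [hd.fderiv]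
    apply vec_ext <;> simp [div_eq_inv_mul]
  have hmf : ∀ z ∈ halfPlane, ∀ v : E2, mfderiv 𝓘(ℝ, E2) IX (fun z ↦ flow hC p (G z)) z v
      = C.field (vec (κ * v 0) (v 1 / z 1)) (flow hC p (G z)) := by
    intro z hz v
    have h1 : HasMFDerivAt 𝓘(ℝ, E2) 𝓘(ℝ, E2) G z (fderiv ℝ G z) :=
      ((hG z hz).differentiableAt (by simp)).hasFDerivAt.hasMFDerivAt
    have h2 := HasMFDerivAt.comp z (g := flow hC p) (hasMFDerivAt_flow hC p (G z)) h1
    have h3 : mfderiv 𝓘(ℝ, E2) IX (fun z ↦ flow hC p (G z)) z = _ := h2.mfderiv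
    rw [h3]
    change C.frameMap (flow hC p (G z)) (fderiv ℝ G z v) = _
    rw [hG' z hz, frameMap_apply]
  refine ⟨fun z ↦ flow hC p (G z), fun z hz ↦ ?_, ?_, fun z hz v w ↦ ?_, fun z hz w hw ↦ ?_⟩
  · have h1 : ContMDiffAt 𝓘(ℝ, E2) IX ∞ (fun z ↦ flow hC p (G z)) z :=
      ContMDiffAt.comp z (g := flow hC p) (contMDiff_flow hC p _) (hG z hz).contMDiffAt
    exact h1.contMDiffWithinAt
  · rw [Set.eq_univ_iff_forall]
    intro x
    obtain ⟨w, rfl⟩ := flow_surjective hC p x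
    refine ⟨vec (w 0 / κ) (Real.exp (w 1 - c₀)), Real.exp_pos _, ?_⟩
    have e : G (vec (w 0 / κ) (Real.exp (w 1 - c₀))) = w := by
      apply vec_ext
      · simp only [G, vec_zero]; field_simp
      · simp [G]
    simp only [e]
  · have hz1 : 0 < z 1 := hz
    rw [hmf z hz, hmf z hz, h.metric]
    simp only [C.a_field, C.b_field, vec_zero, vec_one]
    have e : Real.exp (F (flow hC p (G z))) = 1 / (z 1 ^ 2 * κ ^ 2) := by
      rw [h.apply_flow]
      have e1 : F p - 2 * G z 1 = -(2 * Real.log (z 1) + 2 * Real.log κ) := by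
        simp only [G, vec_one, c₀]; ring
      rw [e1, Real.exp_neg, Real.exp_add, two_mul, two_mul, Real.exp_add, Real.exp_add,
        Real.exp_log hz1, Real.exp_log hκ, one_div]
      ring
    have ei : inner ℝ v w = v 0 * w 0 + v 1 * w 1 := by
      simp [PiLp.inner_apply, Fin.sum_univ_two, mul_comm]
    rw [e, ei]
    field_simp
    ring
  · rw [h.flow_eq_flow_iff, ← hr]
    simp only [G, vec_zero, vec_one, add_left_inj]
    exact and_congr_left' ⟨fun h ↦ Real.log_injOn_pos (show z 1 ∈ Set.Ioi 0 from hz)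
      (show w 1 ∈ Set.Ioi 0 from hw) h, fun h ↦ by rw [h]⟩

/-- Without periods the orbit map is injective and gives the half-plane. With smallest period `c >
0`, the choice `κ = c` turns it into translation by `1`, the parabolic cylinder. -/
theorem IsHorocyclic.isElementaryHyperbolic [ConnectedSpace X] {lam : ℝ} {q : SurfaceMetric X}
    {F : X → ℝ} (h : C.IsHorocyclic lam q F) (hC : C.Complete) : IsElementaryHyperbolic lam q := by
  obtain ⟨p⟩ : Nonempty X := inferInstance
  obtain ⟨c, hc0, hc⟩ := exists_periods_eq hC p
  rcases hc0.eq_or_lt with rfl | hpos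
  · refine Or.inl (h.isHalfPlaneQuotient hC p one_pos fun z w ↦ ?_)
    rw [hc]
    constructor
    · rintro ⟨h1, n, hn⟩
      exact vec_ext (by linarith) h1.symm
    · rintro rfl
      exact ⟨rfl, 0, by simp⟩
  · refine Or.inr (Or.inr (h.isHalfPlaneQuotient hC p hpos fun z w ↦ ?_))
    rw [hc]
    constructor
    · rintro ⟨h1, n, hn⟩
      refine ⟨-n, vec_ext ?_ ?_⟩
      · have : c * (w 0 - (z 0 - n)) = 0 := by linarith
        have := (mul_eq_zero.1 this).resolve_left hpos.ne'
        simp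
        linarith
      · simp [h1]
    · rintro ⟨n, rfl⟩
      refine ⟨by simp, -n, by simp; ring⟩

/-- The flow in the absence of periods as a diffeomorphism. -/
theorem IsHorocyclic.nonempty_diffeomorph_plane [ConnectedSpace X] {lam : ℝ} {q : SurfaceMetric X}
    {F : X → ℝ} (h : C.IsHorocyclic lam q F) {p : X} (hp : ∀ a, a ∈ periods hC p ↔ a = 0) :
    Nonempty (X ≃ₘ^∞⟮IX, 𝓘(ℝ, E2)⟯ E2) := by
  have hinj : Function.Injective (flow hC p) := fun v w hvw ↦ by
    obtain ⟨h1, h2⟩ := (h.flow_eq_flow_iff hC).1 hvw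
    rw [hp] at h2
    exact vec_ext (by linarith) h1
  let e : E2 ≃ X := Equiv.ofBijective (flow hC p) ⟨hinj, flow_surjective hC p⟩
  have he : ∀ w, e w = flow hC p w := fun w ↦ rfl
  refine ⟨⟨e.symm, fun x ↦ ?_, contMDiff_flow hC p⟩⟩
  obtain ⟨w, rfl⟩ := e.surjective x
  rw [he]
  refine contMDiffAt_of_comp_flow hC ?_
  have : (fun w ↦ e.symm (flow hC p w)) = id := by
    funext w; exact e.symm_apply_apply w
  rw [this]
  exact contMDiffAt_id

/-- The argument, relative to a given point, is smooth near that point. -/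
theorem contMDiffAt_arg_div (z₀ : Circle) :
    ContMDiffAt (𝓡 1) 𝓘(ℝ, ℝ) ∞ (fun z : Circle ↦ Complex.arg ((z / z₀ : Circle) : ℂ)) z₀ := by
  haveI : Fact (Module.finrank ℝ ℂ = 1 + 1) := finrank_real_complex_fact'
  have h1 : ContMDiffAt (𝓡 1) 𝓘(ℝ, ℂ) ∞ (fun z : Circle ↦ (z : ℂ)) z₀ :=
    (contMDiff_coe_sphere (E := ℂ) (n := 1)).contMDiffAt
  -- Division by `z₀` moves the point to `1`, away from the branch cut of the logarithm.
  have h2 : ContDiffAt ℝ ∞ (fun w : ℂ ↦ (Complex.log (w / z₀)).im) (z₀ : ℂ) := by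
    have hz : (z₀ : ℂ) / z₀ = 1 := div_self (Circle.coe_ne_zero z₀)
    have h3 : ContDiffAt ℝ ∞ Complex.log ((z₀ : ℂ) / z₀) :=
      (Complex.contDiffAt_log (by rw [hz]; exact Complex.one_mem_slitPlane)).restrict_scalars ℝ
    have h4 : ContDiffAt ℝ ∞ (fun w : ℂ ↦ w / z₀) (z₀ : ℂ) := contDiffAt_id.div_const _
    have h5 : ContDiffAt ℝ ∞ (fun w : ℂ ↦ Complex.log (w / z₀)) (z₀ : ℂ) :=
      ContDiffAt.comp (z₀ : ℂ) (g := Complex.log) h3 h4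
    exact Complex.imCLM.contDiff.contDiffAt.comp _ h5
  have h6 := ContMDiffAt.comp z₀ (g := fun w : ℂ ↦ (Complex.log (w / z₀)).im)
    h2.contMDiffAt h1
  refine h6.congr_of_eventuallyEq (Eventually.of_forall fun z ↦ ?_)
  simp only [Circle.coe_div]
  exact (Complex.log_im _).symm

/-- The flow with a period as a diffeomorphism. -/
theorem IsHorocyclic.nonempty_diffeomorph_cylinder [ConnectedSpace X] {lam : ℝ} {q : SurfaceMetric X}
    {F : X → ℝ} (h : C.IsHorocyclic lam q F) {p : X} {c : ℝ} (hpos : 0 < c)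
    (hc : ∀ a, a ∈ periods hC p ↔ ∃ n : ℤ, a = n * c) :
    Nonempty (X ≃ₘ^∞⟮IX, 𝓘(ℝ, ℝ).prod (𝓡 1)⟯ (ℝ × Circle)) := by
  have hpi := Real.pi_pos
  -- This map and the orbit map have the same fibres, so each factors through the other.
  let G : E2 → ℝ × Circle := fun w ↦ (w 1, Circle.exp (2 * Real.pi / c * w 0))
  have hproj : ∀ i : Fin 2, ContDiff ℝ ∞ (fun z : E2 ↦ z i) := fun i ↦
    (EuclideanSpace.proj i : E2 →L[ℝ] ℝ).contDiff
  have hGs : ContMDiff 𝓘(ℝ, E2) (𝓘(ℝ, ℝ).prod (𝓡 1)) ∞ G :=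
    (hproj 1).contMDiff.prodMk (contMDiff_circleExp.comp
      (contDiff_const.mul (hproj 0)).contMDiff)
  have hGeq : ∀ v w, G v = G w ↔ flow hC p v = flow hC p w := by
    intro v w
    rw [h.flow_eq_flow_iff, hc, Prod.mk.injEq, Circle.exp_eq_exp]
    refine and_congr_right' (exists_congr fun n ↦ ?_)
    have hc' := hpos.ne'
    constructor
    · intro hn
      field_simp at hn
      linarith
    · intro hn
      have : v 0 = w 0 + n * c := by linarith
      rw [this]
      field_simp
  let Ginv : ℝ × Circle → E2 := fun y ↦ vec (c / (2 * Real.pi) * Complex.arg (y.2 : ℂ)) y.1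
  have hGinv : ∀ (b θ : ℝ) (z : Circle), Circle.exp θ = z →
      G (vec (c / (2 * Real.pi) * θ) b) = (b, z) := by
    intro b θ z hz
    simp only [G, vec_zero, vec_one, Prod.mk.injEq, true_and]
    rw [← hz]
    congr 1
    field_simp
  let sec := Function.surjInv (flow_surjective hC p)
  have hsec : ∀ x, flow hC p (sec x) = x := Function.surjInv_eq _
  let f : X → ℝ × Circle := fun x ↦ G (sec x)
  have hf : ∀ w, f (flow hC p w) = G w := fun w ↦ (hGeq _ _).2 (hsec _)
  let k : ℝ × Circle → X := fun y ↦ flow hC p (Ginv y)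
  have hk : ∀ y w, G w = y → k y = flow hC p w := by
    intro y w hw
    refine (hGeq _ _).1 ?_
    rw [hw]
    exact hGinv _ _ _ (Circle.exp_arg _)
  refine ⟨⟨⟨f, k, fun x ↦ ?_, fun y ↦ ?_⟩, fun x ↦ ?_, fun y ↦ ?_⟩⟩
  · exact (hk _ _ rfl).trans (hsec x)
  · exact (hf _).trans (hGinv _ _ _ (Circle.exp_arg _))
  · obtain ⟨w, rfl⟩ := flow_surjective hC p x
    refine contMDiffAt_of_comp_flow hC (hGs.contMDiffAt.congr_of_eventuallyEq ?_)
    exact Eventually.of_forall hf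
  · obtain ⟨b₀, z₀⟩ := y
    -- A local section of `G`, smooth at the given point, with the argument measured from `z₀`. It
    -- need not agree with `Ginv`, but the two differ by periods, so their compositions with the
    -- flow agree.
    let S : ℝ × Circle → E2 := fun y ↦
      vec (c / (2 * Real.pi) * (Complex.arg (z₀ : ℂ) + Complex.arg ((y.2 / z₀ : Circle) : ℂ))) y.1
    have hS : ContMDiffAt (𝓘(ℝ, ℝ).prod (𝓡 1)) 𝓘(ℝ, E2) ∞ S (b₀, z₀) := by
      have h1 : ContMDiffAt (𝓘(ℝ, ℝ).prod (𝓡 1)) 𝓘(ℝ, ℝ) ∞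
          (fun y : ℝ × Circle ↦ Complex.arg ((y.2 / z₀ : Circle) : ℂ)) (b₀, z₀) :=
        ContMDiffAt.comp (b₀, z₀) (g := fun z : Circle ↦ Complex.arg ((z / z₀ : Circle) : ℂ))
          (contMDiffAt_arg_div z₀) contMDiffAt_snd
      have h2 : ContMDiffAt (𝓘(ℝ, ℝ).prod (𝓡 1)) 𝓘(ℝ, ℝ × ℝ) ∞
          (fun y : ℝ × Circle ↦ (Complex.arg ((y.2 / z₀ : Circle) : ℂ), y.1)) (b₀, z₀) :=
        h1.prodMk_space contMDiffAt_fst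
      have h3 : ContDiff ℝ ∞ (fun s : ℝ × ℝ ↦
          vec (c / (2 * Real.pi) * (Complex.arg (z₀ : ℂ) + s.1)) s.2) :=
        contDiff_iff_contDiffAt.2 fun s ↦ contDiffAt_vec
          (contDiffAt_const.mul (contDiffAt_const.add contDiffAt_fst)) contDiffAt_snd
      exact ContMDiffAt.comp (b₀, z₀) (g := fun s : ℝ × ℝ ↦
          vec (c / (2 * Real.pi) * (Complex.arg (z₀ : ℂ) + s.1)) s.2) h3.contMDiff.contMDiffAt h2
    have h4 : ContMDiffAt (𝓘(ℝ, ℝ).prod (𝓡 1)) IX ∞ (fun y ↦ flow hC p (S y)) (b₀, z₀) :=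
      ContMDiffAt.comp (b₀, z₀) (g := flow hC p) (contMDiff_flow hC p).contMDiffAt hS
    refine h4.congr_of_eventuallyEq (Eventually.of_forall fun y ↦ hk y _ ?_)
    refine hGinv _ _ _ ?_
    rw [Circle.exp_add, Circle.exp_arg, Circle.exp_arg, mul_div_cancel]

theorem IsHorocyclic.diffeomorph [ConnectedSpace X] {lam : ℝ} {q : SurfaceMetric X}
    {F : X → ℝ} (h : C.IsHorocyclic lam q F) (hC : C.Complete) :
    Nonempty (X ≃ₘ^∞⟮IX, 𝓘(ℝ, E2)⟯ E2) ∨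
      Nonempty (X ≃ₘ^∞⟮IX, 𝓘(ℝ, ℝ).prod (𝓡 1)⟯ (ℝ × Circle)) := by
  obtain ⟨p⟩ : Nonempty X := inferInstance
  obtain ⟨c, hc0, hc⟩ := exists_periods_eq hC p
  rcases hc0.eq_or_lt with rfl | hpos
  · exact Or.inl (h.nonempty_diffeomorph_plane hC fun a ↦ by rw [hc]; simp)
  · exact Or.inr (h.nonempty_diffeomorph_cylinder hC hpos hc)

end TransFrame

end Translation

/-! ### Curvature of a surface from its connection form. -/

section Curvature

variable {X : Type*} [TopologicalSpace X] [ChartedSpace E2 X] [IsManifold IX ∞ X]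

/-- The connection forms of a metric connection in an orthonormal frame of a surface. -/
def skewForms (κ : ∀ x : X, TangentSpace IX x →L[ℝ] ℝ) (i j : Fin 2) (x : X) :
    TangentSpace IX x →L[ℝ] ℝ :=
  -- On `Fin 2` the factor is `0`, `1` or `-1`; the matrix has rows `(0, -κ)` and `(κ, 0)`.
  ((j : ℝ) - i) • -κ x

/-- The curvature of a metric connection on a surface. -/
theorem GlobalFrame.ε_curvature (C : GlobalFrame IX X (Fin 2))
    {κ : ∀ x : X, TangentSpace IX x →L[ℝ] ℝ} {x : X}
    {Ω : TangentSpace IX x → TangentSpace IX x → ℝ} (hκ : FormDiffAt IX κ x)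
    (hΩ : IsExtDerivAt IX κ x Ω) {V W Z : ∀ y : X, TangentSpace IX y}
    (hV : MDifferentiableAt IX IX.tangent (fun y ↦ (V y : TangentBundle IX X)) x)
    (hW : MDifferentiableAt IX IX.tangent (fun y ↦ (W y : TangentBundle IX X)) x)
    (hZ : ∀ i, ContMDiffAt IX 𝓘(ℝ, ℝ) 2 (fun y ↦ C.ε i y (Z y)) x) (i j : Fin 2) (hij : i ≠ j) :
    C.ε i x (curvature IX (C.cov (skewForms κ)) V W Z x) =
      ((i : ℝ) - j) * (Ω (V x) (W x) * C.ε j x (Z x)) := by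
  have hcov : ∀ (i j : Fin 2) (U : ∀ y : X, TangentSpace IX y) y (v : TangentSpace IX y), i ≠ j →
      C.ε i y (C.cov (skewForms κ) U y v) = mvfderiv IX (fun y ↦ C.ε i y (U y)) y v
        + ((i : ℝ) - j) * (κ y v * C.ε j y (U y)) := by
    intro i j U y v hij
    rw [C.ε_cov]
    simp only [skewForms, Fin.sum_univ_two, _root_.smul_apply, _root_.neg_apply, smul_eq_mul]
    fin_cases i <;> fin_cases j <;> simp at hij ⊢
  -- In the second covariant derivative the term quadratic in `κ` is symmetric in `A` and `B`. It
  -- drops out of the curvature, which is then given by `dκ` alone.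
  have key : ∀ (i j : Fin 2) (A B : ∀ y : X, TangentSpace IX y),
      MDifferentiableAt IX IX.tangent (fun y ↦ (A y : TangentBundle IX X)) x → i ≠ j →
      C.ε i x (C.cov (skewForms κ) (fun y ↦ C.cov (skewForms κ) Z y (A y)) x (B x)) =
        mvfderiv IX (fun y ↦ mvfderiv IX (fun y ↦ C.ε i y (Z y)) y (A y)) x (B x)
        + ((i : ℝ) - j) * (κ x (A x) * mvfderiv IX (fun y ↦ C.ε j y (Z y)) x (B x)
            + C.ε j x (Z x) * mvfderiv IX (fun y ↦ κ y (A y)) x (B x))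
        + ((i : ℝ) - j) * (κ x (B x) * (mvfderiv IX (fun y ↦ C.ε j y (Z y)) x (A x)
            + ((j : ℝ) - i) * (κ x (A x) * C.ε i x (Z x)))) := by
    intro i j A B hA hij
    rw [hcov i j _ x _ hij, hcov j i _ x _ hij.symm]
    congr 1
    have e : (fun y ↦ C.ε i y (C.cov (skewForms κ) Z y (A y))) =
        fun y ↦ mvfderiv IX (fun y ↦ C.ε i y (Z y)) y (A y)
          + ((i : ℝ) - j) * (κ y (A y) * C.ε j y (Z y)) := by
      funext y; exact hcov i j Z y _ hij
    have d1 : MDifferentiableAt IX 𝓘(ℝ, ℝ)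
        (fun y ↦ mvfderiv IX (fun y ↦ C.ε i y (Z y)) y (A y)) x := formDiffAt_mvfderiv (hZ i) A hA
    have d2 : MDifferentiableAt IX 𝓘(ℝ, ℝ) (fun y ↦ C.ε j y (Z y)) x :=
      (hZ j).mdifferentiableAt (by simp)
    have d3 : MDifferentiableAt IX 𝓘(ℝ, ℝ) (fun y ↦ κ y (A y)) x := hκ A hA
    have d4 : MDifferentiableAt IX 𝓘(ℝ, ℝ) (fun y ↦ κ y (A y) * C.ε j y (Z y)) x := d3.mul d2
    have d5 : MDifferentiableAt IX 𝓘(ℝ, ℝ)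
        (fun y ↦ ((i : ℝ) - j) * (κ y (A y) * C.ε j y (Z y))) x := mdifferentiableAt_const.mul d4
    rw [e, mvfderiv_fun_add d1 d5, mvfderiv_fun_mul mdifferentiableAt_const d4,
      mvfderiv_fun_mul d3 d2, mvfderiv_const]
    simp only [_root_.add_apply, _root_.smul_apply, smul_eq_mul, _root_.zero_apply]
    ring
  have h1 := hΩ V W hV hW
  have h2 := mvfderiv_mlieBracket (hZ i) hV hW
  unfold curvature
  rw [map_sub, map_sub, key i j W V hW hij, key i j V W hV hij, hcov i j Z x _ hij, h1, h2]
  ring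

end Curvature

section Curvature

variable {X : Type*} [TopologicalSpace X] [ChartedSpace E2 X] [IsManifold IX ∞ X]

/-- The equations `dl = 0` and `dn = lam l ∧ n` say that the connection form is `κ = lam n`. Then
`dκ = lam² l ∧ n`, so the Gaussian curvature is `-lam²`. -/
theorem IsFrameData.hasScalarCurvature {lam : ℝ} {F : ℝ → X → ℝ} {q : ℝ → SurfaceMetric X}
    {n β : ℝ → ∀ x : X, TangentSpace IX x →L[ℝ] ℝ} (h : IsFrameData lam F q n β) (t : ℝ) :
    HasScalarCurvature (q t) (-2 * lam ^ 2) := by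
  have hl : ∀ x, SmoothFormAt (lForm lam F) (t, x) := fun x ↦ smoothFormAt_lForm lam h.smooth_F _
  let C : GlobalFrame IX X (Fin 2) :=
    { e := fun i x ↦ if i = 0 then sharp (q t) x (lForm lam F t x) else sharp (q t) x (n t x)
      ε := fun i x ↦ if i = 0 then lForm lam F t x else n t x
      expand := fun x v ↦ by
        simp only [Fin.sum_univ_two]
        exact (h.ortho t x).exists_dual.2.2.2.2 v
      indep := fun x a b hab ↦ by
        obtain ⟨h1, h2, h3, h4, -⟩ := (h.ortho t x).exists_dual
        simp only [Fin.sum_univ_two, if_true, one_ne_zero, if_false] at hab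
        have e0 := congrArg (lForm lam F t x) hab
        have e1 := congrArg (n t x) hab
        simp only [map_add, map_smul, h1, h2, h3, h4, smul_eq_mul, mul_one, mul_zero, add_zero,
          zero_add] at e0 e1
        funext i
        fin_cases i
        · exact e0
        · exact e1
      diff := fun i x ↦ by
        fin_cases i
        · exact (hl x).formDiffAt
        · exact (h.smooth_n (t, x)).formDiffAt }
  have hC0 : ∀ x, C.ε 0 x = lForm lam F t x := fun x ↦ rfl
  have hC1 : ∀ x, C.ε 1 x = n t x := fun x ↦ rfl
  let κ : ∀ x : X, TangentSpace IX x →L[ℝ] ℝ := fun x ↦ lam • n t x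
  have hκd : ∀ x, FormDiffAt IX κ x := fun x ↦
    FormDiffAt.smul (f := fun _ ↦ lam) mdifferentiableAt_const (h.smooth_n (t, x)).formDiffAt
  have hκ : ∀ x, IsExtDerivAt IX κ x fun v w ↦
      lam ^ 2 * (lForm lam F t x v * n t x w - lForm lam F t x w * n t x v) := fun x ↦ by
    refine (IsExtDerivAt.smul (f := fun _ ↦ lam) mdifferentiableAt_const
      (h.smooth_n (t, x)).formDiffAt (h.d_n t x)).congr_right fun v w ↦ ?_
    rw [mvfderiv_const]
    simp only [_root_.zero_apply]
    ring
  refine ⟨C.cov (skewForms κ), C.isLeviCivita_cov (η := fun i j ↦ if i = j then 1 else 0)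
    (fun x v w ↦ ?_) (fun x v a b ↦ ?_) (fun i x ↦ ?_), fun x e he horth ↦ ?_⟩
  · rw [h.ortho]
    simp [Fin.sum_univ_two, hC0, hC1]
  · simp [Fin.sum_univ_two, skewForms]
    ring
  · fin_cases i
    · refine IsExtDerivAt.congr_right (isExtDerivAt_lForm lam h.smooth_F t x) fun v w ↦ ?_
      simp [Fin.sum_univ_two, skewForms, hC1, κ]
      ring
    · refine IsExtDerivAt.congr_right (h.d_n t x) fun v w ↦ ?_
      simp [Fin.sum_univ_two, skewForms, hC0, κ]
      ring
  · have hed : ∀ i, MDifferentiableAt IX IX.tangent (fun y ↦ (e i y : TangentBundle IX X)) x :=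
      fun i ↦ (he i x).mdifferentiableAt (by simp)
    have hZ : ∀ k i, ContMDiffAt IX 𝓘(ℝ, ℝ) 2 (fun y ↦ C.ε i y (e k y)) x := by
      intro k i
      have hv : SmoothVecAt (fun _ ↦ e k) (t, x) := by
        have h1 : ContMDiffAt JX IX ∞ (fun p : ℝ × X ↦ p.2) (t, x) := contMDiffAt_snd
        exact ContMDiffAt.comp (t, x) (g := fun y ↦ (⟨y, e k y⟩ : TangentBundle IX X)) (he k x) h1
      fin_cases i
      · exact (SmoothFormAt.slice ((hl x).apply hv)).of_le two_le_infty
      · exact (SmoothFormAt.slice ((h.smooth_n (t, x)).apply hv)).of_le two_le_infty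
    have hR : ∀ i j k, (q t).inner x (curvature IX (C.cov (skewForms κ)) (e i) (e j) (e k) x) (e i x) =
        lam ^ 2 * (lForm lam F t x (e i x) * n t x (e j x) - lForm lam F t x (e j x) * n t x (e i x)) *
        (lForm lam F t x (e k x) * n t x (e i x) - n t x (e k x) * lForm lam F t x (e i x)) := by
      intro i j k
      rw [h.ortho]
      have r0 := C.ε_curvature (hκd x) (hκ x) (hed i) (hed j) (hZ k) 0 1 (by decide)
      have r1 := C.ε_curvature (hκd x) (hκ x) (hed i) (hed j) (hZ k) 1 0 (by decide)
      rw [hC0] at r0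
      rw [hC1] at r1
      rw [r0, r1]
      simp [hC0, hC1]
      ring
    simp only [Fin.sum_univ_two, hR]
    have o00 := horth 0 0
    have o01 := horth 0 1
    have o11 := horth 1 1
    rw [h.ortho] at o00 o01 o11
    simp only [if_true, zero_ne_one, if_false] at o00 o01 o11
    generalize lForm lam F t x (e 0 x) = a at *
    generalize lForm lam F t x (e 1 x) = b at *
    generalize n t x (e 0 x) = c at *
    generalize n t x (e 1 x) = d at *
    -- The components of an orthonormal pair in an orthonormal coframe form an orthogonal matrix,
    -- and the sum of curvatures is `-2 lam²` times its squared determinant.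
    have hdet : (a * d - b * c) ^ 2 = 1 := by
      linear_combination (b * b + d * d) * o00 + o11 - (a * b + c * d) * o01
    linear_combination (-2 * lam ^ 2) * hdet

end Curvature

/-! ### A trivial spinor bundle -/

section TrivialSpinors

/-- Real gamma matrices of the null frame `(K, N, L, n)`: the first two are null with
`K N + N K = 2`, the others are unit. -/
def gammaMat : Fin 4 → Matrix (Fin 4) (Fin 4) ℝ :=
  ![!![0, 0, 2, 0; 0, 0, 0, 2; 0, 0, 0, 0; 0, 0, 0, 0],
    !![0, 0, 0, 0; 0, 0, 0, 0; 1, 0, 0, 0; 0, 1, 0, 0],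
    !![1, 0, 0, 0; 0, -1, 0, 0; 0, 0, -1, 0; 0, 0, 0, 1],
    !![0, 1, 0, 0; 1, 0, 0, 0; 0, 0, 0, -1; 0, 0, -1, 0]]

/-- The matrix of the spin-invariant pairing. -/
def pairMat : Matrix (Fin 4) (Fin 4) ℝ :=
  !![0, 0, 1, 0; 0, 0, 0, 1; -1, 0, 0, 0; 0, -1, 0, 0]

/-- The matrix of the Lorentzian metric in a null frame. -/
def nullMat : Matrix (Fin 4) (Fin 4) ℝ :=
  !![0, 1, 0, 0; 1, 0, 0, 0; 0, 0, 1, 0; 0, 0, 0, 1]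

theorem gammaMat_sq (a s : Fin 4 → ℝ) (i : Fin 4) :
    ∑ k, ∑ j, gammaMat k i j * (a k * ∑ k', ∑ j', gammaMat k' j j' * (a k' * s j')) =
      (∑ k, ∑ j, nullMat k j * (a k * a j)) * s i := by
  fin_cases i <;> simp [Fin.sum_univ_four, gammaMat, nullMat] <;> ring

theorem gammaMat_pairMat (a s t : Fin 4 → ℝ) :
    ∑ i, ∑ j, pairMat i j * ((∑ k, ∑ m, gammaMat k i m * (a k * s m)) * t j) =
      -∑ i, ∑ j, pairMat i j * (s i * ∑ k, ∑ m, gammaMat k j m * (a k * t m)) := by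
  simp [Fin.sum_univ_four, gammaMat, pairMat]
  ring

variable {E : Type*} [NormedAddCommGroup E] [NormedSpace ℝ E] [FiniteDimensional ℝ E]
  {H : Type*} [TopologicalSpace H] {I : ModelWithCorners ℝ E H}
  {M : Type*} [TopologicalSpace M] [ChartedSpace H M] [IsManifold I ∞ M]

theorem contMDiffAt_trivial_iff {F : Type*} [NormedAddCommGroup F] [NormedSpace ℝ F] {f : M → F}
    {p : M} : ContMDiffAt I (I.prod 𝓘(ℝ, F)) ∞
      (fun m ↦ TotalSpace.mk' F (E := Bundle.Trivial M F) m (f m)) p ↔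
      ContMDiffAt I 𝓘(ℝ, F) ∞ f p := by
  rw [contMDiffAt_totalSpace]
  exact ⟨fun h ↦ h.2, fun h ↦ ⟨contMDiffAt_id, h⟩⟩

theorem mdifferentiableAt_coord {s : ∀ y : M, Bundle.Trivial M E4 y} {p : M}
    (h : MDifferentiableAt I (I.prod 𝓘(ℝ, E4)) (fun y ↦ TotalSpace.mk' E4 y (s y)) p) (i : Fin 4) :
    MDifferentiableAt I 𝓘(ℝ, ℝ) (fun y ↦ (s y : E4) i) p := by
  have h1 : MDifferentiableAt I 𝓘(ℝ, E4) (fun y ↦ (s y : E4)) p :=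
    ((mdifferentiableAt_totalSpace _ _).1 h).2
  exact ((EuclideanSpace.proj i : E4 →L[ℝ] ℝ).mdifferentiableAt).comp p h1

theorem mvfderiv_bilin {κ₁ κ₂ : Type*} [Fintype κ₁] [Fintype κ₂] (c : κ₁ → κ₂ → ℝ)
    {f : κ₁ → M → ℝ} {g : κ₂ → M → ℝ} {x : M} (hf : ∀ i, MDifferentiableAt I 𝓘(ℝ, ℝ) (f i) x)
    (hg : ∀ i, MDifferentiableAt I 𝓘(ℝ, ℝ) (g i) x) (v : TangentSpace I x) :
    mvfderiv I (fun y ↦ ∑ i, ∑ j, c i j * (f i y * g j y)) x v =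
      ∑ i, ∑ j, c i j * (mvfderiv I (f i) x v * g j x)
        + ∑ i, ∑ j, c i j * (f i x * mvfderiv I (g j) x v) := by
  have hp : ∀ i j, MDifferentiableAt I 𝓘(ℝ, ℝ) (fun y ↦ c i j * (f i y * g j y)) x := fun i j ↦
    mdifferentiableAt_const.mul ((hf i).mul (hg j))
  rw [mvfderiv_sum_apply (fun i _ ↦ (mdifferentiableAt_sum_real fun j _ ↦ hp i j)),
    ← Finset.sum_add_distrib]
  refine Finset.sum_congr rfl fun i _ ↦ ?_
  rw [mvfderiv_sum_apply (fun j _ ↦ hp i j), ← Finset.sum_add_distrib]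
  refine Finset.sum_congr rfl fun j _ ↦ ?_
  have hab : MDifferentiableAt I 𝓘(ℝ, ℝ) (fun y ↦ f i y * g j y) x := (hf i).mul (hg j)
  rw [mvfderiv_fun_mul mdifferentiableAt_const hab, mvfderiv_fun_mul (hf i) (hg j), mvfderiv_const]
  simp only [_root_.add_apply, _root_.smul_apply, smul_eq_mul, _root_.zero_apply]
  ring

/-- The matrix `A` as an endomorphism of the model fibre. -/
def matCLM (A : Matrix (Fin 4) (Fin 4) ℝ) : E4 →L[ℝ] E4 := Matrix.toEuclideanCLM (𝕜 := ℝ) A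

theorem matCLM_apply (A : Matrix (Fin 4) (Fin 4) ℝ) (s : E4) (i : Fin 4) :
    matCLM A s i = ∑ j, A i j * s j := rfl

/-- The matrix `A` as a bilinear form on the model fibre. -/
def matForm (A : Matrix (Fin 4) (Fin 4) ℝ) : E4 →L[ℝ] E4 →L[ℝ] ℝ :=
  ∑ i, ∑ j, A i j • (EuclideanSpace.proj i : E4 →L[ℝ] ℝ).smulRight (EuclideanSpace.proj j : E4 →L[ℝ] ℝ)

theorem matForm_apply (A : Matrix (Fin 4) (Fin 4) ℝ) (s t : E4) :
    matForm A s t = ∑ i, ∑ j, A i j * (s i * t j) := by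
  simp [matForm, _root_.sum_apply]

namespace GlobalFrame

variable (C : GlobalFrame I M (Fin 4))

/-- Clifford multiplication on the trivial bundle, in a null frame. -/
def cliff (p : M) : TangentSpace I p →L[ℝ] E4 →L[ℝ] E4 :=
  ∑ k, (C.ε k p).smulRight (matCLM (gammaMat k))

theorem cliff_apply (p : M) (v : TangentSpace I p) (s : E4) (i : Fin 4) :
    C.cliff p v s i = ∑ k, ∑ j, gammaMat k i j * (C.ε k p v * s j) := by
  have : C.cliff p v = ∑ k, C.ε k p v • matCLM (gammaMat k) := by
    simp [cliff, _root_.sum_apply]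
  rw [this, _root_.sum_apply, WithLp.ofLp_sum, Finset.sum_apply]
  refine Finset.sum_congr rfl fun k _ ↦ ?_
  rw [_root_.smul_apply, PiLp.smul_apply, matCLM_apply, smul_eq_mul, Finset.mul_sum]
  exact Finset.sum_congr rfl fun j _ ↦ by ring

variable (I) in
/-- The one-form `θ` takes smooth vector fields to smooth functions. -/
def _root_.SusyKundt.FormSmooth (θ : ∀ y : M, TangentSpace I y →L[ℝ] ℝ) : Prop :=
  ∀ (p : M) (V : ∀ y : M, TangentSpace I y),
    ContMDiffAt I I.tangent ∞ (fun y ↦ (V y : TangentBundle I M)) p →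
    ContMDiffAt I 𝓘(ℝ, ℝ) ∞ (fun y ↦ θ y (V y)) p

theorem contMDiffAt_trivialization_symm (p : M) (b : E) :
    ContMDiffAt I I.tangent ∞ (fun y ↦ (⟨y,
      (trivializationAt E (TangentSpace I) p).symm y b⟩ : TangentBundle I M)) p := by
  rw [contMDiffAt_totalSpace]
  refine ⟨contMDiffAt_id, ?_⟩
  refine (contMDiffAt_const (c := b)).congr_of_eventuallyEq ?_
  filter_upwards [(trivializationAt E (TangentSpace I : M → Type _) p).open_baseSet.mem_nhds
    (FiberBundle.mem_baseSet_trivializationAt' p)] with y hy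
  exact congrArg Prod.snd (Trivialization.apply_mk_symm _ hy _)

theorem trivial_trivialization_symm (p m : M) (b : E4) :
    (trivializationAt E4 (Bundle.Trivial M E4) p).symm m b = b :=
  congrArg Prod.snd (Trivialization.apply_mk_symm (trivializationAt E4 (Bundle.Trivial M E4) p)
    (Set.mem_univ m) b)

/-- The trivial bundle with the standard Clifford multiplication in a null frame. -/
def spinorBundle (g : LorentzMetric I M) (hs : ∀ k, FormSmooth I (C.ε k))
    (hg : ∀ p v w, g.val p v w = ∑ i, ∑ j, nullMat i j * (C.ε i p v * C.ε j p w)) :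
    SpinorBundle g where
  S := Bundle.Trivial M E4
  clifford := C.cliff
  clifford_sq p v s := by
    refine PiLp.ext fun i ↦ ?_
    change C.cliff p v (C.cliff p v s) i = g.val p v v * (s : E4) i
    rw [cliff_apply, hg, ← gammaMat_sq]
    simp only [cliff_apply]
  clifford_smooth p := by
    refine contMDiffAt_hom_of_frame (E₁ := fun y : M ↦ TangentSpace I y)
      (E₂ := fun y : M ↦ Bundle.Trivial M E4 y →L[ℝ] Bundle.Trivial M E4 y)
      (Module.finBasis ℝ E) (f := fun m : M ↦ m) (φ := C.cliff) contMDiffAt_id fun i ↦ ?_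
    refine contMDiffAt_hom_of_frame (E₁ := Bundle.Trivial M E4) (E₂ := Bundle.Trivial M E4)
      (EuclideanSpace.basisFun (Fin 4) ℝ).toBasis (f := fun m : M ↦ m) contMDiffAt_id fun j ↦ ?_
    rw [contMDiffAt_trivial_iff]
    have h1 : ∀ m, C.cliff m ((trivializationAt E (TangentSpace I) p).symm m (Module.finBasis ℝ E i))
        ((trivializationAt E4 (Bundle.Trivial M E4) p).symm m
          ((EuclideanSpace.basisFun (Fin 4) ℝ).toBasis j)) =
        ∑ k, C.ε k m ((trivializationAt E (TangentSpace I) p).symm m (Module.finBasis ℝ E i)) •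
          matCLM (gammaMat k) ((EuclideanSpace.basisFun (Fin 4) ℝ).toBasis j) := fun m ↦ by
      rw [trivial_trivialization_symm]
      simp only [cliff, _root_.sum_apply, ContinuousLinearMap.smulRight_apply, _root_.smul_apply]
    refine ContMDiffAt.congr_of_eventuallyEq (f := fun m ↦ ∑ k, C.ε k m
      ((trivializationAt E (TangentSpace I) p).symm m (Module.finBasis ℝ E i)) •
          matCLM (gammaMat k) ((EuclideanSpace.basisFun (Fin 4) ℝ).toBasis j)) ?_
      (Eventually.of_forall h1)
    exact ContMDiffAt.sum fun k _ ↦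
      (hs k p _ (contMDiffAt_trivialization_symm p _)).smul contMDiffAt_const
  pairing _ := matForm pairMat
  pairing_skew p s t := by
    rw [matForm_apply, matForm_apply]
    simp [Fin.sum_univ_four, pairMat]
    ring
  pairing_nondeg p s h := by
    have h' : ∀ t : E4, ∑ i, ∑ j, pairMat i j * ((s : E4) i * t j) = 0 := fun t ↦ by
      rw [← matForm_apply]; exact h t
    refine PiLp.ext fun i ↦ ?_
    have h0 := h' (EuclideanSpace.single 0 1)
    have h1 := h' (EuclideanSpace.single 1 1)
    have h2 := h' (EuclideanSpace.single 2 1)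
    have h3 := h' (EuclideanSpace.single 3 1)
    simp [Fin.sum_univ_four, pairMat] at h0 h1 h2 h3
    fin_cases i
    exacts [h2, h3, h0, h1]
  pairing_clifford p v s t := by
    have := gammaMat_pairMat (fun k ↦ C.ε k p v) (s : E4) (t : E4)
    rw [matForm_apply, matForm_apply]
    simp only [cliff_apply]
    exact this
  pairing_smooth p := by
    refine contMDiffAt_hom_of_frame (E₁ := Bundle.Trivial M E4)
      (E₂ := fun y : M ↦ Bundle.Trivial M E4 y →L[ℝ] Bundle.Trivial M ℝ y)
      (EuclideanSpace.basisFun (Fin 4) ℝ).toBasis (f := fun m : M ↦ m)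
      (φ := fun _ ↦ matForm pairMat) contMDiffAt_id fun i ↦ ?_
    refine contMDiffAt_hom_of_frame (E₁ := Bundle.Trivial M E4) (E₂ := Bundle.Trivial M ℝ)
      (EuclideanSpace.basisFun (Fin 4) ℝ).toBasis (f := fun m : M ↦ m) contMDiffAt_id fun j ↦ ?_
    rw [contMDiffAt_trivial_iff]
    refine (contMDiffAt_const (c := matForm pairMat ((EuclideanSpace.basisFun (Fin 4) ℝ).toBasis i)
      ((EuclideanSpace.basisFun (Fin 4) ℝ).toBasis j))).congr_of_eventuallyEq
      (Eventually.of_forall fun m ↦ ?_)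
    simp only [trivial_trivialization_symm]

/-- The covariant derivative with connection forms `B` on the trivial bundle. -/
def spinCovFun (B : Fin 4 → Fin 4 → ∀ x : M, TangentSpace I x →L[ℝ] ℝ) (s : M → E4) (x : M) :
    TangentSpace I x →L[ℝ] E4 :=
  ∑ i, (mvfderiv I (fun y ↦ s y i) x + ∑ j, s x j • B i j x).smulRight (EuclideanSpace.single i 1)

theorem spinCovFun_apply (B : Fin 4 → Fin 4 → ∀ x : M, TangentSpace I x →L[ℝ] ℝ) (s : M → E4) (x : M)
    (v : TangentSpace I x) (i : Fin 4) :
    spinCovFun B s x v i = mvfderiv I (fun y ↦ s y i) x v + ∑ j, B i j x v * s x j := by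
  have : spinCovFun B s x v = ∑ i, (mvfderiv I (fun y ↦ s y i) x v
      + ∑ j, B i j x v * s x j) • (EuclideanSpace.single i (1 : ℝ) : E4) := by
    simp only [spinCovFun, _root_.sum_apply, ContinuousLinearMap.smulRight_apply, _root_.add_apply,
      _root_.smul_apply, smul_eq_mul, mul_comm]
  rw [this, WithLp.ofLp_sum, Finset.sum_apply]
  simp [Pi.single_apply]

/-- The covariant derivative with connection forms `B` on the trivial bundle. -/
def spinCov (B : Fin 4 → Fin 4 → ∀ x : M, TangentSpace I x →L[ℝ] ℝ) :
    CovariantDerivative I E4 (Bundle.Trivial M E4) where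
  toFun := spinCovFun B
  isCovariantDerivativeOnUniv := by
    constructor
    · intro s t x hs ht _
      ext v i
      change spinCovFun B (fun y ↦ (s y : E4) + (t y : E4)) x v i =
        spinCovFun B s x v i + spinCovFun B t x v i
      rw [spinCovFun_apply, spinCovFun_apply, spinCovFun_apply]
      simp only [PiLp.add_apply]
      rw [mvfderiv_fun_add (mdifferentiableAt_coord hs i) (mdifferentiableAt_coord ht i)]
      simp only [mul_add, Finset.sum_add_distrib, _root_.add_apply]
      ring
    · intro s f x hs hf _
      ext v i
      change spinCovFun B (fun y ↦ f y • (s y : E4)) x v i =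
        f x * spinCovFun B s x v i + mvfderiv I f x v * (s x : E4) i
      rw [spinCovFun_apply, spinCovFun_apply]
      simp only [PiLp.smul_apply, smul_eq_mul]
      rw [mvfderiv_fun_mul hf (mdifferentiableAt_coord hs i)]
      simp only [_root_.add_apply, _root_.smul_apply, smul_eq_mul]
      rw [mul_add, Finset.mul_sum]
      have : ∑ j, B i j x v * (f x * (s x : E4) j) = ∑ j, f x * (B i j x v * (s x : E4) j) :=
        Finset.sum_congr rfl fun j _ ↦ by ring
      rw [this]
      ring

/-- The hypothesis is the commutation rule `[B(v), γ(a)] = γ(Γ(v) a)`. As the gamma matrices are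
constant, the Leibniz rule adds only derivatives of components. -/
theorem spinCovFun_cliff {Γ B : Fin 4 → Fin 4 → ∀ x : M, TangentSpace I x →L[ℝ] ℝ} {p : M}
    {v : TangentSpace I p} (hB : ∀ (a b : Fin 4 → ℝ) i,
      ∑ j, B i j p v * ∑ k, ∑ m, gammaMat k j m * (a k * b m) =
        ∑ k, ∑ j, gammaMat k i j * ((∑ m, Γ k m p v * a m) * b j)
        + ∑ k, ∑ j, gammaMat k i j * (a k * ∑ m, B j m p v * b m))
    {V : ∀ y : M, TangentSpace I y} {s : M → E4}
    (hV : MDifferentiableAt I I.tangent (fun y ↦ (V y : TangentBundle I M)) p)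
    (hd : ∀ i, MDifferentiableAt I 𝓘(ℝ, ℝ) (fun y ↦ s y i) p) :
    spinCovFun B (fun y ↦ C.cliff y (V y) (s y)) p v =
      C.cliff p (C.cov Γ V p v) (s p) + C.cliff p (V p) (spinCovFun B s p v) := by
  have hε := fun k ↦ C.diff k p V hV
  refine PiLp.ext fun i ↦ ?_
  rw [PiLp.add_apply, spinCovFun_apply, cliff_apply, cliff_apply]
  simp only [cliff_apply, ε_cov, spinCovFun_apply]
  rw [mvfderiv_bilin (fun k j ↦ gammaMat k i j) hε hd, hB (fun k ↦ C.ε k p (V p)) (s p) i]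
  simp only [add_mul, mul_add, Finset.sum_add_distrib]
  ring

/-- The pairing has constant coefficients, so it is parallel as soon as the connection matrix lies
in the symplectic Lie algebra of `pairMat`. -/
theorem mvfderiv_pairing {B : Fin 4 → Fin 4 → ∀ x : M, TangentSpace I x →L[ℝ] ℝ} {p : M}
    {v : TangentSpace I p} (hP : ∀ (a b : Fin 4 → ℝ),
      ∑ i, ∑ j, pairMat i j * ((∑ m, B i m p v * a m) * b j)
        + ∑ i, ∑ j, pairMat i j * (a i * ∑ m, B j m p v * b m) = 0) {s t : M → E4}
    (hd : ∀ i, MDifferentiableAt I 𝓘(ℝ, ℝ) (fun y ↦ s y i) p)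
    (hd' : ∀ i, MDifferentiableAt I 𝓘(ℝ, ℝ) (fun y ↦ t y i) p) :
    mvfderiv I (fun y ↦ matForm pairMat (s y) (t y)) p v =
      matForm pairMat (spinCovFun B s p v) (t p) + matForm pairMat (s p) (spinCovFun B t p v) := by
  simp only [matForm_apply, spinCovFun_apply]
  rw [mvfderiv_bilin pairMat hd hd']
  have := hP (s p) (t p)
  simp only [add_mul, mul_add, Finset.sum_add_distrib]
  linarith

theorem isSpinLeviCivita (g : LorentzMetric I M) (hs : ∀ k, FormSmooth I (C.ε k))
    (hg : ∀ p v w, g.val p v w = ∑ i, ∑ j, nullMat i j * (C.ε i p v * C.ε j p w))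
    {Γ B : Fin 4 → Fin 4 → ∀ x : M, TangentSpace I x →L[ℝ] ℝ}
    (hΓ : IsLeviCivita I g.val (C.cov Γ))
    (hB : ∀ x v (a b : Fin 4 → ℝ) i,
      ∑ j, B i j x v * ∑ k, ∑ m, gammaMat k j m * (a k * b m) =
        ∑ k, ∑ j, gammaMat k i j * ((∑ m, Γ k m x v * a m) * b j)
        + ∑ k, ∑ j, gammaMat k i j * (a k * ∑ m, B j m x v * b m))
    (hP : ∀ x v (a b : Fin 4 → ℝ),
      ∑ i, ∑ j, pairMat i j * ((∑ m, B i m x v * a m) * b j)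
        + ∑ i, ∑ j, pairMat i j * (a i * ∑ m, B j m x v * b m) = 0) :
    (C.spinorBundle g hs hg).IsSpinLeviCivita (C.cov Γ) (spinCov B) where
  leviCivita := hΓ
  clifford p _ _ hV hs' v := C.spinCovFun_cliff (hB p v) hV (mdifferentiableAt_coord hs')
  pairing p _ _ hs' ht' v := mvfderiv_pairing (hP p v) (mdifferentiableAt_coord hs')
    (mdifferentiableAt_coord ht')

end GlobalFrame

end TrivialSpinors

/-! ### The Levi-Civita matrix in the null frame and its spin lift. -/

section ConnectionMatrices

variable {R : Type*} [AddCommGroup R] [Module ℝ R]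

/-- The Levi-Civita connection of a supersymmetric Kundt space-time in its null frame. -/
def connMat (lam : ℝ) (l u n κ μ : R) : Matrix (Fin 4) (Fin 4) R :=
  !![lam • l, 0, κ, μ; 0, -(lam • l), lam • u, 0; -(lam • u), -κ, 0, -(lam • n); 0, -μ, lam • n, 0]

/-- The spin connection of a supersymmetric Kundt space-time in its null frame. -/
def spinMat (lam : ℝ) (l u n κ μ : R) : Matrix (Fin 4) (Fin 4) R :=
  !![(lam / 2) • l, -((lam / 2) • n), -κ, -μ; (lam / 2) • n, (lam / 2) • l, -μ, κ;
    (lam / 2) • u, 0, -((lam / 2) • l), -((lam / 2) • n);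
    0, -((lam / 2) • u), (lam / 2) • n, -((lam / 2) • l)]

theorem connMat_skew (lam l u n κ μ : ℝ) (a b : Fin 4 → ℝ) :
    ∑ i, ∑ j, nullMat i j * ((∑ k, connMat lam l u n κ μ i k * a k) * b j
      + a i * ∑ k, connMat lam l u n κ μ j k * b k) = 0 := by
  simp [Fin.sum_univ_four, connMat, nullMat]
  ring

/-- This says that `spinMat` lifts `connMat` to the spin representation. The first column of
`spinMat`, `lam / 2` times `(l, n, u, 0)`, is `lam / 2` times the Clifford action on the first basis
spinor, which makes that spinor Killing. -/
theorem spinMat_gammaMat (lam l u n κ μ : ℝ) (a b : Fin 4 → ℝ) (i : Fin 4) :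
    ∑ j, spinMat lam l u n κ μ i j * ∑ k, ∑ m, gammaMat k j m * (a k * b m) =
      ∑ k, ∑ j, gammaMat k i j * ((∑ m, connMat lam l u n κ μ k m * a m) * b j)
      + ∑ k, ∑ j, gammaMat k i j * (a k * ∑ m, spinMat lam l u n κ μ j m * b m) := by
  fin_cases i <;> simp [Fin.sum_univ_four, connMat, spinMat, gammaMat] <;> ring

theorem spinMat_pairMat (lam l u n κ μ : ℝ) (a b : Fin 4 → ℝ) :
    ∑ i, ∑ j, pairMat i j * ((∑ m, spinMat lam l u n κ μ i m * a m) * b j)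
      + ∑ i, ∑ j, pairMat i j * (a i * ∑ m, spinMat lam l u n κ μ j m * b m) = 0 := by
  simp [Fin.sum_univ_four, spinMat, pairMat]
  ring

end ConnectionMatrices

/-! ### The null one-forms on the product and their exterior derivatives. -/

section Families

variable {X : Type*} [TopologicalSpace X] [ChartedSpace E2 X] [IsManifold IX ∞ X]

theorem connMat_apply {p : ℝ × ℝ × X} (lam : ℝ) (l u n κ μ : TangentSpace IM p →L[ℝ] ℝ)
    (i j : Fin 4) (v : TangentSpace IM p) :
    connMat lam l u n κ μ i j v = connMat lam (l v) (u v) (n v) (κ v) (μ v) i j := by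
  fin_cases i <;> fin_cases j <;> rfl

theorem spinMat_apply {p : ℝ × ℝ × X} (lam : ℝ) (l u n κ μ : TangentSpace IM p →L[ℝ] ℝ)
    (i j : Fin 4) (v : TangentSpace IM p) :
    spinMat lam l u n κ μ i j v = spinMat lam (l v) (u v) (n v) (κ v) (μ v) i j := by
  fin_cases i <;> fin_cases j <;> rfl

theorem FormSmooth.add {θ θ' : ∀ p : ℝ × ℝ × X, TangentSpace IM p →L[ℝ] ℝ}
    (h : FormSmooth IM θ) (h' : FormSmooth IM θ') : FormSmooth IM (fun p ↦ θ p + θ' p) :=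
  fun p V hV ↦ (h p V hV).add (h' p V hV)

theorem FormSmooth.smul {f : ℝ × ℝ × X → ℝ} {θ : ∀ p : ℝ × ℝ × X, TangentSpace IM p →L[ℝ] ℝ}
    (hf : ContMDiff IM 𝓘(ℝ, ℝ) ∞ f) (h : FormSmooth IM θ) : FormSmooth IM (fun p ↦ f p • θ p) :=
  fun p V hV ↦ (hf p).mul (h p V hV)

theorem formSmooth_mvfderiv {f : ℝ × ℝ × X → ℝ} (hf : ContMDiff IM 𝓘(ℝ, ℝ) ∞ f) :
    FormSmooth IM (mvfderiv IM f) := by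
  intro p V hV
  have h1 : ContMDiff IM.tangent 𝓘(ℝ, ℝ).tangent ∞ (tangentMap IM 𝓘(ℝ, ℝ) f) :=
    hf.contMDiff_tangentMap (by simp)
  have h2 : ContMDiffAt IM 𝓘(ℝ, ℝ).tangent ∞
      (fun y ↦ (⟨f y, mvfderiv IM f y (V y)⟩ : TangentBundle 𝓘(ℝ, ℝ) ℝ)) p :=
    h1.contMDiffAt.comp p hV
  have h3 := (contMDiffAt_totalSpace.1 h2).2
  refine h3.congr_of_eventuallyEq (Eventually.of_forall fun m ↦ ?_)
  simp only
  rw [trivializationAt_model_space_apply]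

theorem contMDiff_xu : ContMDiff IM 𝓘(ℝ, ℝ) ∞ (fun p : ℝ × ℝ × X ↦ p.1) := contMDiff_fst

theorem contMDiff_xv : ContMDiff IM 𝓘(ℝ, ℝ) ∞ (fun p : ℝ × ℝ × X ↦ p.2.1) :=
  contMDiff_fst.comp contMDiff_snd

theorem contMDiffAt_projX {V : ∀ p : ℝ × ℝ × X, TangentSpace IM p} {p : ℝ × ℝ × X}
    (hV : ContMDiffAt IM IM.tangent ∞ (fun y ↦ (V y : TangentBundle IM (ℝ × ℝ × X))) p) :
    ContMDiffAt IM IX.tangent ∞ (fun y ↦ (⟨y.2.2, projX y (V y)⟩ : TangentBundle IX X)) p := by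
  have h1 : ContMDiff IM.tangent IX.tangent ∞
      (tangentMap IM IX (fun p : ℝ × ℝ × X ↦ p.2.2)) :=
    smooth_projX.contMDiff_tangentMap (by simp)
  exact h1.contMDiffAt.comp p hV

theorem formSmooth_pullForm {θ : ℝ → ∀ x : X, TangentSpace IX x →L[ℝ] ℝ}
    (hθ : ∀ p, SmoothFormAt θ p) : FormSmooth IM (pullForm θ) := by
  intro p V hV
  have h0 := ContMDiffAt.comp p (f := projUX) (show ContMDiffAt JX (IX.prod 𝓘(ℝ, E2 →L[ℝ] ℝ)) ∞
    (fun p : ℝ × X ↦ (TotalSpace.mk' (E2 →L[ℝ] ℝ) p.2 (θ p.1 p.2) :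
      TotalSpace (E2 →L[ℝ] ℝ) (fun x : X ↦ TangentSpace IX x →L[ℝ] ℝ))) (projUX p) from hθ _)
    (smooth_projUX (X := X)).contMDiffAt
  have h1 : ContMDiffAt IM (IX.prod 𝓘(ℝ, ℝ)) ∞
      (fun m : ℝ × ℝ × X ↦ TotalSpace.mk' ℝ (E := Bundle.Trivial X ℝ) m.2.2
        (θ m.1 m.2.2 (projX m (V m)))) p :=
    ContMDiffAt.clm_bundle_apply (F₁ := E2) (F₂ := ℝ) (E₁ := fun y : X ↦ TangentSpace IX y)
      (E₂ := Bundle.Trivial X ℝ) (b := fun m : ℝ × ℝ × X ↦ m.2.2) h0 (contMDiffAt_projX hV)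
  exact (contMDiffAt_totalSpace.1 h1).2

theorem IsSmoothFun.comp_projUX {f : ℝ → X → ℝ} (hf : IsSmoothFun f) :
    ContMDiff IM 𝓘(ℝ, ℝ) ∞ (fun p : ℝ × ℝ × X ↦ f p.1 p.2.2) :=
  ContMDiff.comp (I' := JX) (g := fun m : ℝ × X ↦ f m.1 m.2) hf smooth_projUX

/-- The null one-form `e^F dx_u`. -/
def uForm (F : ℝ → X → ℝ) (p : ℝ × ℝ × X) : TangentSpace IM p →L[ℝ] ℝ :=
  Real.exp (F p.1 p.2.2) • dxu p

/-- The null one-form `dx_v + β + h dx_u`. -/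
def wForm (h : ℝ → X → ℝ) (β : ℝ → ∀ x : X, TangentSpace IX x →L[ℝ] ℝ) (p : ℝ × ℝ × X) :
    TangentSpace IM p →L[ℝ] ℝ :=
  dxv p + pullForm β p + h p.1 p.2.2 • dxu p

theorem formDiffAt_dxu (p : ℝ × ℝ × X) : FormDiffAt IM dxu p :=
  formDiffAt_mvfderiv ((contMDiff_xu.of_le two_le_infty).contMDiffAt)

theorem formDiffAt_dxv (p : ℝ × ℝ × X) : FormDiffAt IM dxv p :=
  formDiffAt_mvfderiv ((contMDiff_xv.of_le two_le_infty).contMDiffAt)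

theorem isExtDerivAt_dxu (p : ℝ × ℝ × X) : IsExtDerivAt IM dxu p fun _ _ ↦ 0 :=
  isExtDerivAt_mvfderiv ((contMDiff_xu.of_le two_le_infty).contMDiffAt)

theorem isExtDerivAt_dxv (p : ℝ × ℝ × X) : IsExtDerivAt IM dxv p fun _ _ ↦ 0 :=
  isExtDerivAt_mvfderiv ((contMDiff_xv.of_le two_le_infty).contMDiffAt)

theorem IsSmoothFun.mvfderiv_apply {f : ℝ → X → ℝ} (hf : IsSmoothFun f) (p : ℝ × ℝ × X)
    (a : TangentSpace IM p) : mvfderiv IM (fun p : ℝ × ℝ × X ↦ f p.1 p.2.2) p a =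
      dxu p a * deriv (fun τ ↦ f τ p.2.2) p.1 + dX f p.1 p.2.2 (projX p a) :=
  mvfderiv_family (hf.mdifferentiableAt (by simp)) a

/-- `d(e^F dx_u) = d_X F ∧ e^F dx_u`. -/
theorem isExtDerivAt_uForm {F : ℝ → X → ℝ} (hF : IsSmoothFun F) (p : ℝ × ℝ × X) :
    IsExtDerivAt IM (uForm F) p fun a b ↦ dX F p.1 p.2.2 (projX p a) * uForm F p b
      - dX F p.1 p.2.2 (projX p b) * uForm F p a := by
  have hE : IsSmoothFun (fun t x ↦ Real.exp (F t x)) := Real.contDiff_exp.contMDiff.comp hF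
  refine (IsExtDerivAt.smul (f := fun p : ℝ × ℝ × X ↦ Real.exp (F p.1 p.2.2))
    ((hE.comp_projUX p).mdifferentiableAt (by simp)) (formDiffAt_dxu p)
    (isExtDerivAt_dxu p)).congr_right fun a b ↦ ?_
  have h1 : ∀ a, mvfderiv IM (fun p : ℝ × ℝ × X ↦ Real.exp (F p.1 p.2.2)) p a =
      Real.exp (F p.1 p.2.2) * mvfderiv IM (fun p : ℝ × ℝ × X ↦ F p.1 p.2.2) p a := fun a ↦
    mvfderiv_scalar_comp (Real.hasDerivAt_exp _) ((hF.comp_projUX p).mdifferentiableAt (by simp)) a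
  rw [h1, h1, hF.mvfderiv_apply, hF.mvfderiv_apply]
  simp only [uForm, _root_.smul_apply, smul_eq_mul]
  ring

theorem isExtDerivAt_wForm {h : ℝ → X → ℝ} {β : ℝ → ∀ x : X, TangentSpace IX x →L[ℝ] ℝ}
    (hh : IsSmoothFun h) {p : ℝ × ℝ × X} (hβ : SmoothFormAt β (p.1, p.2.2))
    {η : TangentSpace IX p.2.2 → TangentSpace IX p.2.2 → ℝ}
    (hη : IsExtDerivAt IX (β p.1) p.2.2 η) :
    IsExtDerivAt IM (wForm h β) p fun a b ↦
      dxu p a * (partialU β p.1 p.2.2 (projX p b) - dX h p.1 p.2.2 (projX p b))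
      - dxu p b * (partialU β p.1 p.2.2 (projX p a) - dX h p.1 p.2.2 (projX p a))
      + η (projX p a) (projX p b) := by
  have hd := (hh.comp_projUX p).mdifferentiableAt (n := ∞) (by simp)
  have h1 := IsExtDerivAt.smul hd (formDiffAt_dxu p) (isExtDerivAt_dxu p)
  have h2 := IsExtDerivAt.add (formDiffAt_dxv p) (formDiffAt_pullForm hβ) (isExtDerivAt_dxv p)
    (hβ.isExtDerivAt_pullForm hη)
  have h3 := IsExtDerivAt.add ((formDiffAt_dxv p).add (formDiffAt_pullForm hβ))
    (FormDiffAt.smul hd (formDiffAt_dxu p)) h2 h1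
  refine IsExtDerivAt.congr_right h3 fun a b ↦ ?_
  rw [hh.mvfderiv_apply, hh.mvfderiv_apply]
  ring

end Families

/-! ### From the structure equations to a Killing spinor. -/

section Families

variable {X : Type*} [TopologicalSpace X] [ChartedSpace E2 X] [IsManifold IX ∞ X]

variable {lam : ℝ} {F : ℝ → X → ℝ} {q : ℝ → SurfaceMetric X}
  {n β : ℝ → ∀ x : X, TangentSpace IX x →L[ℝ] ℝ}

theorem partialV_eq_vecM (p : ℝ × ℝ × X) : partialV p = vecM p 0 1 0 := partialV_eq p

namespace IsFrameData

/-- The null frame `(K, N, L, n)` of a supersymmetric Kundt space-time. -/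
def nullFrame (h : IsFrameData lam F q n β) {k : ℝ → X → ℝ} (hk : IsSmoothFun k) :
    GlobalFrame IM (ℝ × ℝ × X) (Fin 4) where
  e i p := ![vecM p 0 1 0, vecM p (Real.exp (-F p.1 p.2.2)) (-k p.1 p.2.2 * Real.exp (-F p.1 p.2.2)) 0,
    vecM p 0 (-β p.1 p.2.2 (sharp (q p.1) p.2.2 (lForm lam F p.1 p.2.2)))
      (sharp (q p.1) p.2.2 (lForm lam F p.1 p.2.2)),
    vecM p 0 (-β p.1 p.2.2 (sharp (q p.1) p.2.2 (n p.1 p.2.2))) (sharp (q p.1) p.2.2 (n p.1 p.2.2))] i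
  ε i p := ![wForm k β p, uForm F p, pullForm (lForm lam F) p, pullForm n p] i
  expand p v := by
    obtain ⟨-, -, -, -, h5⟩ := (h.ortho p.1 p.2.2).exists_dual
    have e5 := h5 (projX p v)
    have hE : Real.exp (F p.1 p.2.2) * Real.exp (-F p.1 p.2.2) = 1 := by
      rw [← Real.exp_add]; simp
    have eβ := congrArg (β p.1 p.2.2) e5
    rw [map_add, map_smul, map_smul, smul_eq_mul, smul_eq_mul] at eβ
    simp only [Fin.sum_univ_four, Matrix.cons_val]
    refine vecM_ext ?_ ?_ ?_
    · simp only [map_add, map_smul, dxu_vecM, smul_eq_mul]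
      simp only [uForm, _root_.smul_apply, smul_eq_mul]
      linear_combination (-dxu p v) * hE
    · simp only [map_add, map_smul, dxv_vecM, smul_eq_mul]
      simp only [uForm, wForm, pullForm, _root_.smul_apply, _root_.add_apply, smul_eq_mul,
        ContinuousLinearMap.comp_apply]
      linear_combination (k p.1 p.2.2 * dxu p v) * hE - eβ
    · simp only [map_add, map_smul, projX_vecM, smul_zero, zero_add]
      exact e5
  indep p a b hab := by
    obtain ⟨h1, h2, h3, h4, -⟩ := (h.ortho p.1 p.2.2).exists_dual
    have hE : Real.exp (-F p.1 p.2.2) ≠ 0 := (Real.exp_pos _).ne'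
    simp only [Fin.sum_univ_four, Matrix.cons_val] at hab
    have eu := congrArg (dxu p) hab
    have ev := congrArg (dxv p) hab
    have ex := congrArg (projX p) hab
    simp only [map_add, map_smul, dxu_vecM, dxv_vecM, projX_vecM, smul_zero, zero_add,
      smul_eq_mul, mul_zero, add_zero] at eu ev ex
    have el := congrArg (lForm lam F p.1 p.2.2) ex
    have en := congrArg (n p.1 p.2.2) ex
    simp only [map_add, map_smul, smul_eq_mul, h1, h2, h3, h4, mul_one, mul_zero, add_zero,
      zero_add] at el en
    have e1 : a 1 = b 1 := mul_right_cancel₀ hE eu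
    rw [el, en, e1] at ev
    funext i
    fin_cases i
    · exact by simpa using ev
    · exact e1
    · exact el
    · exact en
  diff i p := by
    have hd := (hk.comp_projUX p).mdifferentiableAt (n := ∞) (by simp)
    have hE : IsSmoothFun (fun t x ↦ Real.exp (F t x)) := Real.contDiff_exp.contMDiff.comp h.smooth_F
    fin_cases i
    · exact ((formDiffAt_dxv p).add (formDiffAt_pullForm (h.smooth_β _))).add
        (FormDiffAt.smul hd (formDiffAt_dxu p))
    · exact FormDiffAt.smul ((hE.comp_projUX p).mdifferentiableAt (by simp)) (formDiffAt_dxu p)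
    · exact formDiffAt_pullForm (smoothFormAt_lForm lam h.smooth_F _)
    · exact formDiffAt_pullForm (h.smooth_n _)

theorem formSmooth_nullFrame (h : IsFrameData lam F q n β) {k : ℝ → X → ℝ} (hk : IsSmoothFun k)
    (i : Fin 4) : FormSmooth IM ((h.nullFrame hk).ε i) := by
  have hE : IsSmoothFun (fun t x ↦ Real.exp (F t x)) := Real.contDiff_exp.contMDiff.comp h.smooth_F
  fin_cases i
  · exact ((formSmooth_mvfderiv contMDiff_xv).add (formSmooth_pullForm h.smooth_β)).add
      (FormSmooth.smul hk.comp_projUX (formSmooth_mvfderiv contMDiff_xu))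
  · exact FormSmooth.smul hE.comp_projUX (formSmooth_mvfderiv contMDiff_xu)
  · exact formSmooth_pullForm (smoothFormAt_lForm lam h.smooth_F)
  · exact formSmooth_pullForm h.smooth_n

/-- The one-form `g(∇ L, N)`. -/
def kappa (lam : ℝ) (F : ℝ → X → ℝ) (q : ℝ → SurfaceMetric X)
    (β : ℝ → ∀ x : X, TangentSpace IX x →L[ℝ] ℝ) (k : ℝ → X → ℝ) (p : ℝ × ℝ × X) :
    TangentSpace IM p →L[ℝ] ℝ :=
  lam • wForm k β p - Real.exp (-F p.1 p.2.2) • pullForm (partialU (lForm lam F)) p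
    - ((partialU β p.1 p.2.2 - dX k p.1 p.2.2)
        (sharp (q p.1) p.2.2 (lForm lam F p.1 p.2.2))) • dxu p

/-- The one-form `g(∇ n, N)`. -/
def mu (F : ℝ → X → ℝ) (q : ℝ → SurfaceMetric X)
    (n β : ℝ → ∀ x : X, TangentSpace IX x →L[ℝ] ℝ) (k : ℝ → X → ℝ) (p : ℝ × ℝ × X) :
    TangentSpace IM p →L[ℝ] ℝ :=
  -(Real.exp (-F p.1 p.2.2) • pullForm (partialU n) p)
    - ((partialU β p.1 p.2.2 - dX k p.1 p.2.2) (sharp (q p.1) p.2.2 (n p.1 p.2.2))) • dxu p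

variable (lam F q n β) in
/-- The Levi-Civita connection forms. -/
def conn (k : ℝ → X → ℝ) (i j : Fin 4) (p : ℝ × ℝ × X) : TangentSpace IM p →L[ℝ] ℝ :=
  connMat lam (pullForm (lForm lam F) p) (uForm F p) (pullForm n p) (kappa lam F q β k p)
    (mu F q n β k p) i j

variable (lam F q n β) in
/-- The spin connection forms. -/
def spin (k : ℝ → X → ℝ) (i j : Fin 4) (p : ℝ × ℝ × X) : TangentSpace IM p →L[ℝ] ℝ :=
  spinMat lam (pullForm (lForm lam F) p) (uForm F p) (pullForm n p) (kappa lam F q β k p)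
    (mu F q n β k p) i j

/-- The four first structure equations. The row of `u` is `d_X F = 2 lam l`. The rows of `l` and `n`
account for the terms with `∂_u` in `kappa` and `mu`. In the row of `w` these terms contribute
`e^{-F} (∂_u l ∧ l + ∂_u n ∧ n)`, which is exactly the prescribed `dβ`. -/
theorem isLeviCivita_nullFrame (hlam : lam ≠ 0) (h : IsFrameData lam F q n β) {k : ℝ → X → ℝ}
    (hk : IsSmoothFun k) {g : ∀ p : ℝ × ℝ × X, TangentSpace IM p →L[ℝ] TangentSpace IM p →L[ℝ] ℝ}
    (hg : ∀ p v w, g p v w = ∑ i, ∑ j, nullMat i j *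
      ((h.nullFrame hk).ε i p v * (h.nullFrame hk).ε j p w)) :
    IsLeviCivita IM g ((h.nullFrame hk).cov (conn lam F q n β k)) := by
  refine (h.nullFrame hk).isLeviCivita_cov hg (fun p v a b ↦ ?_) fun i p ↦ ?_
  · simp only [conn, connMat_apply]
    exact connMat_skew _ _ _ _ _ _ a b
  have hE : Real.exp (F p.1 p.2.2) * Real.exp (-F p.1 p.2.2) = 1 := by
    rw [← Real.exp_add]; simp
  have hdX : ∀ v, dX F p.1 p.2.2 v = 2 * lam * lForm lam F p.1 p.2.2 v := fun v ↦ by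
    simp only [lForm, _root_.smul_apply, smul_eq_mul]
    field_simp
  have hexp := fun θ v ↦ (h.ortho p.1 p.2.2).form_eq θ v
  fin_cases i
  · refine IsExtDerivAt.congr_right (isExtDerivAt_wForm hk (h.smooth_β _) (h.d_β p.1 p.2.2))
      fun a b ↦ ?_
    simp only [conn, connMat_apply, Fin.sum_univ_four]
    simp [connMat, nullFrame, kappa, mu, pullForm]
    rw [hexp (partialU β p.1 p.2.2) (projX p a), hexp (partialU β p.1 p.2.2) (projX p b),
      hexp (dX k p.1 p.2.2) (projX p a), hexp (dX k p.1 p.2.2) (projX p b),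
      hexp (partialU (lForm lam F) p.1 p.2.2) (projX p a),
      hexp (partialU (lForm lam F) p.1 p.2.2) (projX p b),
      hexp (partialU n p.1 p.2.2) (projX p a), hexp (partialU n p.1 p.2.2) (projX p b)]
    ring
  · refine IsExtDerivAt.congr_right (isExtDerivAt_uForm h.smooth_F p) fun a b ↦ ?_
    simp only [conn, connMat_apply, Fin.sum_univ_four]
    simp [connMat, nullFrame, pullForm, hdX]
    ring
  · refine IsExtDerivAt.congr_right (SmoothFormAt.isExtDerivAt_pullForm
      (smoothFormAt_lForm lam h.smooth_F _) (isExtDerivAt_lForm lam h.smooth_F p.1 p.2.2)) fun a b ↦ ?_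
    simp only [conn, connMat_apply, Fin.sum_univ_four]
    simp [connMat, nullFrame, kappa, pullForm, uForm]
    linear_combination (partialU (lForm lam F) p.1 p.2.2 (projX p a) * dxu p b
      - partialU (lForm lam F) p.1 p.2.2 (projX p b) * dxu p a) * hE
  · refine IsExtDerivAt.congr_right (SmoothFormAt.isExtDerivAt_pullForm (h.smooth_n _)
      (h.d_n p.1 p.2.2)) fun a b ↦ ?_
    simp only [conn, connMat_apply, Fin.sum_univ_four]
    simp [connMat, nullFrame, mu, pullForm, uForm]
    linear_combination (partialU n p.1 p.2.2 (projX p a) * dxu p b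
      - partialU n p.1 p.2.2 (projX p b) * dxu p a) * hE

/-- The structure equations yield a Killing spinor. -/
theorem exists_isStandardSusyKundt (hlam : lam ≠ 0) (h : IsFrameData lam F q n β)
    {g : LorentzMetric IM (ℝ × ℝ × X)} {H : ℝ → X → ℝ} (hH : IsSmoothFun H)
    (hq : ∀ t, IsCompleteMetric (q t))
    (hg : ∀ (p : ℝ × ℝ × X) (a b : TangentSpace IM p),
      g.val p a b = H p.1 p.2.2 * (dxu p a * dxu p b)
      + Real.exp (F p.1 p.2.2) *
        (dxu p a * (dxv p b + β p.1 p.2.2 (projX p b))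
          + (dxv p a + β p.1 p.2.2 (projX p a)) * dxu p b)
      + (q p.1).inner p.2.2 (projX p a) (projX p b)) :
    ∃ (B : SpinorBundle g) (ε : ∀ p, B.S p), IsStandardSusyKundt lam g B ε := by
  -- With this `k`, the product `u ⊙ w` of `u = e^F dx_u` and `w = dx_v + β + k dx_u` absorbs `H
  -- dx_u ⊗ dx_u`.
  let k : ℝ → X → ℝ := fun t x ↦ 1 / 2 * H t x * Real.exp (-1 * F t x)
  have hk : IsSmoothFun k := (contMDiff_const.mul hH).mul (h.smooth_F.exp_mul (-1))
  have hE : ∀ t x, Real.exp (F t x) * Real.exp (-1 * F t x) = 1 := fun t x ↦ by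
    rw [← Real.exp_add]; simp
  have hg' : ∀ p v w, g.val p v w = ∑ i, ∑ j, nullMat i j *
      ((h.nullFrame hk).ε i p v * (h.nullFrame hk).ε j p w) := fun p v w ↦ by
    rw [hg, h.ortho]
    simp only [Fin.sum_univ_four]
    simp [nullMat, nullFrame, uForm, wForm, pullForm, k]
    have := hE p.1 p.2.2
    rw [neg_one_mul] at this
    linear_combination (-H p.1 p.2.2 * dxu p v * dxu p w) * this
  have hLC := h.isLeviCivita_nullFrame hlam hk hg'
  have hspin := (h.nullFrame hk).isSpinLeviCivita g (h.formSmooth_nullFrame hk) hg'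
    (Γ := conn lam F q n β k) (B := spin lam F q n β k) hLC
    (fun p v a b i ↦ by
      simp only [conn, spin, connMat_apply, spinMat_apply]
      exact spinMat_gammaMat _ _ _ _ _ _ a b i)
    (fun p v a b ↦ by
      simp only [spin, spinMat_apply]
      exact spinMat_pairMat _ _ _ _ _ _ a b)
  have hcl : ∀ (p : ℝ × ℝ × X) (v : TangentSpace IM p),
      (h.nullFrame hk).cliff p v (EuclideanSpace.single 0 1) =
        !₂[pullForm (lForm lam F) p v, pullForm n p v, uForm F p v, 0] := fun p v ↦ by
    refine PiLp.ext fun i ↦ ?_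
    rw [GlobalFrame.cliff_apply]
    fin_cases i <;> simp [Fin.sum_univ_four, gammaMat, nullFrame]
  refine ⟨(h.nullFrame hk).spinorBundle g (h.formSmooth_nullFrame hk) hg',
    fun _ ↦ (EuclideanSpace.single 0 1 : E4), ?_, ⟨?_, _, _, hspin, fun p v ↦ ?_⟩, fun p w ↦ ?_⟩
  · have hα : IsSmoothForm (fun t x ↦ Real.exp (F t x) • β t x) := fun p ↦
      SmoothFormAt.smul (f := fun t x ↦ Real.exp (F t x))
        ((Real.contDiff_exp.contMDiff.comp h.smooth_F) p) (h.smooth_β p)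
    refine ⟨H, F, _, q, hH, h.smooth_F, hα, isSmoothMetric_of_coframe
      (smoothFormAt_lForm lam h.smooth_F) h.smooth_n h.ortho, hq, fun p a b ↦ ?_⟩
    rw [hg]
    simp only [_root_.smul_apply, smul_eq_mul]
    ring
  · intro p
    exact contMDiffAt_trivial_iff.2 contMDiffAt_const
  · refine PiLp.ext fun i ↦ ?_
    change GlobalFrame.spinCovFun (spin lam F q n β k) (fun _ ↦ EuclideanSpace.single 0 1) p v i =
      lam / 2 * (h.nullFrame hk).cliff p v (EuclideanSpace.single 0 1) i
    rw [GlobalFrame.spinCovFun_apply, hcl, mvfderiv_const]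
    simp only [spin, spinMat_apply]
    fin_cases i <;> simp [Fin.sum_univ_four, spinMat]
  · change _ = matForm pairMat (EuclideanSpace.single 0 1)
      ((h.nullFrame hk).cliff p w (EuclideanSpace.single 0 1))
    rw [hcl, matForm_apply, hg]
    rw [partialV_eq_vecM, dxu_vecM, dxv_vecM, projX_vecM]
    simp [Fin.sum_univ_four, pairMat, uForm]

end IsFrameData

end Families

/-! ### Linear algebra of a real spinor with null current. -/

section CliffordModule

variable {S : Type*} [AddCommGroup S] [Module ℝ S]

/-- `J` makes `S` a complex vector space, where a nonzero scalar `x + iy` acts invertibly. -/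
theorem eq_zero_of_complex_smul {J : S →ₗ[ℝ] S} (hJ : ∀ s, J (J s) = -s) {s : S} (hs : s ≠ 0)
    {x y : ℝ} (h : x • s + y • J s = 0) : x = 0 ∧ y = 0 := by
  have h1 := congrArg J h
  rw [map_add, map_smul, map_smul, hJ, map_zero] at h1
  have h2 : (x ^ 2 + y ^ 2) • s = 0 := by
    have : x • (x • s + y • J s) - y • (x • J s + y • -s) = (x ^ 2 + y ^ 2) • s := by module
    rw [← this, h, h1]; simp
  have h3 : x ^ 2 + y ^ 2 = 0 := (smul_eq_zero.1 h2).resolve_right hs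
  constructor <;> nlinarith [sq_nonneg x, sq_nonneg y]

/-- In a four-dimensional space, the kernel of a null Clifford element is a complex line. -/
theorem exists_of_mem_ker (hS : Module.finrank ℝ S = 4) {K N J : S →ₗ[ℝ] S}
    (hK : ∀ s, K (K s) = 0) (hKN : ∀ s, K (N s) + N (K s) = (2 : ℝ) • s)
    (hJ : ∀ s, J (J s) = -s) (hKJ : ∀ s, K (J s) = J (K s)) {s t : S} (hs : K s = 0) (h0 : s ≠ 0)
    (ht : K t = 0) : ∃ x y : ℝ, t = x • s + y • J s := by
  have : FiniteDimensional ℝ S := Module.finite_of_finrank_pos (by omega)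
  -- If `K s = 0`, then `s = K (N s / 2)`. So kernel and range agree, and both have dimension two;
  -- the kernel is stable under `J`, hence spanned by `s` and `J s`.
  have hr : LinearMap.range K = LinearMap.ker K := by
    ext s
    refine ⟨?_, fun h ↦ ⟨(1 / 2 : ℝ) • N s, ?_⟩⟩
    · rintro ⟨t, rfl⟩; exact hK t
    · have h1 := hKN s
      rw [LinearMap.mem_ker.1 h, map_zero, add_zero] at h1
      rw [map_smul, h1, smul_smul]; norm_num
  have h2 : Module.finrank ℝ (LinearMap.ker K) = 2 := by
    have := LinearMap.finrank_range_add_finrank_ker K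
    rw [hr] at this
    omega
  have hli : LinearIndependent ℝ ![s, J s] :=
    LinearIndependent.pair_iff.2 fun x y h ↦ eq_zero_of_complex_smul hJ h0 h
  have h3 := finrank_span_eq_card hli
  have hle : Submodule.span ℝ (Set.range ![s, J s]) ≤ LinearMap.ker K := by
    rw [Submodule.span_le]
    rintro _ ⟨i, rfl⟩
    fin_cases i
    · exact hs
    · change K (J s) = 0
      rw [hKJ, hs, map_zero]
  have h4 := Submodule.eq_of_le_of_finrank_eq hle (by rw [h3, h2]; rfl)
  have h5 : t ∈ Submodule.span ℝ (Set.range ![s, J s]) := h4 ▸ LinearMap.mem_ker.2 ht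
  rw [Matrix.range_cons_cons_empty, Submodule.mem_span_pair] at h5
  obtain ⟨x, y, h⟩ := h5
  exact ⟨x, y, h.symm⟩

/-- A real spinor with null current is annihilated by its current, and is fixed by a unit spacelike
vector orthogonal to the current. -/
theorem exists_unit_fix (hS : Module.finrank ℝ S = 4) {K N A B : S →ₗ[ℝ] S}
    (hK : ∀ s, K (K s) = 0) (hN : ∀ s, N (N s) = 0)
    (hKN : ∀ s, K (N s) + N (K s) = (2 : ℝ) • s) (hA : ∀ s, A (A s) = s) (hB : ∀ s, B (B s) = s)
    (hBA : ∀ s, B (A s) = -A (B s)) (hKA : ∀ s, K (A s) = -A (K s)) (hKB : ∀ s, K (B s) = -B (K s))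
    (hNA : ∀ s, N (A s) = -A (N s)) (hNB : ∀ s, N (B s) = -B (N s))
    {P : S → S →ₗ[ℝ] ℝ} (hP : ∀ s t, P s t = -P t s) (hnd : ∀ s, (∀ t, P s t = 0) → s = 0)
    (hPK : ∀ s t, P (K s) t = -P s (K t)) (hPN : ∀ s t, P (N s) t = -P s (N t))
    (hPA : ∀ s t, P (A s) t = -P s (A t)) (hPB : ∀ s t, P (B s) t = -P s (B t))
    {s : S} (h0 : P s (K s) = 0) (h1 : P s (N s) ≠ 0) :
    K s = 0 ∧ ∃ x y : ℝ, x ^ 2 + y ^ 2 = 1 ∧ x • A s + y • B s = s := by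
  let J : S →ₗ[ℝ] S := A ∘ₗ B
  have hJ : ∀ s, J (J s) = -s := fun s ↦ by
    change A (B (A (B s))) = -s
    rw [hBA, map_neg, hA, hB]
  have hKJ : ∀ s, K (J s) = J (K s) := fun s ↦ by
    change K (A (B s)) = A (B (K s))
    rw [hKA, hKB, map_neg, neg_neg]
  have hNJ : ∀ s, N (J s) = J (N s) := fun s ↦ by
    change N (A (B s)) = A (B (N s))
    rw [hNA, hNB, map_neg, neg_neg]
  have hPJ : ∀ s t, P s (J t) = -P (J s) t := fun s t ↦ by
    change P s (A (B t)) = -P (A (B s)) t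
    have e1 := hPA s (B t)
    have e2 := hPB (A s) t
    rw [hBA, hP, map_neg, ← hP] at e2
    have e3 := hP (A (B s)) t
    rw [hP (A (B s)) t]
    rw [hP] at e2
    linarith
  have hKNK : ∀ s, K (N (K s)) = (2 : ℝ) • K s := fun s ↦ by
    have := hKN (K s)
    rwa [hK, map_zero, add_zero] at this
  -- Take `b = N (K s)`, so that `K b = 2 K s` and `P b (K b)` is a multiple of `P s (K s) = 0`.
  -- Also `P b (K (J b)) = 0` by the symmetries of `P`. As `b` and `J b` span the kernel of `N`,
  -- which contains every `N (K t)`, the relation `K N K = 2 K` shows that `K b` pairs to zero with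
  -- everything.
  have key : K s = 0 := by
    set b := N (K s) with hb
    have hKb : K b = (2 : ℝ) • K s := hKNK s
    have hNb : N b = 0 := hN _
    have hbb : P b (K b) = 0 := by
      rw [hKb, map_smul, hb, hPN, hPK, hKNK, map_smul, h0]
      simp
    by_cases hb0 : b = 0
    · rw [hb0, map_zero] at hKb
      exact (smul_eq_zero.1 hKb.symm).resolve_left two_ne_zero
    have hbJ : P b (K (J b)) = 0 := by
      have e1 := hPJ b (K b)
      rw [← hKJ] at e1
      have e2 := hPK b (J b)
      rw [hP] at e2
      linarith
    have hker : ∀ t, N t = 0 → P b (K t) = 0 := fun t ht ↦ by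
      obtain ⟨x, y, rfl⟩ := exists_of_mem_ker hS hN (fun s ↦ by rw [add_comm, hKN]) hJ hNJ hNb hb0 ht
      simp only [map_add, map_smul, hbb, hbJ, smul_zero, add_zero]
    have hz : K b = 0 := hnd _ fun t ↦ by
      have := hker (N (K t)) (hN _)
      rw [hKNK, map_smul, smul_eq_mul] at this
      rw [hPK]
      linarith
    rw [hz] at hKb
    exact (smul_eq_zero.1 hKb.symm).resolve_left two_ne_zero
  refine ⟨key, ?_⟩
  have hs : s ≠ 0 := by
    rintro rfl
    simp at h1
  -- `A` preserves the complex line `ker K` and anticommutes with `J`, so it acts there as a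
  -- reflection; `x² + y² = 1` is `A² = 1`. As `B s = A (J s)`, the combination `x A + y B` fixes
  -- `s`.
  obtain ⟨x, y, hxy⟩ := exists_of_mem_ker hS hK hKN hJ hKJ key hs
    (t := A s) (by rw [hKA, key, map_zero, neg_zero])
  have hAJ : A (J s) = y • s - x • J s := by
    have h2 : A (J s) = -J (A s) := by
      change A (A (B s)) = -A (B (A s))
      rw [hBA, map_neg, neg_neg]
    rw [h2, hxy, map_add, map_smul, map_smul, hJ]
    module
  have h3 : (x ^ 2 + y ^ 2 - 1) • s = 0 := by
    have h4 := congrArg A hxy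
    rw [hA, map_add, map_smul, map_smul, hxy, hAJ] at h4
    have : (x ^ 2 + y ^ 2 - 1) • s = x • (x • s + y • J s) + y • (y • s - x • J s) - s := by module
    rw [this, ← h4, sub_self]
  have h5 : x ^ 2 + y ^ 2 = 1 := by
    have := (smul_eq_zero.1 h3).resolve_right hs
    linarith
  refine ⟨x, y, h5, ?_⟩
  have hBs : B s = y • s - x • J s := by
    rw [← hAJ]
    exact (hA _).symm
  rw [hBs, hxy]
  have : x • (x • s + y • J s) + y • (y • s - x • J s) = (x ^ 2 + y ^ 2) • s := by module
  rw [this, h5, one_smul]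

end CliffordModule

/-! ### Bilinearity of exterior derivatives at a point. -/

section ExtDerivBilinear

variable {E : Type*} [NormedAddCommGroup E] [NormedSpace ℝ E] [CompleteSpace E]
  {H : Type*} [TopologicalSpace H] {I : ModelWithCorners ℝ E H}
  {M : Type*} [TopologicalSpace M] [ChartedSpace H M] [IsManifold I ∞ M]

/-- In `IsExtDerivAt` the value `η` is an arbitrary function; its linearity is inherited from the
invariant formula and is needed to write `η` as a multiple of `l ∧ n`. -/
theorem IsExtDerivAt.add_right {θ : ∀ y : M, TangentSpace I y →L[ℝ] ℝ} {x : M}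
    {η : TangentSpace I x → TangentSpace I x → ℝ} (hd : FormDiffAt I θ x) (h : IsExtDerivAt I θ x η)
    (v w w' : TangentSpace I x) : η v (w + w') = η v w + η v w' := by
  have hv := FiberBundle.mdifferentiableAt_extend I E v
  have hw := FiberBundle.mdifferentiableAt_extend I E w
  have hw' := FiberBundle.mdifferentiableAt_extend I E w'
  have h1 := h _ _ hv (mdifferentiableAt_add_section hw hw')
  have h2 := h _ _ hv hw
  have h3 := h _ _ hv hw'
  have e1 := mvfderiv_fun_add (hd _ hw) (hd _ hw')
  rw [mlieBracket_add_right hw hw', map_add] at h1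
  simp only [Pi.add_apply, map_add, FiberBundle.extend_apply_self] at h1 h2 h3
  rw [e1] at h1
  rw [h1, h2, h3]
  simp only [_root_.add_apply]
  ring

theorem IsExtDerivAt.smul_right {θ : ∀ y : M, TangentSpace I y →L[ℝ] ℝ} {x : M}
    {η : TangentSpace I x → TangentSpace I x → ℝ} (hd : FormDiffAt I θ x) (h : IsExtDerivAt I θ x η)
    (c : ℝ) (v w : TangentSpace I x) : η v (c • w) = c * η v w := by
  have hv := FiberBundle.mdifferentiableAt_extend I E v
  have hw := FiberBundle.mdifferentiableAt_extend I E w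
  have h1 := h _ _ hv (MDifferentiableAt.smul_const_section (a := c) hw)
  have h2 := h _ _ hv hw
  have e1 := mvfderiv_fun_mul (mdifferentiableAt_const (c := c)) (hd _ hw)
  rw [mlieBracket_const_smul_right hw, map_smul] at h1
  simp only [Pi.smul_apply, map_smul, FiberBundle.extend_apply_self, smul_eq_mul] at h1 h2
  rw [e1, mvfderiv_const] at h1
  rw [h1, h2]
  simp only [_root_.smul_apply, smul_eq_mul, smul_zero, add_zero]
  ring

end ExtDerivBilinear

/-! ### Differential consequences of the Killing equation. -/

section KillingSpinors

variable {E : Type*} [NormedAddCommGroup E] [NormedSpace ℝ E]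
  {H : Type*} [TopologicalSpace H] {I : ModelWithCorners ℝ E H}
  {M : Type*} [TopologicalSpace M] [ChartedSpace H M] [IsManifold I ∞ M]

/-- The exterior derivative of a one-form in terms of the covariant derivative of its dual field. -/
theorem IsLeviCivita.isExtDerivAt {g : ∀ x : M, TangentSpace I x →L[ℝ] TangentSpace I x →L[ℝ] ℝ}
    {nab : CovariantDerivative I E (TangentSpace I : M → Type _)} (h : IsLeviCivita I g nab)
    {θ : ∀ x : M, TangentSpace I x →L[ℝ] ℝ} {Z : ∀ x : M, TangentSpace I x}
    (hθ : ∀ x v, θ x v = g x (Z x) v) {p : M}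
    (hZ : MDifferentiableAt I I.tangent (fun y ↦ (Z y : TangentBundle I M)) p) :
    IsExtDerivAt I θ p fun v w ↦ g p (nab Z p v) w - g p (nab Z p w) v := by
  intro V W hV hW
  simp only [hθ]
  rw [h.metric p Z W hZ hW, h.metric p Z V hZ hV, ← h.torsion_free p V W hV hW, map_sub]
  ring

theorem IsLeviCivita.add_eq_zero {g : ∀ x : M, TangentSpace I x →L[ℝ] TangentSpace I x →L[ℝ] ℝ}
    {nab : CovariantDerivative I E (TangentSpace I : M → Type _)} (h : IsLeviCivita I g nab)
    {V W : ∀ x : M, TangentSpace I x} {c : ℝ} (hc : ∀ y, g y (V y) (W y) = c) {p : M}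
    (hV : MDifferentiableAt I I.tangent (fun y ↦ (V y : TangentBundle I M)) p)
    (hW : MDifferentiableAt I I.tangent (fun y ↦ (W y : TangentBundle I M)) p)
    (v : TangentSpace I p) : g p (nab V p v) (W p) + g p (V p) (nab W p v) = 0 := by
  rw [← h.metric p V W hV hW]
  simp only [hc]
  rw [mvfderiv_const]
  rfl

namespace SpinorBundle

variable {g : LorentzMetric I M} (B : SpinorBundle g)

theorem finrank_fiber (p : M) : Module.finrank ℝ (B.S p) = 4 := by
  have e := ((trivializationAt E4 B.S p).continuousLinearEquivAt ℝ p
    (FiberBundle.mem_baseSet_trivializationAt' p)).toLinearEquiv.finrank_eq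
  rw [e]
  simp

theorem clifford_add_swap (p : M) (v w : TangentSpace I p) (s : B.S p) :
    B.clifford p v (B.clifford p w s) + B.clifford p w (B.clifford p v s)
      = (2 * g.val p v w) • s := by
  have h := B.clifford_sq p (v + w) s
  simp only [map_add, _root_.add_apply] at h
  rw [B.clifford_sq, B.clifford_sq, g.symm p w v] at h
  have e : (2 * g.val p v w) • s = (g.val p v v + g.val p v w + (g.val p v w + g.val p w w)) • s
      - g.val p v v • s - g.val p w w • s := by module
  rw [e, ← h]
  abel

theorem mdifferentiableAt_clifford {V : ∀ y : M, TangentSpace I y} {s : ∀ y : M, B.S y} {p : M}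
    (hV : MDifferentiableAt I I.tangent (fun y ↦ (V y : TangentBundle I M)) p)
    (hs : MDifferentiableAt I (I.prod 𝓘(ℝ, E4)) (fun y ↦ TotalSpace.mk' E4 y (s y)) p) :
    MDifferentiableAt I (I.prod 𝓘(ℝ, E4))
      (fun y ↦ TotalSpace.mk' E4 y (B.clifford y (V y) (s y))) p := by
  have h0 := B.clifford_smooth.mdifferentiableAt (x := p) (by simp)
  have h1 : MDifferentiableAt I (I.prod 𝓘(ℝ, E4 →L[ℝ] E4))
      (fun m ↦ TotalSpace.mk' (E4 →L[ℝ] E4) (E := fun m ↦ B.S m →L[ℝ] B.S m) m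
        (B.clifford m (V m))) p :=
    MDifferentiableAt.clm_bundle_apply (F₁ := E) (F₂ := E4 →L[ℝ] E4)
      (E₁ := fun y : M ↦ TangentSpace I y)
      (E₂ := fun m ↦ B.S m →L[ℝ] B.S m) (b := fun m ↦ m) h0 hV
  exact MDifferentiableAt.clm_bundle_apply (F₁ := E4) (F₂ := E4) (E₁ := B.S)
      (E₂ := B.S) (b := fun m ↦ m) h1 hs

variable {B} {nab : CovariantDerivative I E (TangentSpace I : M → Type _)}
  {D : CovariantDerivative I E4 B.S} {lam : ℝ} {ε : ∀ p, B.S p}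

/-- The exterior derivative of the Dirac current of a Killing spinor. -/
theorem IsSpinLeviCivita.isExtDerivAt_diracCurrent (h : B.IsSpinLeviCivita nab D)
    (hε : ContMDiff I (I.prod 𝓘(ℝ, E4)) ∞ (fun p ↦ TotalSpace.mk' E4 p (ε p)))
    (hD : ∀ (p : M) (v : TangentSpace I p), D ε p v = (lam / 2) • B.clifford p v (ε p))
    {u : ∀ p : M, TangentSpace I p →L[ℝ] ℝ} (hu : ∀ p v, u p v = B.diracCurrent ε p v) (p : M) :
    IsExtDerivAt I u p fun v w ↦
      2 * lam * B.pairing p (B.clifford p v (ε p)) (B.clifford p w (ε p)) := by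
  intro V W hV hW
  have hs := hε.mdifferentiableAt (x := p) (by simp)
  -- Both slots of the pairing contribute `(lam / 2) ⟨V·ε, W·ε⟩`, the second after moving `W`
  -- across. Antisymmetrizing doubles this term, since the pairing is skew, and torsion-freeness
  -- cancels the rest.
  have key : ∀ V W : ∀ y : M, TangentSpace I y,
      MDifferentiableAt I I.tangent (fun y ↦ (W y : TangentBundle I M)) p →
      mvfderiv I (fun y ↦ u y (W y)) p (V p) =
        lam * B.pairing p (B.clifford p (V p) (ε p)) (B.clifford p (W p) (ε p))
        + u p (nab W p (V p)) := by
    intro V W hW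
    simp only [hu, diracCurrent]
    rw [h.pairing p ε (fun y ↦ B.clifford y (W y) (ε y)) hs (B.mdifferentiableAt_clifford hW hs),
      h.clifford p W ε hW hs, hD]
    have e := B.pairing_clifford p (W p) (ε p) (B.clifford p (V p) (ε p))
    rw [B.pairing_skew] at e
    simp only [map_add, map_smul, _root_.smul_apply, smul_eq_mul]
    linear_combination (lam / 2) * e
  rw [key V W hW, key W V hV, ← h.leviCivita.torsion_free p V W hV hW, map_sub,
    B.pairing_skew p (B.clifford p (W p) (ε p))]
  ring

/-- The derivative of a field that fixes a Killing spinor. -/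
theorem IsSpinLeviCivita.clifford_nab_eq (h : B.IsSpinLeviCivita nab D)
    (hε : ContMDiff I (I.prod 𝓘(ℝ, E4)) ∞ (fun p ↦ TotalSpace.mk' E4 p (ε p)))
    (hD : ∀ (p : M) (v : TangentSpace I p), D ε p v = (lam / 2) • B.clifford p v (ε p))
    {L : ∀ p : M, TangentSpace I p} (hL : ∀ p, B.clifford p (L p) (ε p) = ε p) {p : M}
    (hd : MDifferentiableAt I I.tangent (fun y ↦ (L y : TangentBundle I M)) p)
    (v : TangentSpace I p) :
    B.clifford p (nab L p v - lam • (v - g.val p (L p) v • L p)) (ε p) = 0 := by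
  have hs := hε.mdifferentiableAt (x := p) (by simp)
  have h1 := h.clifford p L ε hd hs v
  -- Differentiating `L·ε = ε` gives `(∇_v L)·ε = (lam / 2) (v·ε - L·v·ε)`, where `L·v·ε = 2 g(L, v)
  -- ε - v·ε`.
  have e : (fun y ↦ B.clifford y (L y) (ε y)) = ε := funext hL
  rw [e, hD, map_smul] at h1
  have h2 := B.clifford_add_swap p (L p) v (ε p)
  rw [hL] at h2
  have h3 : B.clifford p (nab L p v) (ε p) = (lam / 2) • B.clifford p v (ε p)
      - (lam / 2) • ((2 * g.val p (L p) v) • ε p - B.clifford p v (ε p)) := by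
    rw [h1, ← h2]
    module
  simp only [map_sub, map_smul, _root_.sub_apply, _root_.smul_apply, hL]
  rw [h3]
  module

end SpinorBundle

end KillingSpinors

/-! ### The null frame of a Kundt metric and the vector fixing the spinor. -/

section Reduction

variable {X : Type*} [TopologicalSpace X] [ChartedSpace E2 X] [IsManifold IX ∞ X]

/-- The lift of a vector of `X` orthogonal to the null directions. -/
def liftM (β : ℝ → ∀ x : X, TangentSpace IX x →L[ℝ] ℝ) (p : ℝ × ℝ × X)
    (z : TangentSpace IX p.2.2) : TangentSpace IM p := vecM p 0 (-β p.1 p.2.2 z) z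

/-- The null vector dual to `∂_{x_v}`. -/
def nullM (H F : ℝ → X → ℝ) (p : ℝ × ℝ × X) : TangentSpace IM p :=
  vecM p (Real.exp (-1 * F p.1 p.2.2))
    (-(1 / 2 * H p.1 p.2.2 * Real.exp (-1 * F p.1 p.2.2)) * Real.exp (-1 * F p.1 p.2.2)) 0

/-- The metric `H dx_u ⊗ dx_u + e^F dx_u ⊙ (dx_v + β) + q`. -/
def HasKundtForm (g : LorentzMetric IM (ℝ × ℝ × X)) (H F : ℝ → X → ℝ)
    (β : ℝ → ∀ x : X, TangentSpace IX x →L[ℝ] ℝ) (q : ℝ → SurfaceMetric X) : Prop :=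
  ∀ (p : ℝ × ℝ × X) (a b : TangentSpace IM p),
    g.val p a b = H p.1 p.2.2 * (dxu p a * dxu p b)
    + Real.exp (F p.1 p.2.2) *
      (dxu p a * (dxv p b + β p.1 p.2.2 (projX p b))
        + (dxv p a + β p.1 p.2.2 (projX p a)) * dxu p b)
    + (q p.1).inner p.2.2 (projX p a) (projX p b)

variable {g : LorentzMetric IM (ℝ × ℝ × X)} {H F : ℝ → X → ℝ}
  {β : ℝ → ∀ x : X, TangentSpace IX x →L[ℝ] ℝ} {q : ℝ → SurfaceMetric X}

namespace HasKundtForm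

theorem val_liftM (h : HasKundtForm g H F β q) (p : ℝ × ℝ × X) (z : TangentSpace IX p.2.2)
    (v : TangentSpace IM p) : g.val p (liftM β p z) v = (q p.1).inner p.2.2 z (projX p v) := by
  rw [h]
  simp [liftM]

theorem val_nullM (h : HasKundtForm g H F β q) (p : ℝ × ℝ × X) (v : TangentSpace IM p) :
    g.val p (nullM H F p) v =
      wForm (fun t x ↦ 1 / 2 * H t x * Real.exp (-1 * F t x)) β p v := by
  have hE : Real.exp (F p.1 p.2.2) * Real.exp (-1 * F p.1 p.2.2) = 1 := by
    rw [← Real.exp_add]; simp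
  rw [h]
  simp only [nullM, wForm, pullForm, dxu_vecM, dxv_vecM, projX_vecM, map_zero, _root_.zero_apply,
    _root_.add_apply, _root_.smul_apply, smul_eq_mul, ContinuousLinearMap.comp_apply]
  linear_combination (dxv p v + β p.1 p.2.2 (projX p v)
    - 1 / 2 * H p.1 p.2.2 * Real.exp (-1 * F p.1 p.2.2) * dxu p v) * hE

theorem val_partialV (h : HasKundtForm g H F β q) (p : ℝ × ℝ × X) (v : TangentSpace IM p) :
    g.val p (partialV p) v = uForm F p v := by
  rw [h, partialV_eq_vecM]
  simp [uForm]

theorem val_liftM_liftM (h : HasKundtForm g H F β q) (p : ℝ × ℝ × X)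
    (z w : TangentSpace IX p.2.2) :
    g.val p (liftM β p z) (liftM β p w) = (q p.1).inner p.2.2 z w := by
  rw [h.val_liftM, liftM, projX_vecM]

theorem val_liftM_nullM (h : HasKundtForm g H F β q) (p : ℝ × ℝ × X) (z : TangentSpace IX p.2.2) :
    g.val p (liftM β p z) (nullM H F p) = 0 := by
  rw [h.val_liftM, nullM, projX_vecM, map_zero]

theorem val_nullM_nullM (h : HasKundtForm g H F β q) (p : ℝ × ℝ × X) :
    g.val p (nullM H F p) (nullM H F p) = 0 := by
  rw [h.val_nullM]
  simp [nullM, wForm, pullForm]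

theorem uForm_nullM (F : ℝ → X → ℝ) (p : ℝ × ℝ × X) : uForm F p (nullM H F p) = 1 := by
  have hE : Real.exp (F p.1 p.2.2) * Real.exp (-1 * F p.1 p.2.2) = 1 := by
    rw [← Real.exp_add]; simp
  simp only [uForm, nullM, _root_.smul_apply, dxu_vecM, smul_eq_mul, hE]

end HasKundtForm

theorem exists_orthonormal (q : SurfaceMetric X) (x : X) : ∃ e f : TangentSpace IX x,
    q.inner x e e = 1 ∧ q.inner x e f = 0 ∧ q.inner x f f = 1 := by
  have : Nontrivial (TangentSpace IX x) :=
    Module.nontrivial_of_finrank_pos (R := ℝ) (by rw [finrank_tangentSpace]; norm_num)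
  obtain ⟨z, hz⟩ := exists_ne (0 : TangentSpace IX x)
  have hpos : 0 < q.inner x z z := q.pos x z hz
  set c := q.inner x z z with hc
  have he : q.inner x ((√c)⁻¹ • z) ((√c)⁻¹ • z) = 1 := by
    simp only [map_smul, _root_.smul_apply, smul_eq_mul, ← hc]
    have := Real.mul_self_sqrt hpos.le
    have h0 : √c ≠ 0 := (Real.sqrt_pos.2 hpos).ne'
    field_simp
    nlinarith
  set e := (√c)⁻¹ • z with hedef
  have hsh : e = sharp q x (q.inner x e) := eq_sharp fun w ↦ rfl
  obtain ⟨n, hn⟩ := exists_isOrthoCoframe (q := q) (x := x) (l := q.inner x e)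
    (by rw [← hsh]; exact he)
  obtain ⟨-, -, h3, h4, -⟩ := hn.exists_dual
  exact ⟨e, sharp q x n, he, h3, by rw [sharp_spec]; exact h4⟩

/-- The algebraic reduction defined by a spinor with null current `∂_{x_v}`. -/
theorem exists_liftM_fix (h : HasKundtForm g H F β q) {B : SpinorBundle g} {ε : ∀ p, B.S p}
    (had : ∀ (p : ℝ × ℝ × X) (w : TangentSpace IM p),
      g.val p (partialV p) w = B.diracCurrent ε p w) (p : ℝ × ℝ × X) :
    ∃ z : TangentSpace IX p.2.2, (q p.1).inner p.2.2 z z = 1 ∧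
      B.clifford p (liftM β p z) (ε p) = ε p := by
  obtain ⟨e, f, hee, hef, hff⟩ := exists_orthonormal (q p.1) p.2.2
  have hu : ∀ w, B.pairing p (ε p) (B.clifford p w (ε p)) = uForm F p w := fun w ↦ by
    rw [← h.val_partialV]; exact (had p w).symm
  have hsw := B.clifford_add_swap p
  have hswap : ∀ v w, g.val p v w = 0 → ∀ s,
      B.clifford p v (B.clifford p w s) = -B.clifford p w (B.clifford p v s) := fun v w hvw s ↦ by
    have := hsw v w s
    rw [hvw, mul_zero, zero_smul] at this
    exact eq_neg_of_add_eq_zero_left this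
  have hsq : ∀ v, g.val p v v = 0 → ∀ s, B.clifford p v (B.clifford p v s) = 0 := fun v hv s ↦ by
    rw [B.clifford_sq, hv, zero_smul]
  have hsq1 : ∀ v, g.val p v v = 1 → ∀ s, B.clifford p v (B.clifford p v s) = s := fun v hv s ↦ by
    rw [B.clifford_sq, hv, one_smul]
  have hKl : ∀ z, g.val p (partialV p) (liftM β p z) = 0 := fun z ↦ by
    rw [h.val_partialV]; simp [uForm, liftM]
  have hKK : g.val p (partialV p) (partialV p) = 0 := by
    rw [h.val_partialV, partialV_eq_vecM]; simp [uForm]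
  have hKN : g.val p (partialV p) (nullM H F p) = 1 := by
    rw [h.val_partialV, HasKundtForm.uForm_nullM]
  have hNl : ∀ z, g.val p (nullM H F p) (liftM β p z) = 0 := fun z ↦ by
    rw [g.symm, h.val_liftM_nullM]
  -- The null pair is `∂_{x_v}` and `nullM`, and the unit pair consists of the lifts of an
  -- orthonormal basis of `T_x X`. Adaptedness gives the pairings `u(∂_{x_v}) = 0` and `u(N) = 1`.
  obtain ⟨-, x, y, hxy, hfix⟩ := exists_unit_fix (B.finrank_fiber p)
    (K := (B.clifford p (partialV p)).toLinearMap) (N := (B.clifford p (nullM H F p)).toLinearMap)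
    (A := (B.clifford p (liftM β p e)).toLinearMap) (B := (B.clifford p (liftM β p f)).toLinearMap)
    (P := fun s ↦ (B.pairing p s).toLinearMap) (s := ε p)
    (hsq _ hKK) (hsq _ (h.val_nullM_nullM p))
    (fun s ↦ by have := hsw (partialV p) (nullM H F p) s; rwa [hKN, mul_one] at this)
    (hsq1 _ (by rw [h.val_liftM_liftM, hee])) (hsq1 _ (by rw [h.val_liftM_liftM, hff]))
    (hswap _ _ (by rw [g.symm, h.val_liftM_liftM, hef])) (hswap _ _ (hKl e)) (hswap _ _ (hKl f))
    (hswap _ _ (hNl e)) (hswap _ _ (hNl f)) (B.pairing_skew p) (B.pairing_nondeg p)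
    (B.pairing_clifford p _) (B.pairing_clifford p _) (B.pairing_clifford p _)
    (B.pairing_clifford p _)
    (by
      have := hu (partialV p)
      rw [partialV_eq_vecM] at this ⊢
      exact this.trans (by simp [uForm]))
    (by
      have := hu (nullM H F p)
      rw [HasKundtForm.uForm_nullM] at this
      exact ne_of_eq_of_ne this one_ne_zero)
  refine ⟨x • e + y • f, ?_, ?_⟩
  · have hfe : (q p.1).inner p.2.2 f e = 0 := by rw [(q p.1).symm, hef]
    simp only [map_add, map_smul, _root_.add_apply, _root_.smul_apply, smul_eq_mul, hee, hef, hff,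
      hfe]
    linear_combination hxy
  · have e1 : liftM β p (x • e + y • f) = x • liftM β p e + y • liftM β p f := by
      refine vecM_ext ?_ ?_ ?_ <;>
        simp only [liftM, map_add, map_smul, dxu_vecM, dxv_vecM, projX_vecM, smul_eq_mul] <;> ring
    rw [e1]
    simp only [map_add, map_smul, _root_.add_apply, _root_.smul_apply]
    exact hfix

end Reduction

/-! ### From a Killing spinor to the Kundt data. -/

section Reduction

variable {X : Type*} [TopologicalSpace X] [ChartedSpace E2 X] [IsManifold IX ∞ X]

variable {lam : ℝ} {g : LorentzMetric IM (ℝ × ℝ × X)} {H F : ℝ → X → ℝ}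
  {β n : ℝ → ∀ x : X, TangentSpace IX x →L[ℝ] ℝ} {q : ℝ → SurfaceMetric X}
  {B : SpinorBundle g} {ε : ∀ p, B.S p}
  {nab : CovariantDerivative IM (ℝ × ℝ × E2) (TangentSpace IM : ℝ × ℝ × X → Type _)}
  {D : CovariantDerivative IM E4 B.S}

/-- Pair `z·ε + e·z·ε = 2 q(e, z) ε` with `N·ε`. Since `e` fixes `ε` and anticommutes with `N`, both
terms on the left give the same number, while `⟨ε, N·ε⟩ = 1`. -/
theorem pairing_liftM_nullM (h : HasKundtForm g H F β q)
    (had : ∀ (p : ℝ × ℝ × X) (w : TangentSpace IM p),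
      g.val p (partialV p) w = B.diracCurrent ε p w) {p : ℝ × ℝ × X} {e : TangentSpace IX p.2.2}
    (he : B.clifford p (liftM β p e) (ε p) = ε p) (z : TangentSpace IX p.2.2) :
    B.pairing p (B.clifford p (liftM β p z) (ε p)) (B.clifford p (nullM H F p) (ε p)) =
      (q p.1).inner p.2.2 e z := by
  have hN : B.pairing p (ε p) (B.clifford p (nullM H F p) (ε p)) = 1 := by
    rw [← HasKundtForm.uForm_nullM (H := H) F p, ← h.val_partialV]
    exact (had p _).symm
  have h1 := congrArg (fun s ↦ B.pairing p s (B.clifford p (nullM H F p) (ε p)))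
    (B.clifford_add_swap p (liftM β p z) (liftM β p e) (ε p))
  have h2 := B.clifford_add_swap p (liftM β p e) (nullM H F p) (ε p)
  rw [h.val_liftM_nullM, he, mul_zero, zero_smul] at h2
  have h3 := eq_neg_of_add_eq_zero_left h2
  simp only [map_add, map_smul, _root_.add_apply, _root_.smul_apply, he, hN, smul_eq_mul,
    h.val_liftM_liftM, B.pairing_clifford p (liftM β p e), h3, map_neg] at h1
  rw [(q p.1).symm p.2.2 z e] at h1
  linarith

/-- A Killing spinor is fixed by the lift of the unit vector `l♯`. -/
theorem clifford_liftM_sharp (hlam : lam ≠ 0) (h : HasKundtForm g H F β q) (hF : IsSmoothFun F)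
    (had : ∀ (p : ℝ × ℝ × X) (w : TangentSpace IM p),
      g.val p (partialV p) w = B.diracCurrent ε p w)
    (hε : ContMDiff IM (IM.prod 𝓘(ℝ, E4)) ∞ (fun p ↦ TotalSpace.mk' E4 p (ε p)))
    (hs : B.IsSpinLeviCivita nab D)
    (hD : ∀ (p : ℝ × ℝ × X) (v : TangentSpace IM p), D ε p v = (lam / 2) • B.clifford p v (ε p))
    (p : ℝ × ℝ × X) :
    lForm lam F p.1 p.2.2 (sharp (q p.1) p.2.2 (lForm lam F p.1 p.2.2)) = 1 ∧
    B.clifford p (liftM β p (sharp (q p.1) p.2.2 (lForm lam F p.1 p.2.2))) (ε p) = ε p := by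
  obtain ⟨e, he, hfix⟩ := exists_liftM_fix h had p
  have hd := hs.isExtDerivAt_diracCurrent hε hD (u := uForm F)
    (fun p v ↦ by rw [← h.val_partialV]; exact had p v) p
  -- The two expressions for `du` are evaluated on the lift of `z` and on `N`: one gives `2 lam q(e,
  -- z)`, the other `d_X F(z)`.
  have hl : ∀ z, (q p.1).inner p.2.2 e z = lForm lam F p.1 p.2.2 z := fun z ↦ by
    have h1 := hd.unique (isExtDerivAt_uForm hF p) (liftM β p z) (nullM H F p)
    rw [pairing_liftM_nullM h had hfix, HasKundtForm.uForm_nullM, dX_eq_lForm hlam] at h1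
    simp only [liftM, nullM, projX_vecM, map_zero, zero_mul, sub_zero, mul_one,
      _root_.smul_apply, smul_eq_mul] at h1
    exact mul_left_cancel₀ (mul_ne_zero two_ne_zero hlam) h1
  have e1 := eq_sharp hl
  rw [← e1, ← hl]
  exact ⟨he, hfix⟩

theorem mdifferentiableAt_liftM (hβ : ∀ p, SmoothFormAt β p) {Z : ℝ → ∀ x : X, TangentSpace IX x}
    (hZ : ∀ p, SmoothVecAt Z p) (p : ℝ × ℝ × X) :
    MDifferentiableAt IM IM.tangent
      (fun m ↦ (liftM β m (Z m.1 m.2.2) : TangentBundle IM (ℝ × ℝ × X))) p := by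
  have h1 : IsSmoothFun fun t x ↦ -β t x (Z t x) := fun m ↦ ((hβ m).apply (hZ m)).neg
  exact (contMDiffAt_vecM (a := fun _ ↦ 0) contMDiffAt_const (h1.comp_projUX p)
    (hZ _)).mdifferentiableAt (by simp)

theorem smoothVecAt_zero (p : ℝ × X) : SmoothVecAt (fun _ x ↦ (0 : TangentSpace IX x)) p :=
  SmoothVecAt.of_coeff (f := fun _ _ ↦ 0) (fun _ ↦ contMDiffAt_const) (by simp)

theorem mdifferentiableAt_nullM (hH : IsSmoothFun H) (hF : IsSmoothFun F) (p : ℝ × ℝ × X) :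
    MDifferentiableAt IM IM.tangent
      (fun m ↦ (nullM H F m : TangentBundle IM (ℝ × ℝ × X))) p := by
  have h1 : IsSmoothFun fun t x ↦ 1 / 2 * H t x * Real.exp (-1 * F t x) :=
    (contMDiff_const.mul hH).mul (hF.exp_mul (-1))
  have h2 : IsSmoothFun fun t x ↦
      -(1 / 2 * H t x * Real.exp (-1 * F t x)) * Real.exp (-1 * F t x) :=
    (ContMDiff.neg h1).mul (hF.exp_mul (-1))
  exact (contMDiffAt_vecM (Z := fun _ _ ↦ 0) ((hF.exp_mul (-1)).comp_projUX p) (h2.comp_projUX p)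
    (smoothVecAt_zero _)).mdifferentiableAt (by simp)

/-- The shape operator of the field `L` fixing a Killing spinor. -/
theorem projX_nab (h : HasKundtForm g H F β q)
    (had : ∀ (p : ℝ × ℝ × X) (w : TangentSpace IM p),
      g.val p (partialV p) w = B.diracCurrent ε p w)
    (hε : ContMDiff IM (IM.prod 𝓘(ℝ, E4)) ∞ (fun p ↦ TotalSpace.mk' E4 p (ε p)))
    (hs : B.IsSpinLeviCivita nab D)
    (hD : ∀ (p : ℝ × ℝ × X) (v : TangentSpace IM p), D ε p v = (lam / 2) • B.clifford p v (ε p))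
    {L : ∀ p : ℝ × ℝ × X, TangentSpace IM p} (hL : ∀ p, B.clifford p (L p) (ε p) = ε p)
    {p : ℝ × ℝ × X}
    (hd : MDifferentiableAt IM IM.tangent (fun y ↦ (L y : TangentBundle IM (ℝ × ℝ × X))) p)
    (v : TangentSpace IM p) :
    projX p (nab L p v) = lam • (projX p v - g.val p (L p) v • projX p (L p)) := by
  have h0 := hs.clifford_nab_eq hε hD hL hd v
  -- `W` kills `ε`, hence `u(W) = 0` and `g(W, W) = 0`. Without a `dx_u` component, `g(W, W)` is the
  -- squared `q`-length of the projection of `W`, which must vanish.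
  set W := nab L p v - lam • (v - g.val p (L p) v • L p) with hW
  have hu : ∀ w, uForm F p w = B.pairing p (ε p) (B.clifford p w (ε p)) := fun w ↦ by
    rw [← h.val_partialV]; exact had p w
  have hε0 : ε p ≠ 0 := fun h0 ↦ by
    have := hu (nullM H F p)
    rw [HasKundtForm.uForm_nullM, h0] at this
    simp at this
  have h1 : dxu p W = 0 := by
    have := hu W
    rw [h0, map_zero, uForm, _root_.smul_apply, smul_eq_mul] at this
    exact (mul_eq_zero.1 this).resolve_left (Real.exp_pos _).ne'
  have h2 : g.val p W W = 0 := by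
    have := B.clifford_sq p W (ε p)
    rw [h0, map_zero] at this
    exact (smul_eq_zero.1 this.symm).resolve_right hε0
  rw [h, h1] at h2
  have h3 : projX p W = 0 := inner_self_eq_zero' (q p.1) (by linarith)
  rw [hW, map_sub, map_smul, map_sub, map_smul] at h3
  exact sub_eq_zero.1 h3

theorem val_liftM_sharp (h : HasKundtForm g H F β q)
    (θ : ℝ → ∀ x : X, TangentSpace IX x →L[ℝ] ℝ) (p : ℝ × ℝ × X) (v : TangentSpace IM p) :
    g.val p (liftM β p (sharp (q p.1) p.2.2 (θ p.1 p.2.2))) v = pullForm θ p v := by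
  rw [h.val_liftM, sharp_spec]
  rfl

/-- The structure equations of a Killing spinor. -/
theorem isFrameData_of_killing (h : HasKundtForm g H F β q) (hH : IsSmoothFun H)
    (hF : IsSmoothFun F) (hβ : ∀ p, SmoothFormAt β p) (hq : IsSmoothMetric q)
    (hn : ∀ p, SmoothFormAt n p)
    (ho : ∀ t x, IsOrthoCoframe (q t) x (lForm lam F t x) (n t x))
    (hLC : IsLeviCivita IM g.val nab)
    (hnab : ∀ (p : ℝ × ℝ × X) (v : TangentSpace IM p),
      n p.1 p.2.2 (projX p (nab
        (fun p ↦ liftM β p (sharp (q p.1) p.2.2 (lForm lam F p.1 p.2.2))) p v)) =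
      lam * n p.1 p.2.2 (projX p v)) :
    IsFrameData lam F q n β := by
  have hl := smoothFormAt_lForm lam hF (X := X)
  let L : ∀ p : ℝ × ℝ × X, TangentSpace IM p := fun p ↦
    liftM β p (sharp (q p.1) p.2.2 (lForm lam F p.1 p.2.2))
  let A : ∀ p : ℝ × ℝ × X, TangentSpace IM p := fun p ↦
    liftM β p (sharp (q p.1) p.2.2 (n p.1 p.2.2))
  let N : ∀ p : ℝ × ℝ × X, TangentSpace IM p := nullM H F
  have dL : ∀ p, MDifferentiableAt IM IM.tangent
      (fun y ↦ (L y : TangentBundle IM (ℝ × ℝ × X))) p :=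
    mdifferentiableAt_liftM hβ fun p ↦ hq.sharp (hl p)
  have dA : ∀ p, MDifferentiableAt IM IM.tangent
      (fun y ↦ (A y : TangentBundle IM (ℝ × ℝ × X))) p :=
    mdifferentiableAt_liftM hβ fun p ↦ hq.sharp (hn p)
  have dN : ∀ p, MDifferentiableAt IM IM.tangent
      (fun y ↦ (N y : TangentBundle IM (ℝ × ℝ × X))) p := mdifferentiableAt_nullM hH hF
  have gL : ∀ p v, g.val p (L p) v = pullForm (lForm lam F) p v := val_liftM_sharp h _
  have gA : ∀ p v, g.val p (A p) v = pullForm n p v := val_liftM_sharp h _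
  have pA : ∀ p, projX p (A p) = sharp (q p.1) p.2.2 (n p.1 p.2.2) := fun p ↦ projX_vecM _ _ _ _
  have pL : ∀ p, projX p (L p) = sharp (q p.1) p.2.2 (lForm lam F p.1 p.2.2) := fun p ↦
    projX_vecM _ _ _ _
  have pN : ∀ p, projX p (N p) = 0 := fun p ↦ projX_vecM _ _ _ _
  have uA : ∀ p, dxu p (A p) = 0 := fun p ↦ dxu_vecM _ _ _ _
  have uL : ∀ p, dxu p (L p) = 0 := fun p ↦ dxu_vecM _ _ _ _
  have uN : ∀ p, dxu p (N p) = Real.exp (-F p.1 p.2.2) := fun p ↦ by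
    rw [← neg_one_mul]; exact dxu_vecM _ _ _ _
  have gAA : ∀ p, g.val p (A p) (A p) = 1 := fun p ↦ by
    obtain ⟨-, -, -, h4, -⟩ := (ho p.1 p.2.2).exists_dual
    rw [gA, pullForm, ContinuousLinearMap.comp_apply, pA, h4]
  have gAL : ∀ p, g.val p (A p) (L p) = 0 := fun p ↦ by
    obtain ⟨-, h2, -, -, -⟩ := (ho p.1 p.2.2).exists_dual
    rw [gA, pullForm, ContinuousLinearMap.comp_apply, pL, h2]
  have gAN : ∀ p, g.val p (A p) (N p) = 0 := fun p ↦ h.val_liftM_nullM p _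
  have gLN : ∀ p, g.val p (L p) (N p) = 0 := fun p ↦ h.val_liftM_nullM p _
  have hk : IsSmoothFun fun t x ↦ 1 / 2 * H t x * Real.exp (-1 * F t x) :=
    (contMDiff_const.mul hH).mul (hF.exp_mul (-1))
  have gAnab : ∀ p v, g.val p (A p) (nab L p v) = lam * n p.1 p.2.2 (projX p v) := fun p v ↦ by
    rw [gA]; exact hnab p v
  -- With `A` dual to `n`, `dn(l♯, n♯) = g(∇_L A, A) - g(∇_A A, L)`. The first term vanishes, and
  -- the second is `g(A, ∇_A L) = lam`.
  have key : ∀ (t : ℝ) (x : X) (η : TangentSpace IX x → TangentSpace IX x → ℝ),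
      IsExtDerivAt IX (n t) x η →
      η (sharp (q t) x (lForm lam F t x)) (sharp (q t) x (n t x)) = lam := by
    intro t x η hη
    obtain ⟨p, rfl, rfl⟩ : ∃ p : ℝ × ℝ × X, p.1 = t ∧ p.2.2 = x := ⟨(t, 0, x), rfl, rfl⟩
    have h1 := ((hn (p.1, p.2.2)).isExtDerivAt_pullForm hη).unique
      (hLC.isExtDerivAt (fun x v ↦ (gA x v).symm) (dA p)) (L p) (A p)
    rw [uA, uL, pA, pL] at h1
    have h2 := hLC.add_eq_zero gAA (dA p) (dA p) (L p)
    have h3 := hLC.add_eq_zero gAL (dA p) (dL p) (A p)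
    obtain ⟨-, -, -, h4, -⟩ := (ho p.1 p.2.2).exists_dual
    rw [gAnab, pA, h4] at h3
    rw [g.symm p (A p)] at h2
    linarith
  refine ⟨hF, hn, hβ, ho, fun t x ↦ ?_, fun t x ↦ ?_⟩
  · obtain ⟨η, hη, -⟩ := SmoothFormAt.exists_isExtDerivAt (p := (t, 0, x)) (hn (t, x))
    have hfd : FormDiffAt IX (n t) x := (hn (t, x)).formDiffAt
    refine IsExtDerivAt.congr_right hη fun v w ↦ ?_
    rw [(ho t x).alt_eq (A := η) (fun u v w ↦ ?_) (fun c v w ↦ ?_) hη.swap v w, key t x η hη]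
    · rw [hη.swap, hη.add_right hfd, hη.swap w u, hη.swap w v]; ring
    · rw [hη.swap, hη.smul_right hfd, hη.swap w v]; ring
  · obtain ⟨η, hη, -⟩ := SmoothFormAt.exists_isExtDerivAt (p := (t, 0, x)) (hβ (t, x))
    obtain ⟨ζ, hζ, -⟩ := SmoothFormAt.exists_isExtDerivAt (p := (t, 0, x)) (hn (t, x))
    have hfd : FormDiffAt IX (β t) x := (hβ (t, x)).formDiffAt
    refine IsExtDerivAt.congr_right hη fun v w ↦ ?_
    rw [(ho t x).alt_eq (A := η) (fun u v w ↦ ?_) (fun c v w ↦ ?_) hη.swap v w]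
    · congr 1
      obtain ⟨p, rfl, rfl⟩ : ∃ p : ℝ × ℝ × X, p.1 = t ∧ p.2.2 = x := ⟨(t, 0, x), rfl, rfl⟩
      -- By orthogonality, `dβ(l♯, n♯) = g(∇_A L, N) - g(∇_L A, N)`. The same two terms appear in
      -- `dl(N, A)` and `dn(N, L)`, which equal `e^{-F} ∂_u l(n♯)` and `e^{-F} ∂_u n(l♯)`, because
      -- `∇_N L` has no component along `A`.
      have w1 := (isExtDerivAt_wForm (p := p) hk (hβ _) hη).unique
        (hLC.isExtDerivAt (fun x v ↦ (h.val_nullM x v).symm) (dN p)) (L p) (A p)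
      have l1 := ((hl (p.1, p.2.2)).isExtDerivAt_pullForm
        (isExtDerivAt_lForm lam hF p.1 p.2.2)).unique
        (hLC.isExtDerivAt (fun x v ↦ (gL x v).symm) (dL p)) (N p) (A p)
      have n1 := ((hn (p.1, p.2.2)).isExtDerivAt_pullForm hζ).unique
        (hLC.isExtDerivAt (fun x v ↦ (gA x v).symm) (dA p)) (N p) (L p)
      have z1 : ζ 0 (sharp (q p.1) p.2.2 (lForm lam F p.1 p.2.2)) = 0 := by
        have := hζ.smul_right (hn (p.1, p.2.2)).formDiffAt 0
          (sharp (q p.1) p.2.2 (lForm lam F p.1 p.2.2)) 0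
        rw [hζ.swap]
        simpa using this
      rw [uA, uL, pA, pL] at w1
      rw [uA, uN, pA, pN] at l1
      rw [uL, uN, pL, pN, z1] at n1
      have h1 := hLC.add_eq_zero gAN (dA p) (dN p) (L p)
      have h2 := hLC.add_eq_zero gLN (dL p) (dN p) (A p)
      have h3 := hLC.add_eq_zero gAL (dA p) (dL p) (N p)
      rw [gAnab, pN, map_zero] at h3
      have h4 := gAnab p (N p)
      rw [pN, map_zero] at h4
      rw [g.symm p (A p)] at h1 h4
      rw [g.symm p (L p)] at h2
      change _ = g.val p (nab N p (L p)) (A p) - g.val p (nab N p (A p)) (L p) at w1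
      linarith
    · rw [hη.swap, hη.add_right hfd, hη.swap w u, hη.swap w v]; ring
    · rw [hη.swap, hη.smul_right hfd, hη.swap w v]; ring

/-- The Brinkmann one-form is rescaled to `β = e^{-F} α`. The orientation serves to choose the
second covector of the coframe smoothly. -/
theorem IsStandardSusyKundt.exists_isKundtData (o : SurfaceOrientation X)
    (hlam : lam ≠ 0) (h : IsStandardSusyKundt lam g B ε) :
    ∃ (H F : ℝ → X → ℝ) (q : ℝ → SurfaceMetric X)
      (om β : ℝ → ∀ x : X, TangentSpace IX x →L[ℝ] ℝ), IsKundtData lam o g H F q om β := by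
  obtain ⟨⟨H, F, α, q, hH, hF, hα, hq, hc, hg⟩, ⟨hε, nab, D, hs, hD⟩, had⟩ := h
  have hβ : ∀ p, SmoothFormAt (fun t x ↦ Real.exp (-1 * F t x) • α t x) p := fun p ↦
    SmoothFormAt.smul (f := fun t x ↦ Real.exp (-1 * F t x)) ((hF.exp_mul (-1)) p) (hα p)
  have hK : HasKundtForm g H F (fun t x ↦ Real.exp (-1 * F t x) • α t x) q := fun p a b ↦ by
    have hE : Real.exp (F p.1 p.2.2) * Real.exp (-1 * F p.1 p.2.2) = 1 := by
      rw [← Real.exp_add]; simp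
    rw [hg]
    simp only [_root_.smul_apply, smul_eq_mul]
    linear_combination -(dxu p a * α p.1 p.2.2 (projX p b) + α p.1 p.2.2 (projX p a) * dxu p b) * hE
  have hfix := clifford_liftM_sharp hlam hK hF had hε hs hD
  have hl := smoothFormAt_lForm lam hF (X := X)
  obtain ⟨n, hn, ho⟩ := exists_smooth_coframe o hq hl fun t x ↦ (hfix (t, 0, x)).1
  have hf := isFrameData_of_killing hK hH hF hβ hq hn ho hs.leviCivita fun p v ↦ by
    rw [projX_nab hK had hε hs hD (fun p ↦ (hfix p).2)
      (mdifferentiableAt_liftM hβ (fun p ↦ hq.sharp (hl p)) p)]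
    obtain ⟨-, h2, -, -, -⟩ := (ho p.1 p.2.2).exists_dual
    rw [liftM, projX_vecM, map_smul, map_sub, map_smul, h2]
    simp
  exact ⟨_, _, _, _, _, hf.kundtData hlam o hH hc hK⟩

end Reduction

end SusyKundt

end

/-! ### The theorem. -/

open SusyKundt in
theorem mainTheorem1 {X : Type*} [TopologicalSpace X] [T2Space X] [SecondCountableTopology X]
    [ConnectedSpace X] [ChartedSpace E2 X] [IsManifold IX ∞ X]
    (o : SurfaceOrientation X) (lam : ℝ) (hlam : lam ≠ 0)
    (g : LorentzMetric IM (ℝ × ℝ × X)) :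
    ((∃ (B : SpinorBundle g) (ε : ∀ p, B.S p), IsStandardSusyKundt lam g B ε) ↔
      ∃ (H F : ℝ → X → ℝ) (q : ℝ → SurfaceMetric X)
        (om β : ℝ → ∀ x : X, TangentSpace IX x →L[ℝ] ℝ), IsKundtData lam o g H F q om β) ∧
    ∀ (H F : ℝ → X → ℝ) (q : ℝ → SurfaceMetric X)
      (om β : ℝ → ∀ x : X, TangentSpace IX x →L[ℝ] ℝ), IsKundtData lam o g H F q om β →
      ∀ t : ℝ, IsElementaryHyperbolic lam (q t) ∧
        HasScalarCurvature (q t) (-2 * lam ^ 2) ∧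
        (Nonempty (X ≃ₘ^∞⟮IX, 𝓘(ℝ, E2)⟯ E2) ∨
          Nonempty (X ≃ₘ^∞⟮IX, 𝓘(ℝ, ℝ).prod (𝓡 1)⟯ (ℝ × Circle))) := by
  refine ⟨⟨fun ⟨B, ε, h⟩ ↦ h.exists_isKundtData o hlam, fun ⟨H, F, q, om, β, h⟩ ↦ ?_⟩,
    fun H F q om β h t ↦ ?_⟩
  · refine (h.frameData hlam).exists_isStandardSusyKundt hlam h.smooth_H h.complete fun p a b ↦ ?_
    rw [h.metric_M, h.metric_X]
    ring
  · obtain ⟨C, hC⟩ := h.exists_transFrame hlam t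
    have hc := hC.complete (h.complete t)
    exact ⟨hC.isElementaryHyperbolic hc, (h.frameData hlam).hasScalarCurvature t,
      hC.diffeomorph hc⟩
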